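/- **Theorem.** Let $n\ge 1$, let $M$ be $\mathbb C^n$ or a quotient $\mathbb C^n/\Lambda$ by a discrete subgroup $\Lambda$ (for instance a flat torus $T^{2n}$, when $\Lambda$ is a lattice), with its flat metric $\langle\cdot,\cdot\rangle$ and its symplectic form $\omega(\cdot,\cdot)=\langle J\cdot,\cdot\rangle$, and identify every tangent space of $M$ with $\mathbb C^n$. Let $\Sigma$ be a smooth $n$-dimensional manifold, $0<T\le\infty$, and let $F:\Sigma\times[0,T)\to M$ be a smooth Lagrangian mean curvature flow, parametrized in the normal direction: each $F_t=F(\cdot,t)$ is an immersion with $F_t^*\omega=0$, and $$\frac{\partial F}{\partial t}=H,$$ where $H(\cdot,t)$ is the mean curvature vector of $F_t$. Let $g_t$ be the metric on $\Sigma$ induced by $F_t$. Let $LG(n)=U(n)/O(n)$ be the Lagrangian Grassmannian (the class of $U$ is the Lagrangian subspace $U(\mathbb R^n)\subset\mathbb C^n$), with the quotient of the bi-invariant metric $-\operatorname{Re}\operatorname{tr}(XY)$ of $U(n)$. Then the Gauss map $\gamma_t:\Sigma\to LG(n)$, $\gamma_t(p)=dF_t(T_p\Sigma)$, is well defined, depends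 smoothly on $(p,t)\in\Sigma\times[0,T)$, and is a harmonic map heat flow with respect to the evolving metrics $g_t$: $$\frac{\partial\gamma_t}{\partial t}=\tau_{g_t}(\gamma_t),\qquad \tau_{g}(\gamma)=\operatorname{tr}_{g}\nabla d\gamma .$$ If $\Sigma$ is oriented, the same holds for the Gauss map $\gamma_t:\Sigma\to U(n)/SO(n)$ into the double cover of $LG(n)$ (with the quotient metric), the Grassmannian of oriented Lagrangian subspaces, where $dF_t(T_p\Sigma)$ carries the orientation of $T_p\Sigma$. -/

import Mathlib

open Set Matrix Topology
open scoped Manifold ContDiff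

/-! ### Ambient spaces: `ℂⁿ` and its quotients by discrete subgroups -/

/-- `ℝⁿ` with its Euclidean norm, the model space of an `n`-dimensional manifold. -/
abbrev Rn (n : ℕ) : Type := EuclideanSpace ℝ (Fin n)

/-- `ℂⁿ` with its Hermitian norm. -/
abbrev Cn (n : ℕ) : Type := EuclideanSpace ℂ (Fin n)

/-- The standard Riemannian metric `⟨v, w⟩` of `ℂⁿ = ℝ²ⁿ`. -/
noncomputable def realInner {n : ℕ} (v w : Cn n) : ℝ := (inner ℂ v w).re

/-- The standard symplectic form `ω(v, w) = ⟨J v, w⟩ = ∑ dxⁱ ∧ dyⁱ` of `ℂⁿ`, with `J v = i v`. -/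
noncomputable def symplecticForm {n : ℕ} (v w : Cn n) : ℝ := realInner (Complex.I • v) w

section Torus

variable {n : ℕ} (Λ : AddSubgroup (Cn n)) [DiscreteTopology Λ]

theorem isLocalHomeomorph_mk :
    IsLocalHomeomorph (QuotientAddGroup.mk : Cn n → Cn n ⧸ Λ) :=
  (Λ.isAddQuotientCoveringMap_of_comm ⟨inferInstance⟩).isCoveringMap.isLocalHomeomorph

/-- For a discrete subgroup `Λ ⊆ ℂⁿ` (for a lattice, `ℂⁿ ⧸ Λ` is a flat torus) the manifold
`ℂⁿ ⧸ Λ` has the local inverses of the covering `ℂⁿ → ℂⁿ ⧸ Λ` as charts. The transition functions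
are locally translations, so all tangent spaces are identified with `ℂⁿ`, and the flat metric, the
complex structure and the Levi-Civita connection are those of `ℂⁿ` in each chart. -/
noncomputable instance quotientChartedSpace : ChartedSpace (Cn n) (Cn n ⧸ Λ) :=
  (isLocalHomeomorph_mk Λ).chartedSpace Quotient.mk_surjective

/-- Near each point of its domain, a transition function is a translation. -/
theorem quotient_transition {e e' : OpenPartialHomeomorph (Cn n ⧸ Λ) (Cn n)}
    (he : e ∈ atlas (Cn n) (Cn n ⧸ Λ)) (he' : e' ∈ atlas (Cn n) (Cn n ⧸ Λ))
    {x : Cn n} (hx : x ∈ (e.symm.trans e').source) :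
    ∃ v : Cn n, ∀ᶠ y in 𝓝 x, (e.symm.trans e') y = y + v := by
  have key : ∀ f ∈ atlas (Cn n) (Cn n ⧸ Λ), ∀ y ∈ f.target,
      f.symm y = QuotientAddGroup.mk y := by
    rintro f ⟨q, rfl⟩ y _
    simp [chartAt_self_eq]
  have hmk : ∀ y ∈ (e.symm.trans e').source, (e.symm.trans e') y - y ∈ Λ := by
    intro y hy
    have hy' := hy
    rw [OpenPartialHomeomorph.trans_source] at hy'
    have h1 := key e he y (by simpa using hy'.1)
    have h2 := key e' he' (e' (e.symm y)) (e'.map_source hy'.2)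
    rw [e'.left_inv hy'.2, h1, QuotientAddGroup.eq] at h2
    simpa [h1, sub_eq_neg_add] using h2
  have hnhds : ∀ᶠ y in 𝓝 x, y ∈ (e.symm.trans e').source :=
    (e.symm.trans e').open_source.mem_nhds hx
  obtain ⟨V, hV, hVΛ⟩ : ∃ V ∈ 𝓝 ((e.symm.trans e') x - x), ∀ w ∈ V, w ∈ Λ →
      w = (e.symm.trans e') x - x := by
    have h := isOpen_discrete ({⟨_, hmk x hx⟩} : Set Λ)
    obtain ⟨V, hVo, hV⟩ := isOpen_induced_iff.1 h
    refine ⟨V, hVo.mem_nhds ?_, fun w hw hwΛ => ?_⟩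
    · have : (⟨_, hmk x hx⟩ : Λ) ∈ Subtype.val ⁻¹' V := by rw [hV]; rfl
      exact this
    · have : (⟨w, hwΛ⟩ : Λ) ∈ Subtype.val ⁻¹' V := hw
      rw [hV] at this
      exact congrArg Subtype.val this
  have hcont : ContinuousAt (fun y => (e.symm.trans e') y - y) x :=
    ((e.symm.trans e').continuousAt hx).sub continuousAt_id
  refine ⟨(e.symm.trans e') x - x, ?_⟩
  filter_upwards [hnhds, hcont hV] with y hy hyV
  rw [← hVΛ _ hyV (hmk y hy), add_sub_cancel]

instance quotient_isManifold : IsManifold 𝓘(ℝ, Cn n) ∞ (Cn n ⧸ Λ) := by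
  refine isManifold_of_contDiffOn _ _ _ fun e e' he he' x hx => ?_
  obtain ⟨v, hv⟩ := quotient_transition Λ he he' (by simpa using hx.1)
  refine ContDiffAt.contDiffWithinAt ?_
  refine (contDiffAt_id.add (contDiffAt_const (c := v))).congr_of_eventuallyEq ?_
  simpa [Filter.EventuallyEq] using hv

end Torus

/-! ### Calculus in local coordinates -/

/-- The partial derivative `∂ᵢ h` of a function on `ℝⁿ`. -/
noncomputable def partialDeriv {n : ℕ} {V : Type*} [NormedAddCommGroup V] [NormedSpace ℝ V]
    (i : Fin n) (h : Rn n → V) (x : Rn n) : V :=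
  fderiv ℝ h x (EuclideanSpace.single i 1)

/-- The Christoffel symbol `Γᵏᵢⱼ = ½ ∑ₗ gᵏˡ (∂ᵢ gⱼₗ + ∂ⱼ gᵢₗ - ∂ₗ gᵢⱼ)` of a metric on `ℝⁿ`. -/
noncomputable def christoffel {n : ℕ} (G : Rn n → Matrix (Fin n) (Fin n) ℝ) (x : Rn n)
    (k i j : Fin n) : ℝ :=
  2⁻¹ * ∑ l, (G x)⁻¹ k l *
    (partialDeriv i (fun y => G y j l) x + partialDeriv j (fun y => G y i l) x
      - partialDeriv l (fun y => G y i j) x)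

section Domain

variable {n : ℕ} {S : Type*} [TopologicalSpace S] [ChartedSpace (Rn n) S]

/-- The coefficients `gᵢⱼ` of a metric on `S` in the chart centred at `p`. -/
noncomputable def metricCoeff
    (g : ∀ q : S, TangentSpace (𝓡 n) q → TangentSpace (𝓡 n) q → ℝ) (p : S) (x : Rn n) :
    Matrix (Fin n) (Fin n) ℝ :=
  Matrix.of fun i j =>
    g ((extChartAt (𝓡 n) p).symm x)
      (mfderiv 𝓘(ℝ, Rn n) (𝓡 n) (extChartAt (𝓡 n) p).symm x (EuclideanSpace.single i 1))
      (mfderiv 𝓘(ℝ, Rn n) (𝓡 n) (extChartAt (𝓡 n) p).symm x (EuclideanSpace.single j 1))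

/-- The Laplace-Beltrami operator `Δ_g u = ∑ gⁱʲ (∂ᵢ ∂ⱼ u - ∑ₖ Γᵏᵢⱼ ∂ₖ u)`, applied to a
vector-valued function. -/
noncomputable def laplaceBeltrami {E : Type*} [NormedAddCommGroup E] [NormedSpace ℝ E]
    (g : ∀ q : S, TangentSpace (𝓡 n) q → TangentSpace (𝓡 n) q → ℝ) (u : S → E) (p : S) : E :=
  let G := metricCoeff g p
  let h : Rn n → E := u ∘ (extChartAt (𝓡 n) p).symm
  let x := extChartAt (𝓡 n) p p
  ∑ i, ∑ j, (G x)⁻¹ i j •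
    (partialDeriv i (partialDeriv j h) x - ∑ k, christoffel G x k i j • partialDeriv k h x)

/-! ### The harmonic map heat flow into an isometrically immersed Riemannian manifold -/

/-- The image under `dι` of the tangent space at `y` of a manifold `N` immersed by `ι : N → E`:
the velocities of the curves through `y`. -/
def immersedTangentSpace {N : Type*} [TopologicalSpace N] {E : Type*} [NormedAddCommGroup E]
    [NormedSpace ℝ E] (ι : N → E) (y : N) : Submodule ℝ E :=
  Submodule.span ℝ {v | ∃ c : ℝ → N, Continuous c ∧ c 0 = y ∧ HasDerivAt (ι ∘ c) v 0}

/-- The tension field `τ_g(u) = tr_g ∇du` of a map `u : S → N` into a Riemannian manifold `N`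
isometrically immersed by `ι : N → E` in a Euclidean space, as a vector `dι(τ_g(u))` of `E`: the
tangential part of the Laplacian of `ι ∘ u`. -/
noncomputable def tensionField {N : Type*} [TopologicalSpace N] {E : Type*} [NormedAddCommGroup E]
    [InnerProductSpace ℝ E] [FiniteDimensional ℝ E] (ι : N → E)
    (g : ∀ q : S, TangentSpace (𝓡 n) q → TangentSpace (𝓡 n) q → ℝ) (u : S → N) (p : S) : E :=
  (immersedTangentSpace ι (u p)).starProjection (laplaceBeltrami g (ι ∘ u) p)

/-- `γ` is, for the times in the interval `J`, a smooth solution `∂γ/∂t = τ_{g(t)}(γ)` of the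
harmonic map heat flow from `S` with the time-dependent metric `g` to the Riemannian manifold `N`
isometrically immersed by `ι : N → E`. At an end point of `J` the time derivative is one-sided. -/
structure IsHarmonicMapHeatFlow {N : Type*} [TopologicalSpace N] {E : Type*}
    [NormedAddCommGroup E] [InnerProductSpace ℝ E] [FiniteDimensional ℝ E] (ι : N → E)
    (J : Set ℝ) (g : ℝ → ∀ q : S, TangentSpace (𝓡 n) q → TangentSpace (𝓡 n) q → ℝ)
    (γ : ℝ → S → N) : Prop where
  continuousOn : ContinuousOn (fun z : ℝ × S => γ z.1 z.2) (J ×ˢ univ)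
  smoothOn : ContMDiffOn (𝓘(ℝ, ℝ).prod (𝓡 n)) 𝓘(ℝ, E) ∞
    (fun z : ℝ × S => ι (γ z.1 z.2)) (J ×ˢ univ)
  heat_eq : ∀ t ∈ J, ∀ p : S,
    derivWithin (fun s => ι (γ s p)) J t = tensionField ι (g t) (γ t) p

/-! ### Lagrangian mean curvature flow

`M` is `ℂⁿ` or `ℂⁿ ⧸ Λ`, and `T_q M = ℂⁿ`. -/

variable {M : Type*} [TopologicalSpace M] [ChartedSpace (Cn n) M]

/-- The differential `dF_p : T_p S → ℂⁿ`. -/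
noncomputable def differential (F : S → M) (p : S) (v : TangentSpace (𝓡 n) p) : Cn n :=
  mfderiv (𝓡 n) 𝓘(ℝ, Cn n) F p v

/-- The metric on `S` induced by `F : S → M`. -/
noncomputable def inducedMetric (F : S → M) (p : S) (v w : TangentSpace (𝓡 n) p) : ℝ :=
  realInner (differential F p v) (differential F p w)

/-- The mean curvature vector `H = ∑ gⁱʲ (∂ᵢ ∂ⱼ F)^⊥` of an immersion `F : S → M`, computed in
coordinates; the normal part of `v` is `v - ∑ gᵏˡ ⟨v, ∂ₖ F⟩ ∂ₗ F`. -/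
noncomputable def meanCurvature (F : S → M) (p : S) : Cn n :=
  let h : Rn n → Cn n := writtenInExtChartAt (𝓡 n) 𝓘(ℝ, Cn n) p F
  let x := extChartAt (𝓡 n) p p
  let G : Matrix (Fin n) (Fin n) ℝ :=
    Matrix.of fun i j => realInner (partialDeriv i h x) (partialDeriv j h x)
  let normalPart : Cn n → Cn n := fun v =>
    v - ∑ k, ∑ l, (G⁻¹ k l * realInner v (partialDeriv k h x)) • partialDeriv l h x
  ∑ i, ∑ j, G⁻¹ i j • normalPart (partialDeriv i (partialDeriv j h) x)

/-- The time interval `[0, T)`, where `T` may be `∞`. -/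
def timeInterval (T : EReal) : Set ℝ := {t | 0 ≤ t ∧ (t : EReal) < T}

/-- `F : S × [0, T) → M` is a smooth family of Lagrangian immersions moving by its mean curvature
vector, `∂F/∂t = H`. -/
structure IsLagrangianMeanCurvatureFlow (T : EReal) (F : ℝ → S → M) : Prop where
  smoothOn : ContMDiffOn (𝓘(ℝ, ℝ).prod (𝓡 n)) 𝓘(ℝ, Cn n) ∞
    (fun z : ℝ × S => F z.1 z.2) (timeInterval T ×ˢ univ)
  immersion : ∀ t ∈ timeInterval T, ∀ p : S, Function.Injective (differential (n := n) (F t) p)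
  lagrangian : ∀ t ∈ timeInterval T, ∀ p : S, ∀ v w : TangentSpace (𝓡 n) p,
    symplecticForm (differential (F t) p v) (differential (F t) p w) = 0
  flow : ∀ t ∈ timeInterval T, ∀ p : S,
    (mfderivWithin 𝓘(ℝ, ℝ) 𝓘(ℝ, Cn n) (fun s => F s p) (timeInterval T) t (1 : ℝ) : Cn n)
      = meanCurvature (F t) p

/-- `o` is a (continuous) orientation of the manifold `S`: near each point there is a smooth chart
whose coordinate frames are positively oriented. -/
def IsManifoldOrientation (o : ∀ p : S, Orientation ℝ (TangentSpace (𝓡 n) p) (Fin n)) : Prop :=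
  ∀ p₀ : S, ∃ e ∈ IsManifold.maximalAtlas (𝓡 n) ∞ S, p₀ ∈ e.source ∧ ∀ p ∈ e.source,
    ∃ b : Module.Basis (Fin n) ℝ (TangentSpace (𝓡 n) p),
      (∀ i, b i = mfderiv 𝓘(ℝ, Rn n) (𝓡 n) e.symm (e p) (EuclideanSpace.single i 1)) ∧
      b.orientation = o p

end Domain

/-! ### The Lagrangian Grassmannians `U(n)/O(n)` and `U(n)/SO(n)` -/

/-- The subgroup `O(n)` of `U(n)`. -/
def orthogonalSubgroup (n : ℕ) : Subgroup (Matrix.unitaryGroup (Fin n) ℂ) where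
  carrier := {U | ∃ A ∈ Matrix.orthogonalGroup (Fin n) ℝ,
    (U : Matrix (Fin n) (Fin n) ℂ) = A.map Complex.ofReal}
  mul_mem' := by
    rintro U V ⟨A, hA, hU⟩ ⟨B, hB, hV⟩
    exact ⟨A * B, mul_mem hA hB, by
      rw [Matrix.UnitaryGroup.mul_val, hU, hV]; exact (Matrix.map_mul (f := Complex.ofRealHom)).symm⟩
  one_mem' := ⟨1, one_mem _, by simp⟩
  inv_mem' := by
    rintro U ⟨A, hA, hU⟩
    exact ⟨star A, (star (⟨A, hA⟩ : Matrix.orthogonalGroup (Fin n) ℝ)).2, by rw [Matrix.UnitaryGroup.inv_val, hU]; ext i j; simp⟩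

/-- The subgroup `SO(n)` of `U(n)`. -/
def specialOrthogonalSubgroup (n : ℕ) : Subgroup (Matrix.unitaryGroup (Fin n) ℂ) where
  carrier := {U | ∃ A ∈ Matrix.specialOrthogonalGroup (Fin n) ℝ,
    (U : Matrix (Fin n) (Fin n) ℂ) = A.map Complex.ofReal}
  mul_mem' := by
    rintro U V ⟨A, hA, hU⟩ ⟨B, hB, hV⟩
    exact ⟨A * B, mul_mem hA hB, by
      rw [Matrix.UnitaryGroup.mul_val, hU, hV]; exact (Matrix.map_mul (f := Complex.ofRealHom)).symm⟩
  one_mem' := ⟨1, one_mem _, by simp⟩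
  inv_mem' := by
    rintro U ⟨A, hA, hU⟩
    exact ⟨star A, (star (⟨A, hA⟩ : Matrix.specialOrthogonalGroup (Fin n) ℝ)).2, by rw [Matrix.UnitaryGroup.inv_val, hU]; ext i j; simp⟩

/-- The Lagrangian Grassmannian `U(n)/O(n)`: the class of `U` is the Lagrangian subspace
`U(ℝⁿ) ⊆ ℂⁿ`, the real span of the columns of `U`. -/
abbrev LagrangianGrassmannian (n : ℕ) : Type :=
  Matrix.unitaryGroup (Fin n) ℂ ⧸ orthogonalSubgroup n

/-- The Grassmannian `U(n)/SO(n)` of oriented Lagrangian subspaces: the class of `U` is `U(ℝⁿ)`,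
oriented by the columns of `U`. -/
abbrev OrientedLagrangianGrassmannian (n : ℕ) : Type :=
  Matrix.unitaryGroup (Fin n) ℂ ⧸ specialOrthogonalSubgroup n

/-- The map `U(n)/SO(n) → U(n)/O(n)` that forgets the orientation. -/
def forgetOrientation (n : ℕ) :
    OrientedLagrangianGrassmannian n → LagrangianGrassmannian n :=
  Subgroup.quotientMapOfLE fun _ ⟨A, hA, hU⟩ =>
    ⟨A, (Matrix.mem_specialOrthogonalGroup_iff.1 hA).1, hU⟩

/-- The isometric embedding `[U] ↦ ½ U Uᵀ` of `U(n)/O(n)` in the space of complex `n × n` matrices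
with the Frobenius norm. The metric of `U(n)/O(n)` that it induces is the standard one, which is
the quotient of the bi-invariant metric `-Re tr (X Y)` of `U(n)`: the horizontal vectors `U X` at
`U`, where `X` is `i` times a real symmetric matrix, are mapped to `U X Uᵀ`, of the same norm. -/
noncomputable def cartanEmbedding (n : ℕ) :
    LagrangianGrassmannian n → EuclideanSpace ℂ (Fin n × Fin n) :=
  Quotient.lift
    (fun U : Matrix.unitaryGroup (Fin n) ℂ => WithLp.toLp 2 fun ij : Fin n × Fin n =>
      2⁻¹ * ((U : Matrix (Fin n) (Fin n) ℂ) * (U : Matrix (Fin n) (Fin n) ℂ)ᵀ) ij.1 ij.2)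
    (by
      intro U V h
      obtain ⟨A, hA, hUV⟩ := QuotientGroup.leftRel_apply.1 h
      have hV : (V : Matrix (Fin n) (Fin n) ℂ) = U * A.map Complex.ofReal := by
        rw [← hUV, ← Matrix.UnitaryGroup.mul_val, mul_inv_cancel_left]
      have hA' : A.map Complex.ofReal * (A.map Complex.ofReal)ᵀ = 1 := by
        have h := congrArg (Complex.ofRealHom.mapMatrix (m := Fin n))
          ((Matrix.mem_orthogonalGroup_iff _ _).1 hA)
        rw [map_mul, map_one] at h
        exact h
      simp only [hV, Matrix.transpose_mul]
      rw [Matrix.mul_assoc, ← Matrix.mul_assoc (A.map Complex.ofReal), hA', Matrix.one_mul])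

/-- The isometric immersion `[U] ↦ ½ U Uᵀ` of the double covering `U(n)/SO(n)` of `U(n)/O(n)`. -/
noncomputable def cartanImmersion (n : ℕ) :
    OrientedLagrangianGrassmannian n → EuclideanSpace ℂ (Fin n × Fin n) :=
  cartanEmbedding n ∘ forgetOrientation n

/-- The `j`-th column of a matrix, as a vector of `ℂⁿ`. -/
noncomputable def column {n : ℕ} (U : Matrix.unitaryGroup (Fin n) ℂ) (j : Fin n) : Cn n :=
  WithLp.toLp 2 fun i => (U : Matrix (Fin n) (Fin n) ℂ) i j

section GaussMap

variable {n : ℕ} {S : Type*} [TopologicalSpace S] [ChartedSpace (Rn n) S]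
  {M : Type*} [TopologicalSpace M] [ChartedSpace (Cn n) M]

/-- `γ t p = [U]` is the tangent space `dF_t(T_p S) ⊆ ℂⁿ`: the columns of `U` are the image of a
basis of `T_p S`. -/
def IsGaussMap (J : Set ℝ) (F : ℝ → S → M) (γ : ℝ → S → LagrangianGrassmannian n) : Prop :=
  ∀ t ∈ J, ∀ p : S, ∃ U : Matrix.unitaryGroup (Fin n) ℂ, γ t p = QuotientGroup.mk U ∧
    ∃ b : Module.Basis (Fin n) ℝ (TangentSpace (𝓡 n) p),
      ∀ j, differential (F t) p (b j) = column U j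

/-- `γ t p = [U]` is the tangent space `dF_t(T_p S) ⊆ ℂⁿ` with the orientation carried over from
`S`: the columns of `U` are the image of a positively oriented basis of `T_p S`. -/
def IsOrientedGaussMap (J : Set ℝ) (o : ∀ p : S, Orientation ℝ (TangentSpace (𝓡 n) p) (Fin n))
    (F : ℝ → S → M) (γ : ℝ → S → OrientedLagrangianGrassmannian n) : Prop :=
  ∀ t ∈ J, ∀ p : S, ∃ U : Matrix.unitaryGroup (Fin n) ℂ, γ t p = QuotientGroup.mk U ∧
    ∃ b : Module.Basis (Fin n) ℝ (TangentSpace (𝓡 n) p),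
      (∀ j, differential (F t) p (b j) = column U j) ∧ b.orientation = o p

end GaussMap

/-! The differential of the Gauss map is the second fundamental form, which for a Lagrangian
immersion is the totally symmetric tensor `A k i j = Im ⟨∂ᵢF, ∂ₖ∂ⱼF⟩` (Hermitian product). In a flat
ambient space `∇A` is totally symmetric too (Codazzi), so the tension field `tr ∇A` of the Gauss map
is `∇α`, where `α = tr A` is the mean curvature form `αᵢ = Im ⟨∂ᵢF, H⟩`. A motion with velocity `H`
turns the tangent planes with velocity `Im ⟨∂ᵢF, ∂ⱼH⟩`, which is again `∇α`.

The proof does this with matrices. Let `E` have the columns `∂ⱼF`. If `E = U R` with `U` unitary and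
`R` real, then `Q = U Uᵀ = E Ē⁻¹`; so `Q` is smooth without a smooth choice of `U`, and `½ Q` is the
Gauss map seen in the space of matrices. At `[U]`, the tangent vectors are symmetric `V` with `Uᴴ V
Ū` purely imaginary, and a matrix `W` with `Uᴴ W Ū` real is normal. Replacing `U` by `E` is a real
congruence, which respects both conditions (`starProjection_immersedTangentSpace`). As `Q_t` is
tangent, the heat equation says that `Im (Eᴴ (ΔQ - Q_t) Ē) = 0`.

Differentiating `Q Ē = E` expresses `Eᴴ (DQ) Ē` and `Eᴴ (D²Q) Ē` through derivatives of `E`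
(`first_derivative_form`, `second_derivative_form`). Differentiating `αᵢ = ∑ gᵏˡ A k i l` gives `Im
(Eᴴ E_t)`. The third derivatives of `F` agree because partial derivatives commute, and the remaining
Christoffel terms agree by `trace_contraction`. This is `tangential_laplacian_eq`, applied to the
flow in `evolution_gaussMatrix`.

`exists_isLocalLift` supplies the passage to coordinates: the flow becomes a map into `ℂⁿ` on a
product of a time interval and an open set. Continuity of the Gauss map as a map to the Grassmannian
follows from that of `½ U Uᵀ`, together with `det U` in the oriented case, because these data embed
the compact quotients. -/

/-! ### The pointwise algebra -/

section Algebra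

variable {n : ℕ}

/-- The entrywise complex conjugate of a matrix. -/
abbrev conjM (A : Matrix (Fin n) (Fin n) ℂ) : Matrix (Fin n) (Fin n) ℂ :=
  A.map (starRingEnd ℂ)

theorem conjM_mul (A B : Matrix (Fin n) (Fin n) ℂ) : conjM (A * B) = conjM A * conjM B :=
  Matrix.map_mul

theorem conjM_conjTranspose (A : Matrix (Fin n) (Fin n) ℂ) : conjM Aᴴ = Aᵀ := by
  ext i j; simp

theorem conjM_conjM (A : Matrix (Fin n) (Fin n) ℂ) : conjM (conjM A) = A := by
  ext i j; simp

/-- The transpose of the relation `Q Ē = E`. It removes `Q` from every term in which `Q` is not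
differentiated. -/
theorem conjTranspose_mul_symm {E Q : Matrix (Fin n) (Fin n) ℂ} (hQ : Qᵀ = Q)
    (hQE : Q * conjM E = E) : Eᴴ * Q = Eᵀ := by
  have h := congrArg Matrix.transpose hQE
  rw [Matrix.transpose_mul, hQ] at h
  rw [← h]; congr 1

/-- If `Q Ē = E` then `Eᴴ (DQ) Ē = 2 i Im (Eᴴ (DE))` for a derivation `D`. -/
theorem first_derivative_form {E Q E₁ Q₁ : Matrix (Fin n) (Fin n) ℂ} (hQ : Qᵀ = Q)
    (hQE : Q * conjM E = E) (h₁ : Q₁ * conjM E + Q * conjM E₁ = E₁) :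
    Eᴴ * Q₁ * conjM E = Eᴴ * E₁ - conjM (Eᴴ * E₁) := by
  have h := congrArg (Eᴴ * ·) h₁
  simp only [Matrix.mul_add, ← Matrix.mul_assoc, conjTranspose_mul_symm hQ hQE] at h
  rw [conjM_mul, conjM_conjTranspose]
  exact eq_sub_of_add_eq h

/-- Multiply the twice differentiated relation `Q Ē = E` by `Eᴴ`. In the mixed terms, `Ēₖ = Ē C̄ₖ`
brings the first derivatives of `Q` into the form covered by `first_derivative_form`. -/
theorem second_derivative_form {E Q Ek El Ekl Qk Ql Qkl Ck Cl : Matrix (Fin n) (Fin n) ℂ}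
    (hQ : Qᵀ = Q) (hQE : Q * conjM E = E)
    (hk : Qk * conjM E + Q * conjM Ek = Ek) (hl : Ql * conjM E + Q * conjM El = El)
    (hkl : Qkl * conjM E + Ql * conjM Ek + (Qk * conjM El + Q * conjM Ekl) = Ekl)
    (hCk : Ek = E * Ck) (hCl : El = E * Cl) :
    Eᴴ * Qkl * conjM E = Eᴴ * Ekl - conjM (Eᴴ * Ekl)
      - (Eᴴ * El - conjM (Eᴴ * El)) * conjM Ck - (Eᴴ * Ek - conjM (Eᴴ * Ek)) * conjM Cl := by
  have h := congrArg (Eᴴ * ·) hkl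
  simp only [Matrix.mul_add, ← Matrix.mul_assoc, conjTranspose_mul_symm hQ hQE] at h
  rw [← first_derivative_form hQ hQE hk, ← first_derivative_form hQ hQE hl,
    conjM_mul Eᴴ Ekl, conjM_conjTranspose]
  have e1 : conjM Ek = conjM E * conjM Ck := by rw [hCk, conjM_mul]
  have e2 : conjM El = conjM E * conjM Cl := by rw [hCl, conjM_mul]
  rw [Matrix.mul_assoc _ _ (conjM Ck), Matrix.mul_assoc _ _ (conjM Cl), ← e1, ← e2, ← h]
  abel

theorem im_sub_conj_mul_conj (A C : Matrix (Fin n) (Fin n) ℂ) (i j : Fin n) :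
    (((A - conjM A) * conjM C) i j).im = 2 * ∑ r, (A i r).im * (C r j).re := by
  simp only [Matrix.mul_apply, Complex.im_sum, Finset.mul_sum]
  refine Finset.sum_congr rfl fun r _ => ?_
  simp [Complex.mul_im]; ring

theorem im_sub_conj (A : Matrix (Fin n) (Fin n) ℂ) (i j : Fin n) :
    ((A - conjM A) i j).im = 2 * (A i j).im := by
  simp; ring

theorem re_sub_conj (A : Matrix (Fin n) (Fin n) ℂ) (i j : Fin n) :
    ((A - conjM A) i j).re = 0 := by
  simp

/-- `∑ᵏˡ gᵏˡ (Aₗ g Γₖ)ᵢⱼ` as a trace, for totally symmetric `A` and symmetric `Γ`. -/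
theorem trace_contraction {g : Matrix (Fin n) (Fin n) ℝ} (hg : gᵀ = g)
    {A Γ : Fin n → Matrix (Fin n) (Fin n) ℝ}
    (hA : ∀ k i j, A k i j = A j i k) (hA' : ∀ k i j, A k i j = A k j i)
    (hΓ : ∀ k i j, Γ k i j = Γ j i k) (i j : Fin n) :
    2 * ∑ k, ∑ l, g k l * (A l * (g * Γ k)) i j
      = ∑ k, ∑ l, (g * (Γ j + (Γ j)ᵀ) * g) k l * A k i l := by
  have hAi : (A i)ᵀ = A i := by ext a b; exact (hA' i a b).symm
  -- The symmetries let the free indices `i`, `j` trade places with the summed `l`, `k`: `A l i r =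
  -- A i l r` and `Γ k s j = Γ j s k`, so the summand is the `(l, k)` entry of `A i * g * Γ j`.
  have h1 : ∑ k, ∑ l, g k l * (A l * (g * Γ k)) i j = (g * A i * (g * Γ j)).trace := by
    simp only [Matrix.trace, Matrix.diag_apply]
    refine Finset.sum_congr rfl fun k _ => ?_
    rw [Matrix.mul_assoc, Matrix.mul_apply (M := g) (N := A i * (g * Γ j))]
    refine Finset.sum_congr rfl fun l _ => ?_
    congr 1
    simp only [Matrix.mul_apply]
    refine Finset.sum_congr rfl fun r _ => ?_
    rw [hA l i r, hA' r i l, hA r l i, hA' i l r]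
    congr 1
    exact Finset.sum_congr rfl fun s _ => by rw [hΓ]
  have h2 : ∀ N : Matrix (Fin n) (Fin n) ℝ,
      ∑ k, ∑ l, N k l * A k i l = (N * A i).trace := by
    intro N
    simp only [Matrix.trace, Matrix.diag_apply, Matrix.mul_apply]
    refine Finset.sum_congr rfl fun k _ => Finset.sum_congr rfl fun l _ => ?_
    rw [hA' k i l, hA k l i, hA' i l k]
  rw [h1, h2, Matrix.mul_add, Matrix.add_mul, Matrix.add_mul, Matrix.trace_add]
  -- A trace is invariant under transposition and `g`, `A i` are symmetric. So `Γ j` and its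
  -- transpose contribute equally, which accounts for the factor 2.
  have h3 : (g * (Γ j)ᵀ * g * A i).trace = (g * Γ j * g * A i).trace := by
    rw [← Matrix.trace_transpose]
    simp only [Matrix.transpose_mul, Matrix.transpose_transpose, hg, hAi]
    rw [Matrix.trace_mul_comm]
    simp only [Matrix.mul_assoc]
  have h4 : (g * A i * (g * Γ j)).trace = (g * Γ j * g * A i).trace := by
    rw [Matrix.trace_mul_comm]; simp only [Matrix.mul_assoc]
  rw [h3, h4]; ring

/-- The tangential part of the Laplacian of `Q = U Uᵀ` is the time derivative of `Q`, if `Q Ē = E`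
for the frame `E` of a Lagrangian immersion that moves by its mean curvature vector `H`. -/
theorem tangential_laplacian_eq {E Q Qt Et : Matrix (Fin n) (Fin n) ℂ}
    {Ek Qk : Fin n → Matrix (Fin n) (Fin n) ℂ} {Ekl Qkl : Fin n → Fin n → Matrix (Fin n) (Fin n) ℂ}
    {g G : Matrix (Fin n) (Fin n) ℝ} {g₁ Γ : Fin n → Matrix (Fin n) (Fin n) ℝ} {H : Fin n → ℂ}
    (hG : Eᴴ * E = G.map Complex.ofReal) (hgs : gᵀ = g) (hGg : G * g = 1)
    (hΓ : ∀ k, Γ k = (Eᴴ * Ek k).map Complex.re)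
    (hEk : ∀ k a j, Ek k a j = Ek j a k)
    (hEkl : ∀ k l a j, Ekl k l a j = Ekl k j a l) (hEkl' : ∀ k l, Ekl k l = Ekl l k)
    (hQ : Qᵀ = Q) (hQE : Q * conjM E = E)
    (hQk : ∀ k, Qk k * conjM E + Q * conjM (Ek k) = Ek k)
    (hQkl : ∀ k l, Qkl k l * conjM E + Qk l * conjM (Ek k)
      + (Qk k * conjM (Ek l) + Q * conjM (Ekl k l)) = Ekl k l)
    (hQt : Qt * conjM E + Q * conjM Et = Et)
    (hlag : ∀ k i j, (((Ek k)ᴴ * E + Eᴴ * Ek k) i j).im = 0)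
    (hH : ∀ a, H a = ∑ k, ∑ l, (g k l : ℂ) *
      (Ek k a l - ∑ r, ((g * Γ l) r k : ℂ) * E a r))
    (hHd : ∀ i j, (∑ a, (starRingEnd ℂ (Ek j a i) * H a + starRingEnd ℂ (E a i) * Et a j)).im
      = ∑ k, ∑ l, (g₁ j k l * ((Eᴴ * Ek k) i l).im
        + g k l * (∑ a, (starRingEnd ℂ (Ek j a i) * Ek k a l
          + starRingEnd ℂ (E a i) * Ekl j k a l)).im))
    (hg₁ : ∀ j, g₁ j = -(g * (Γ j + (Γ j)ᵀ) * g)) (i j : Fin n) :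
    ((Eᴴ * ((∑ k, ∑ l, (g k l : ℂ) • (Qkl k l - ∑ r, ((g * Γ l) r k : ℂ) • Qk r)) - Qt)
      * conjM E) i j).im = 0 := by
  -- The second fundamental form. Its symmetry in `k`, `j` is that of second derivatives; its
  -- symmetry in `i`, `j` is the differentiated Lagrangian condition. Here `G` is the metric and `g`
  -- its inverse.
  set A : Fin n → Matrix (Fin n) (Fin n) ℝ := fun k => (Eᴴ * Ek k).map Complex.im with hAdef
  have hMsymm : ∀ k i j, (Eᴴ * Ek k) i j = (Eᴴ * Ek j) i k := by
    intro k i j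
    simp only [Matrix.mul_apply]
    exact Finset.sum_congr rfl fun a _ => by rw [hEk]
  have hA : ∀ k i j, A k i j = A j i k := by
    intro k i j; simp only [hAdef, Matrix.map_apply, hMsymm k i j]
  have hstar : ∀ k i j, (((Ek k)ᴴ * E) i j).im = -A k j i := by
    intro k i j
    have : (Ek k)ᴴ * E = (Eᴴ * Ek k)ᴴ := by simp
    rw [this]; simp [hAdef]
  have hA' : ∀ k i j, A k i j = A k j i := by
    intro k i j
    have h := hlag k i j
    rw [Matrix.add_apply, Complex.add_im, hstar] at h
    simp only [hAdef, Matrix.map_apply] at h ⊢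
    linarith
  have hΓs : ∀ k i j, Γ k i j = Γ j i k := by
    intro k i j; simp only [hΓ, Matrix.map_apply, hMsymm k i j]
  have hgG : g * G = 1 := mul_eq_one_comm.1 hGg
  -- `Eₖ = E Cₖ`
  set C : Fin n → Matrix (Fin n) (Fin n) ℂ := fun k => g.map Complex.ofReal * (Eᴴ * Ek k)
    with hC
  have hinv : g.map Complex.ofReal * Eᴴ * E = 1 := by
    rw [Matrix.mul_assoc, hG]
    have := congrArg (fun N : Matrix (Fin n) (Fin n) ℝ => N.map Complex.ofRealHom) hgG
    simp only [Matrix.map_mul] at this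
    exact this.trans (by simp)
  have hECk : ∀ k, Ek k = E * C k := by
    intro k
    rw [hC]; simp only [← Matrix.mul_assoc]
    have := mul_eq_one_comm.1 hinv
    rw [← Matrix.mul_assoc] at this
    rw [this, Matrix.one_mul]
  have hCre : ∀ k r j, (C k r j).re = (g * Γ k) r j := by
    intro k r j
    simp [hC, hΓ, Matrix.mul_apply (M := g.map Complex.ofReal), Matrix.mul_apply (M := g)]
  have f1 : ∀ k, ((Eᴴ * Qk k * conjM E) i j).im = 2 * A k i j := by
    intro k; rw [first_derivative_form hQ hQE (hQk k), im_sub_conj]; rfl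
  have ft : ((Eᴴ * Qt * conjM E) i j).im = 2 * ((Eᴴ * Et) i j).im := by
    rw [first_derivative_form hQ hQE hQt, im_sub_conj]
  -- The first derivatives of `Q` enter through purely imaginary matrices, so only `Re Cₖ = g Γₖ`,
  -- the Christoffel symbols, survives in the imaginary part.
  have f2 : ∀ k l, ((Eᴴ * Qkl k l * conjM E) i j).im = 2 * ((Eᴴ * Ekl k l) i j).im
      - 2 * (A l * (g * Γ k)) i j - 2 * (A k * (g * Γ l)) i j := by
    intro k l
    rw [second_derivative_form hQ hQE (hQk k) (hQk l) (hQkl k l) (hECk k) (hECk l),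
      Matrix.sub_apply, Matrix.sub_apply, Complex.sub_im, Complex.sub_im, im_sub_conj,
      im_sub_conj_mul_conj, im_sub_conj_mul_conj]
    simp only [hCre]
    rfl
  -- the derivative of `H`
  have fH : ((Eᴴ * Et) i j).im = ∑ k, ∑ l, (g k l * ((Eᴴ * Ekl k l) i j).im
      - g k l * (∑ r, (g * Γ l) r k * A r i j) + g₁ j k l * A k i l) := by
    have e1 := hHd i j
    rw [Finset.sum_add_distrib, Complex.add_im] at e1
    -- Inserting the formula for `H` in the factor that is not differentiated produces `Im ⟨∂ⱼ∂ᵢF,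
    -- ∂ₖ∂ₗF⟩`, which cancels against the same term on the right of `e1`. The tangential part of `H`
    -- gives the Christoffel term in `A`.
    have e2 : (∑ a, starRingEnd ℂ (Ek j a i) * H a).im
        = ∑ k, ∑ l, g k l * ((∑ a, starRingEnd ℂ (Ek j a i) * Ek k a l).im
          + ∑ r, (g * Γ l) r k * A r i j) := by
      have : ∀ a, starRingEnd ℂ (Ek j a i) * H a = ∑ k, ∑ l, ((g k l : ℂ) *
          (starRingEnd ℂ (Ek j a i) * Ek k a l
            - ∑ r, ((g * Γ l) r k : ℂ) * (starRingEnd ℂ (Ek j a i) * E a r))) := by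
        intro a
        rw [hH, Finset.mul_sum]
        refine Finset.sum_congr rfl fun k _ => ?_
        rw [Finset.mul_sum]
        refine Finset.sum_congr rfl fun l _ => ?_
        rw [mul_left_comm, mul_sub, Finset.mul_sum]
        congr 2
        exact Finset.sum_congr rfl fun r _ => by ring
      simp only [this]
      rw [Finset.sum_comm, Complex.im_sum]
      refine Finset.sum_congr rfl fun k _ => ?_
      rw [Finset.sum_comm, Complex.im_sum]
      refine Finset.sum_congr rfl fun l _ => ?_
      rw [← Finset.mul_sum, Complex.im_ofReal_mul, Finset.sum_sub_distrib, Complex.sub_im,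
        sub_eq_add_neg]
      congr 2
      rw [Finset.sum_comm, Complex.im_sum, ← Finset.sum_neg_distrib]
      refine Finset.sum_congr rfl fun r _ => ?_
      rw [← Finset.mul_sum, Complex.im_ofReal_mul, ← mul_neg]
      congr 1
      have h := hstar j i r
      simp only [Matrix.mul_apply, Matrix.conjTranspose_apply] at h
      rw [hA r i j, hA' j i r, neg_eq_iff_eq_neg]
      exact h
    rw [e2] at e1
    have e3 : ((Eᴴ * Et) i j).im = (∑ a, starRingEnd ℂ (E a i) * Et a j).im := by
      simp only [Matrix.mul_apply, Matrix.conjTranspose_apply]; rfl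
    rw [e3, eq_sub_of_add_eq' e1]
    simp only [← Finset.sum_sub_distrib]
    refine Finset.sum_congr rfl fun k _ => Finset.sum_congr rfl fun l _ => ?_
    -- The Codazzi step: in flat space the third derivatives are symmetric in `j`, `k`, `l`.
    have e4 : (∑ a, starRingEnd ℂ (E a i) * Ekl j k a l).im = ((Eᴴ * Ekl k l) i j).im := by
      simp only [Matrix.mul_apply, Matrix.conjTranspose_apply]
      congr 1
      exact Finset.sum_congr rfl fun a _ => by rw [hEkl' j k, hEkl k j]; rfl
    rw [Finset.sum_add_distrib, Complex.add_im, e4]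
    have e5 : ((Eᴴ * Ek k) i l).im = A k i l := rfl
    rw [e5]; ring
  -- The third derivatives and the terms `(g Γₗ) r k * A r i j` occur on both sides. What remains
  -- compares the two mixed terms of `f2` with the derivative of the inverse metric.
  have key := trace_contraction hgs hA hA' hΓs i j
  have key' : ∑ k, ∑ l, g k l * (A k * (g * Γ l)) i j
      = ∑ k, ∑ l, g k l * (A l * (g * Γ k)) i j := by
    rw [Finset.sum_comm]
    refine Finset.sum_congr rfl fun k _ => Finset.sum_congr rfl fun l _ => ?_
    rw [← congrFun (congrFun hgs l) k, Matrix.transpose_apply]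
  have hL : ((Eᴴ * (∑ k, ∑ l, (g k l : ℂ) • (Qkl k l - ∑ r, ((g * Γ l) r k : ℂ) • Qk r))
      * conjM E) i j).im = ∑ k, ∑ l, g k l * (((Eᴴ * Qkl k l * conjM E) i j).im
        - ∑ r, (g * Γ l) r k * ((Eᴴ * Qk r * conjM E) i j).im) := by
    simp only [Matrix.mul_sum, Matrix.sum_mul, Matrix.sum_apply, Complex.im_sum, Matrix.mul_smul,
      Matrix.smul_mul, Matrix.smul_apply, smul_eq_mul, Complex.im_ofReal_mul, Matrix.mul_sub,
      Matrix.sub_mul, Matrix.sub_apply, Complex.sub_im]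
  rw [Matrix.mul_sub, Matrix.sub_mul, Matrix.sub_apply, Complex.sub_im, hL, ft, fH]
  simp only [f1, f2, hg₁, Matrix.neg_apply]
  simp only [mul_sub, Finset.sum_sub_distrib, Finset.sum_add_distrib, mul_add, Finset.mul_sum,
    neg_mul, Finset.sum_neg_distrib] at key key' ⊢
  have r1 : ∑ k, ∑ l, g k l * (2 * (A l * (g * Γ k)) i j)
      = ∑ k, ∑ l, 2 * (g k l * (A l * (g * Γ k)) i j) :=
    Finset.sum_congr rfl fun k _ => Finset.sum_congr rfl fun l _ => by ring
  have r2 : ∑ k, ∑ l, g k l * (2 * (A k * (g * Γ l)) i j)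
      = ∑ k, ∑ l, 2 * (g k l * (A l * (g * Γ k)) i j) := by
    simp only [← Finset.mul_sum, ← key']
    simp only [Finset.mul_sum]
    exact Finset.sum_congr rfl fun k _ => Finset.sum_congr rfl fun l _ => by ring
  rw [r1, r2, key]
  simp only [← Finset.mul_sum, mul_left_comm _ (2 : ℝ)]
  ring

end Algebra

/-! ### Directional derivatives on a set with unique derivatives -/

section DirDeriv

variable {X : Type*} [NormedAddCommGroup X] [NormedSpace ℝ X]
  {V : Type*} [NormedAddCommGroup V] [NormedSpace ℝ V]
  {V' : Type*} [NormedAddCommGroup V'] [NormedSpace ℝ V']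

/-- The derivative of `u` within `W` in the direction `v`. -/
noncomputable def dirDeriv (W : Set X) (v : X) (u : X → V) (z : X) : V :=
  fderivWithin ℝ u W z v

variable {W : Set X}

theorem dirDeriv_contDiffOn (hW : UniqueDiffOn ℝ W) {u : X → V} (hu : ContDiffOn ℝ ∞ u W)
    (v : X) : ContDiffOn ℝ ∞ (dirDeriv W v u) W :=
  (hu.fderivWithin hW (by simp)).clm_apply contDiffOn_const

theorem dirDeriv_congr {u u' : X → V} (h : ∀ z ∈ W, u z = u' z) (v : X) {z : X} (hz : z ∈ W) :
    dirDeriv W v u z = dirDeriv W v u' z := by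
  unfold dirDeriv
  rw [fderivWithin_congr h (h z hz)]

theorem dirDeriv_clm (hW : UniqueDiffOn ℝ W) {u : X → V} (hu : ContDiffOn ℝ ∞ u W)
    (L : V →L[ℝ] V') (v : X) {z : X} (hz : z ∈ W) :
    dirDeriv W v (fun y => L (u y)) z = L (dirDeriv W v u z) := by
  have h := L.hasFDerivAt.comp_hasFDerivWithinAt z
    ((hu.differentiableOn (by simp)) z hz).hasFDerivWithinAt
  have h' := h.fderivWithin (hW z hz)
  change fderivWithin ℝ (L ∘ u) W z v = _
  rw [h']; rfl

/-- `W` may contain boundary points, such as those with `t = 0`. The second derivative is symmetric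
there as well, since these points are limits of interior points. -/
theorem dirDeriv_comm (hW : UniqueDiffOn ℝ W) (hc : W ⊆ closure (interior W)) {u : X → V}
    (hu : ContDiffOn ℝ ∞ u W) (v w : X) {z : X} (hz : z ∈ W) :
    dirDeriv W v (dirDeriv W w u) z = dirDeriv W w (dirDeriv W v u) z := by
  have key : ∀ a b : X, dirDeriv W a (dirDeriv W b u) z
      = fderivWithin ℝ (fderivWithin ℝ u W) W z a b := by
    intro a b
    have h1 : ContDiffOn ℝ ∞ (fderivWithin ℝ u W) W := hu.fderivWithin hW (by simp)
    exact dirDeriv_clm hW h1 (ContinuousLinearMap.apply ℝ V b) a hz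
  rw [key, key]
  exact (hu z hz).isSymmSndFDerivWithinAt
    (by simpa using ENat.LEInfty.out) hW (hc hz) hz v w

theorem dirDeriv_sum (hW : UniqueDiffOn ℝ W) {ι : Type*} {s : Finset ι} {u : ι → X → V}
    (hu : ∀ b, ContDiffOn ℝ ∞ (u b) W) (v : X) {z : X} (hz : z ∈ W) :
    dirDeriv W v (fun y => ∑ b ∈ s, u b y) z = ∑ b ∈ s, dirDeriv W v (u b) z := by
  unfold dirDeriv
  rw [fderivWithin_fun_sum (hW z hz) fun b _ => (hu b).differentiableOn (by simp) z hz]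
  simp

theorem dirDeriv_add (hW : UniqueDiffOn ℝ W) {u w : X → V} (hu : ContDiffOn ℝ ∞ u W)
    (hw : ContDiffOn ℝ ∞ w W) (v : X) {z : X} (hz : z ∈ W) :
    dirDeriv W v (fun y => u y + w y) z = dirDeriv W v u z + dirDeriv W v w z := by
  unfold dirDeriv
  rw [fderivWithin_fun_add (hW z hz) (hu.differentiableOn (by simp) z hz)
    (hw.differentiableOn (by simp) z hz)]
  simp

theorem dirDeriv_mul {𝔸 : Type*} [NormedCommRing 𝔸] [NormedAlgebra ℝ 𝔸] (hW : UniqueDiffOn ℝ W)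
    {p q : X → 𝔸} (hp : ContDiffOn ℝ ∞ p W) (hq : ContDiffOn ℝ ∞ q W) (v : X) {z : X}
    (hz : z ∈ W) :
    dirDeriv W v (fun y => p y * q y) z = dirDeriv W v p z * q z + p z * dirDeriv W v q z := by
  unfold dirDeriv
  rw [fderivWithin_fun_mul (hW z hz) (hp.differentiableOn (by simp) z hz)
    (hq.differentiableOn (by simp) z hz)]
  simp; ring

theorem contDiffOn_conj {u : X → ℂ} (hu : ContDiffOn ℝ ∞ u W) :
    ContDiffOn ℝ ∞ (fun z => starRingEnd ℂ (u z)) W :=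
  (Complex.conjCLE : ℂ →L[ℝ] ℂ).contDiff.comp_contDiffOn hu

theorem dirDeriv_conj (hW : UniqueDiffOn ℝ W) {u : X → ℂ} (hu : ContDiffOn ℝ ∞ u W) (v : X)
    {z : X} (hz : z ∈ W) :
    dirDeriv W v (fun y => starRingEnd ℂ (u y)) z = starRingEnd ℂ (dirDeriv W v u z) :=
  dirDeriv_clm hW hu (Complex.conjCLE : ℂ →L[ℝ] ℂ) v hz

theorem contDiffOn_im {u : X → ℂ} (hu : ContDiffOn ℝ ∞ u W) :
    ContDiffOn ℝ ∞ (fun z => (u z).im) W :=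
  Complex.imCLM.contDiff.comp_contDiffOn hu

theorem contDiffOn_re {u : X → ℂ} (hu : ContDiffOn ℝ ∞ u W) :
    ContDiffOn ℝ ∞ (fun z => (u z).re) W :=
  Complex.reCLM.contDiff.comp_contDiffOn hu

theorem dirDeriv_im (hW : UniqueDiffOn ℝ W) {u : X → ℂ} (hu : ContDiffOn ℝ ∞ u W) (v : X)
    {z : X} (hz : z ∈ W) :
    dirDeriv W v (fun y => (u y).im) z = (dirDeriv W v u z).im :=
  dirDeriv_clm hW hu Complex.imCLM v hz

theorem dirDeriv_re (hW : UniqueDiffOn ℝ W) {u : X → ℂ} (hu : ContDiffOn ℝ ∞ u W) (v : X)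
    {z : X} (hz : z ∈ W) :
    dirDeriv W v (fun y => (u y).re) z = (dirDeriv W v u z).re :=
  dirDeriv_clm hW hu Complex.reCLM v hz

/-! ### Smooth matrix-valued functions -/

variable {n : ℕ}

/-- The entries of `P` are smooth on `W`. -/
def SmoothMatrixOn {R : Type*} [NormedAddCommGroup R] [NormedSpace ℝ R] (W : Set X)
    (P : X → Matrix (Fin n) (Fin n) R) : Prop :=
  ∀ i j, ContDiffOn ℝ ∞ (fun z => P z i j) W

/-- The entrywise derivative within `W` in the direction `v`. -/
noncomputable def matDeriv {R : Type*} [NormedAddCommGroup R] [NormedSpace ℝ R] (W : Set X) (v : X)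
    (P : X → Matrix (Fin n) (Fin n) R) (z : X) : Matrix (Fin n) (Fin n) R :=
  Matrix.of fun i j => dirDeriv W v (fun y => P y i j) z

theorem SmoothMatrixOn.matDeriv {R : Type*} [NormedAddCommGroup R] [NormedSpace ℝ R]
    (hW : UniqueDiffOn ℝ W) {P : X → Matrix (Fin n) (Fin n) R} (hP : SmoothMatrixOn W P) (v : X) :
    SmoothMatrixOn W (matDeriv W v P) :=
  fun i j => dirDeriv_contDiffOn hW (hP i j) v

theorem SmoothMatrixOn.mul {𝔸 : Type*} [NormedCommRing 𝔸] [NormedAlgebra ℝ 𝔸]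
    {P R : X → Matrix (Fin n) (Fin n) 𝔸} (hP : SmoothMatrixOn W P) (hR : SmoothMatrixOn W R) :
    SmoothMatrixOn W (fun z => P z * R z) := by
  intro i j
  simp only [Matrix.mul_apply]
  exact ContDiffOn.sum fun a _ => (hP i a).mul (hR a j)

theorem SmoothMatrixOn.conj {P : X → Matrix (Fin n) (Fin n) ℂ} (hP : SmoothMatrixOn W P) :
    SmoothMatrixOn W (fun z => conjM (P z)) :=
  fun i j => contDiffOn_conj (hP i j)

theorem SmoothMatrixOn.conjTranspose {P : X → Matrix (Fin n) (Fin n) ℂ}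
    (hP : SmoothMatrixOn W P) : SmoothMatrixOn W (fun z => (P z)ᴴ) :=
  fun i j => contDiffOn_conj (hP j i)

theorem SmoothMatrixOn.det {𝕜 : Type*} [NormedField 𝕜] [NormedAlgebra ℝ 𝕜]
    {P : X → Matrix (Fin n) (Fin n) 𝕜} (hP : SmoothMatrixOn W P) :
    ContDiffOn ℝ ∞ (fun z => (P z).det) W := by
  simp only [Matrix.det_apply]
  exact ContDiffOn.sum fun σ _ => (contDiffOn_prod fun i _ => hP (σ i) i).const_smul _

theorem SmoothMatrixOn.inv {𝕜 : Type*} [NormedField 𝕜] [NormedAlgebra ℝ 𝕜]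
    {P : X → Matrix (Fin n) (Fin n) 𝕜} (hP : SmoothMatrixOn W P)
    (hdet : ∀ z ∈ W, (P z).det ≠ 0) : SmoothMatrixOn W (fun z => (P z)⁻¹) := by
  intro i j
  simp only [Matrix.inv_def, Ring.inverse_eq_inv', Matrix.smul_apply, smul_eq_mul,
    Matrix.adjugate_apply]
  refine (hP.det.inv hdet).mul (SmoothMatrixOn.det fun a b => ?_)
  by_cases h : a = j
  · subst h; simpa using contDiffOn_const
  · simpa [Matrix.updateRow_ne h] using hP a b

theorem matDeriv_congr {R : Type*} [NormedAddCommGroup R] [NormedSpace ℝ R]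
    {P P' : X → Matrix (Fin n) (Fin n) R} (h : ∀ z ∈ W, P z = P' z) (v : X) {z : X} (hz : z ∈ W) :
    matDeriv W v P z = matDeriv W v P' z := by
  ext i j
  exact dirDeriv_congr (fun y hy => by rw [h y hy]) v hz

theorem matDeriv_mul {𝔸 : Type*} [NormedCommRing 𝔸] [NormedAlgebra ℝ 𝔸] (hW : UniqueDiffOn ℝ W)
    {P R : X → Matrix (Fin n) (Fin n) 𝔸} (hP : SmoothMatrixOn W P) (hR : SmoothMatrixOn W R)
    (v : X) {z : X} (hz : z ∈ W) :
    matDeriv W v (fun y => P y * R y) z = matDeriv W v P z * R z + P z * matDeriv W v R z := by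
  ext i j
  simp only [matDeriv, Matrix.of_apply, Matrix.mul_apply, Matrix.add_apply]
  rw [dirDeriv_sum hW (fun b => (hP i b).mul (hR b j)) v hz, ← Finset.sum_add_distrib]
  exact Finset.sum_congr rfl fun b _ => dirDeriv_mul hW (hP i b) (hR b j) v hz

theorem matDeriv_add {R : Type*} [NormedAddCommGroup R] [NormedSpace ℝ R] (hW : UniqueDiffOn ℝ W)
    {P P' : X → Matrix (Fin n) (Fin n) R} (hP : SmoothMatrixOn W P) (hP' : SmoothMatrixOn W P')
    (v : X) {z : X} (hz : z ∈ W) :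
    matDeriv W v (fun y => P y + P' y) z = matDeriv W v P z + matDeriv W v P' z := by
  ext i j
  exact dirDeriv_add hW (hP i j) (hP' i j) v hz

theorem matDeriv_conj (hW : UniqueDiffOn ℝ W) {P : X → Matrix (Fin n) (Fin n) ℂ}
    (hP : SmoothMatrixOn W P) (v : X) {z : X} (hz : z ∈ W) :
    matDeriv W v (fun y => conjM (P y)) z = conjM (matDeriv W v P z) := by
  ext i j
  exact dirDeriv_conj hW (hP i j) v hz

theorem matDeriv_conjTranspose (hW : UniqueDiffOn ℝ W) {P : X → Matrix (Fin n) (Fin n) ℂ}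
    (hP : SmoothMatrixOn W P) (v : X) {z : X} (hz : z ∈ W) :
    matDeriv W v (fun y => (P y)ᴴ) z = (matDeriv W v P z)ᴴ := by
  ext i j
  exact dirDeriv_conj hW (hP j i) v hz

theorem matDeriv_const {R : Type*} [NormedAddCommGroup R] [NormedSpace ℝ R]
    (P : Matrix (Fin n) (Fin n) R) (v : X) (z : X) : matDeriv W v (fun _ => P) z = 0 := by
  ext i j
  simp [matDeriv, dirDeriv]

/-- Differentiate `P⁻¹ P = 1`. -/
theorem matDeriv_inv {𝕜 : Type*} [NormedField 𝕜] [NormedAlgebra ℝ 𝕜] (hW : UniqueDiffOn ℝ W)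
    {P : X → Matrix (Fin n) (Fin n) 𝕜} (hP : SmoothMatrixOn W P)
    (hdet : ∀ z ∈ W, (P z).det ≠ 0) (v : X) {z : X} (hz : z ∈ W) :
    matDeriv W v (fun y => (P y)⁻¹) z = -((P z)⁻¹ * matDeriv W v P z * (P z)⁻¹) := by
  have hu : ∀ y ∈ W, IsUnit (P y).det := fun y hy => isUnit_iff_ne_zero.2 (hdet y hy)
  have h1 : matDeriv W v (fun y => (P y)⁻¹ * P y) z = 0 := by
    rw [matDeriv_congr (P' := fun _ => 1) (fun y hy => Matrix.nonsing_inv_mul _ (hu y hy)) v hz,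
      matDeriv_const]
  rw [matDeriv_mul hW (hP.inv hdet) hP v hz] at h1
  have h2 := congrArg (· * (P z)⁻¹) h1
  simp only [Matrix.add_mul, Matrix.zero_mul] at h2
  rw [Matrix.mul_nonsing_inv_cancel_right _ _ (hu z hz)] at h2
  exact eq_neg_of_add_eq_zero_left h2

end DirDeriv

/-! ### The evolution of the frame in coordinates -/

section Evolution

variable {n : ℕ}

/-- The direction `∂/∂t` in `ℝ × ℝⁿ`. -/
def timeDir (n : ℕ) : ℝ × Rn n := (1, 0)

/-- The direction `∂/∂xⁱ` in `ℝ × ℝⁿ`. -/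
noncomputable def spaceDir {n : ℕ} (i : Fin n) : ℝ × Rn n := (0, EuclideanSpace.single i 1)

/-- The matrix with the columns `∂ⱼ f`. -/
noncomputable def frame (W : Set (ℝ × Rn n)) (f : ℝ × Rn n → Cn n) (z : ℝ × Rn n) :
    Matrix (Fin n) (Fin n) ℂ :=
  Matrix.of fun a j => dirDeriv W (spaceDir j) (fun y => f y a) z

/-- `E Ē⁻¹`, which is `U Uᵀ` if `E = U R` for a unitary `U` and a real `R`. -/
noncomputable def gaussMatrix (W : Set (ℝ × Rn n)) (f : ℝ × Rn n → Cn n) (z : ℝ × Rn n) :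
    Matrix (Fin n) (Fin n) ℂ :=
  frame W f z * (conjM (frame W f z))⁻¹

/-- The induced metric in coordinates. -/
noncomputable def metricMatrix (W : Set (ℝ × Rn n)) (f : ℝ × Rn n → Cn n) (z : ℝ × Rn n) :
    Matrix (Fin n) (Fin n) ℝ :=
  ((frame W f z)ᴴ * frame W f z).map Complex.re

/-- The Christoffel symbols of the first kind: the entry `(i, j)` is `⟨∂ᵢ f, ∂ⱼ ∂ₖ f⟩`. -/
noncomputable def lowerChristoffel (W : Set (ℝ × Rn n)) (f : ℝ × Rn n → Cn n) (z : ℝ × Rn n)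
    (k : Fin n) : Matrix (Fin n) (Fin n) ℝ :=
  ((frame W f z)ᴴ * matDeriv W (spaceDir k) (frame W f) z).map Complex.re

variable {W : Set (ℝ × Rn n)} {f : ℝ × Rn n → Cn n}

theorem contDiffOn_component (hf : ContDiffOn ℝ ∞ f W) (a : Fin n) :
    ContDiffOn ℝ ∞ (fun y => f y a) W :=
  ((EuclideanSpace.proj a : Cn n →L[ℂ] ℂ).restrictScalars ℝ).contDiff.comp_contDiffOn hf

theorem smoothMatrixOn_frame (hW : UniqueDiffOn ℝ W) (hf : ContDiffOn ℝ ∞ f W) :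
    SmoothMatrixOn W (frame W f) :=
  fun a j => dirDeriv_contDiffOn hW (contDiffOn_component hf a) (spaceDir j)

theorem det_conjM_ne_zero {E : Matrix (Fin n) (Fin n) ℂ} (hE : E.det ≠ 0) :
    (conjM E).det ≠ 0 := by
  have : (conjM E).det = starRingEnd ℂ E.det := (RingHom.map_det (starRingEnd ℂ) E).symm
  rw [this]; simpa using hE

theorem metricMatrix_eq {z : ℝ × Rn n}
    (hlag : ∀ i j, (((frame W f z)ᴴ * frame W f z) i j).im = 0) :
    (frame W f z)ᴴ * frame W f z = (metricMatrix W f z).map Complex.ofReal := by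
  ext i j
  apply Complex.ext
  · simp [metricMatrix]
  · simpa using hlag i j

theorem det_metricMatrix_ne_zero {z : ℝ × Rn n}
    (hlag : ∀ i j, (((frame W f z)ᴴ * frame W f z) i j).im = 0) (hE : (frame W f z).det ≠ 0) :
    (metricMatrix W f z).det ≠ 0 := by
  have h := congrArg Matrix.det (metricMatrix_eq hlag)
  have h2 : ((metricMatrix W f z).map Complex.ofReal).det = ((metricMatrix W f z).det : ℂ) :=
    (RingHom.map_det Complex.ofRealHom (metricMatrix W f z)).symm
  rw [h2, Matrix.det_mul, Matrix.det_conjTranspose] at h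
  intro h0
  rw [h0] at h
  simp [hE] at h

theorem metricMatrix_transpose (z : ℝ × Rn n) : (metricMatrix W f z)ᵀ = metricMatrix W f z := by
  have h : ((frame W f z)ᴴ * frame W f z)ᴴ = (frame W f z)ᴴ * frame W f z := by simp
  ext i j
  have h' := congrArg Complex.re (congrFun (congrFun h i) j)
  rwa [Matrix.conjTranspose_apply, Complex.star_def, Complex.conj_re] at h'

theorem gaussMatrix_mul_conj {z : ℝ × Rn n} (hE : (frame W f z).det ≠ 0) :
    gaussMatrix W f z * conjM (frame W f z) = frame W f z :=
  Matrix.nonsing_inv_mul_cancel_right _ _ (isUnit_iff_ne_zero.2 (det_conjM_ne_zero hE))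

/-- The Lagrangian condition makes `Eᴴ E` real, so `Eᴴ E = Eᵀ Ē`. Multiplying by `(Eᴴ)⁻¹` on the
left and `Ē⁻¹` on the right gives `E Ē⁻¹ = (Eᴴ)⁻¹ Eᵀ`, whose right side is the transpose of the
left. -/
theorem gaussMatrix_transpose {z : ℝ × Rn n}
    (hlag : ∀ i j, (((frame W f z)ᴴ * frame W f z) i j).im = 0) (hE : (frame W f z).det ≠ 0) :
    (gaussMatrix W f z)ᵀ = gaussMatrix W f z := by
  set E := frame W f z with hEdef
  have hu : IsUnit (conjM E).det := isUnit_iff_ne_zero.2 (det_conjM_ne_zero hE)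
  have h1 : Eᴴ * E = Eᵀ * conjM E := by
    have : conjM (Eᴴ * E) = Eᴴ * E := by
      rw [metricMatrix_eq hlag]; ext i j; simp
    rw [← this, conjM_mul, conjM_conjTranspose]
  have h2 : (conjM E)ᵀ = Eᴴ := rfl
  have h3 : IsUnit (Eᴴ).det := by rw [← h2, Matrix.det_transpose]; exact hu
  unfold gaussMatrix
  rw [← hEdef, Matrix.transpose_mul, Matrix.transpose_nonsing_inv, h2]
  calc (Eᴴ)⁻¹ * Eᵀ = (Eᴴ)⁻¹ * ((Eᵀ * conjM E) * (conjM E)⁻¹) := by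
        rw [Matrix.mul_nonsing_inv_cancel_right _ _ hu]
    _ = (Eᴴ)⁻¹ * (Eᴴ * (E * (conjM E)⁻¹)) := by rw [← h1, Matrix.mul_assoc Eᴴ]
    _ = _ := Matrix.nonsing_inv_mul_cancel_left _ _ h3

theorem smoothMatrixOn_gaussMatrix (hW : UniqueDiffOn ℝ W) (hf : ContDiffOn ℝ ∞ f W)
    (hE : ∀ z ∈ W, (frame W f z).det ≠ 0) : SmoothMatrixOn W (gaussMatrix W f) :=
  (smoothMatrixOn_frame hW hf).mul
    ((smoothMatrixOn_frame hW hf).conj.inv fun z hz => det_conjM_ne_zero (hE z hz))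

theorem smoothMatrixOn_metricMatrix (hW : UniqueDiffOn ℝ W) (hf : ContDiffOn ℝ ∞ f W) :
    SmoothMatrixOn W (metricMatrix W f) :=
  fun i j => contDiffOn_re
    (((smoothMatrixOn_frame hW hf).conjTranspose.mul (smoothMatrixOn_frame hW hf)) i j)

theorem frame_symm (hW : UniqueDiffOn ℝ W) (hc : W ⊆ closure (interior W))
    (hf : ContDiffOn ℝ ∞ f W) (k a j : Fin n) {z : ℝ × Rn n} (hz : z ∈ W) :
    matDeriv W (spaceDir k) (frame W f) z a j = matDeriv W (spaceDir j) (frame W f) z a k :=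
  dirDeriv_comm hW hc (contDiffOn_component hf a) (spaceDir k) (spaceDir j) hz

theorem matDeriv_metricMatrix (hW : UniqueDiffOn ℝ W) (hf : ContDiffOn ℝ ∞ f W) (k : Fin n)
    {z : ℝ × Rn n} (hz : z ∈ W) :
    matDeriv W (spaceDir k) (metricMatrix W f) z
      = lowerChristoffel W f z k + (lowerChristoffel W f z k)ᵀ := by
  have hS := smoothMatrixOn_frame hW hf
  ext i j
  have h1 : matDeriv W (spaceDir k) (metricMatrix W f) z i j
      = (matDeriv W (spaceDir k) (fun y => (frame W f y)ᴴ * frame W f y) z i j).re :=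
    dirDeriv_re hW ((hS.conjTranspose.mul hS) i j) (spaceDir k) hz
  rw [h1, matDeriv_mul hW hS.conjTranspose hS _ hz, matDeriv_conjTranspose hW hS _ hz]
  have h2 : (matDeriv W (spaceDir k) (frame W f) z)ᴴ * frame W f z
      = ((frame W f z)ᴴ * matDeriv W (spaceDir k) (frame W f) z)ᴴ := by simp
  rw [h2]
  simp only [lowerChristoffel, Matrix.add_apply, Matrix.conjTranspose_apply, Matrix.map_apply,
    Matrix.transpose_apply, Complex.add_re]
  rw [add_comm]; rfl

/-- The evolution equation of `U Uᵀ` for a Lagrangian immersion `f` moving by its mean curvature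
vector. -/
theorem evolution_gaussMatrix (hW : UniqueDiffOn ℝ W) (hc : W ⊆ closure (interior W))
    (hf : ContDiffOn ℝ ∞ f W) (hE : ∀ z ∈ W, (frame W f z).det ≠ 0)
    (hlag : ∀ z ∈ W, ∀ i j, (((frame W f z)ᴴ * frame W f z) i j).im = 0)
    (hflow : ∀ z ∈ W, ∀ a, dirDeriv W (timeDir n) (fun y => f y a) z
      = ∑ k, ∑ l, ((metricMatrix W f z)⁻¹ k l : ℂ) * (matDeriv W (spaceDir k) (frame W f) z a l
        - ∑ r, (((metricMatrix W f z)⁻¹ * lowerChristoffel W f z l) r k : ℂ) * frame W f z a r))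
    {z : ℝ × Rn n} (hz : z ∈ W) (i j : Fin n) :
    (((frame W f z)ᴴ * ((∑ k, ∑ l, ((metricMatrix W f z)⁻¹ k l : ℂ) •
        (matDeriv W (spaceDir k) (matDeriv W (spaceDir l) (gaussMatrix W f)) z
          - ∑ r, (((metricMatrix W f z)⁻¹ * lowerChristoffel W f z l) r k : ℂ) •
            matDeriv W (spaceDir r) (gaussMatrix W f) z))
        - matDeriv W (timeDir n) (gaussMatrix W f) z) * conjM (frame W f z)) i j).im = 0 := by
  have hS := smoothMatrixOn_frame hW hf
  have hSQ := smoothMatrixOn_gaussMatrix hW hf hE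
  have hSg : SmoothMatrixOn W (fun y => (metricMatrix W f y)⁻¹) :=
    (smoothMatrixOn_metricMatrix hW hf).inv fun y hy =>
      det_metricMatrix_ne_zero (hlag y hy) (hE y hy)
  -- The product rule for `Q Ē = E`, proved on all of `W` so that it can be differentiated again.
  have hd : ∀ v, ∀ y ∈ W, matDeriv W v (gaussMatrix W f) y * conjM (frame W f y)
      + gaussMatrix W f y * conjM (matDeriv W v (frame W f) y) = matDeriv W v (frame W f) y := by
    intro v y hy
    have h := matDeriv_congr (fun y hy => gaussMatrix_mul_conj (hE y hy)) v hy
    rwa [matDeriv_mul hW hSQ hS.conj v hy, matDeriv_conj hW hS v hy] at h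
  refine tangential_laplacian_eq (Et := matDeriv W (timeDir n) (frame W f) z)
    (Ek := fun k => matDeriv W (spaceDir k) (frame W f) z)
    (Qk := fun k => matDeriv W (spaceDir k) (gaussMatrix W f) z)
    (Ekl := fun k l => matDeriv W (spaceDir k) (matDeriv W (spaceDir l) (frame W f)) z)
    (Qkl := fun k l => matDeriv W (spaceDir k) (matDeriv W (spaceDir l) (gaussMatrix W f)) z)
    (g₁ := fun k => matDeriv W (spaceDir k) (fun y => (metricMatrix W f y)⁻¹) z)
    (Γ := lowerChristoffel W f z)
    (H := fun a => dirDeriv W (timeDir n) (fun y => f y a) z)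
    (metricMatrix_eq (hlag z hz)) ?_
    (Matrix.mul_nonsing_inv _ (isUnit_iff_ne_zero.2
      (det_metricMatrix_ne_zero (hlag z hz) (hE z hz))))
    (fun k => rfl) (fun k a j => frame_symm hW hc hf k a j hz) ?_ ?_
    (gaussMatrix_transpose (hlag z hz) (hE z hz)) (gaussMatrix_mul_conj (hE z hz))
    (fun k => hd _ z hz) ?_ (hd _ z hz) ?_ (hflow z hz) ?_ ?_ i j
  · rw [Matrix.transpose_nonsing_inv, metricMatrix_transpose]
  · intro k l a j
    exact dirDeriv_congr (fun y hy => frame_symm hW hc hf l a j hy) (spaceDir k) hz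
  · intro k l
    ext a j
    exact dirDeriv_comm hW hc (hS a j) (spaceDir k) (spaceDir l) hz
  · intro k l
    have h := matDeriv_congr (hd (spaceDir l)) (spaceDir k) hz
    rw [matDeriv_add hW ((hSQ.matDeriv hW _).mul hS.conj) (hSQ.mul (hS.matDeriv hW _).conj) _ hz,
      matDeriv_mul hW (hSQ.matDeriv hW _) hS.conj _ hz,
      matDeriv_mul hW hSQ (hS.matDeriv hW _).conj _ hz, matDeriv_conj hW hS _ hz,
      matDeriv_conj hW (hS.matDeriv hW _) _ hz] at h
    exact h
  · intro k i j
    have h := dirDeriv_congr (fun y hy => hlag y hy i j) (spaceDir k) hz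
    rw [dirDeriv_im hW ((hS.conjTranspose.mul hS) i j) _ hz] at h
    have h2 := matDeriv_mul hW hS.conjTranspose hS (spaceDir k) hz
    rw [matDeriv_conjTranspose hW hS _ hz] at h2
    rw [← h2]
    refine h.trans ?_
    simp [dirDeriv]
  · intro i j
    have hH : ∀ a, ContDiffOn ℝ ∞ (dirDeriv W (timeDir n) (fun y => f y a)) W :=
      fun a => dirDeriv_contDiffOn hW (contDiffOn_component hf a) _
    -- The mean curvature form: `Im ⟨∂ᵢf, H⟩` is the trace of the second fundamental form, since the
    -- Lagrangian condition kills the pairing with the tangential part that is subtracted in `H`.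
    -- The identity holds on all of `W`, so both sides may be differentiated by `∂ⱼ`.
    have hid : ∀ y ∈ W, (∑ a, starRingEnd ℂ (frame W f y a i)
          * dirDeriv W (timeDir n) (fun y => f y a) y).im
        = ∑ k, ∑ l, (metricMatrix W f y)⁻¹ k l * (∑ a, starRingEnd ℂ (frame W f y a i)
          * matDeriv W (spaceDir k) (frame W f) y a l).im := by
      intro y hy
      have h0 : ∀ r, (∑ a, starRingEnd ℂ (frame W f y a i) * frame W f y a r).im = 0 := by
        intro r
        have := hlag y hy i r
        rwa [Matrix.mul_apply] at this
      have h1 : ∀ a, starRingEnd ℂ (frame W f y a i) * dirDeriv W (timeDir n) (fun y => f y a) y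
          = ∑ k, ∑ l, ((metricMatrix W f y)⁻¹ k l : ℂ) * (starRingEnd ℂ (frame W f y a i)
              * matDeriv W (spaceDir k) (frame W f) y a l
            - ∑ r, (((metricMatrix W f y)⁻¹ * lowerChristoffel W f y l) r k : ℂ)
              * (starRingEnd ℂ (frame W f y a i) * frame W f y a r)) := by
        intro a
        rw [hflow y hy, Finset.mul_sum]
        refine Finset.sum_congr rfl fun k _ => ?_
        rw [Finset.mul_sum]
        refine Finset.sum_congr rfl fun l _ => ?_
        rw [mul_left_comm, mul_sub, Finset.mul_sum]
        congr 2
        exact Finset.sum_congr rfl fun r _ => by ring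
      simp only [h1]
      rw [Finset.sum_comm, Complex.im_sum]
      refine Finset.sum_congr rfl fun k _ => ?_
      rw [Finset.sum_comm, Complex.im_sum]
      refine Finset.sum_congr rfl fun l _ => ?_
      rw [← Finset.mul_sum, Complex.im_ofReal_mul, Finset.sum_sub_distrib, Complex.sub_im]
      congr 1
      refine sub_eq_self.2 ?_
      rw [Finset.sum_comm, Complex.im_sum]
      simp only [← Finset.mul_sum, Complex.im_ofReal_mul, h0, mul_zero, Finset.sum_const_zero]
    have h := dirDeriv_congr hid (spaceDir j) hz
    have s1 : ∀ a, ContDiffOn ℝ ∞ (fun y => starRingEnd ℂ (frame W f y a i)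
        * dirDeriv W (timeDir n) (fun y => f y a) y) W :=
      fun a => (contDiffOn_conj (hS a i)).mul (hH a)
    have s2 : ∀ k l a, ContDiffOn ℝ ∞ (fun y => starRingEnd ℂ (frame W f y a i)
        * matDeriv W (spaceDir k) (frame W f) y a l) W :=
      fun k l a => (contDiffOn_conj (hS a i)).mul (hS.matDeriv hW (spaceDir k) a l)
    have s2' : ∀ k l, ContDiffOn ℝ ∞ (fun y => (∑ a, starRingEnd ℂ (frame W f y a i)
        * matDeriv W (spaceDir k) (frame W f) y a l).im) W :=
      fun k l => contDiffOn_im (ContDiffOn.sum fun a _ => s2 k l a)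
    have s3 : ∀ k l, ContDiffOn ℝ ∞ (fun y => (metricMatrix W f y)⁻¹ k l
        * (∑ a, starRingEnd ℂ (frame W f y a i)
        * matDeriv W (spaceDir k) (frame W f) y a l).im) W :=
      fun k l => (hSg k l).mul (s2' k l)
    rw [dirDeriv_im hW (ContDiffOn.sum fun a _ => s1 a) _ hz, dirDeriv_sum hW s1 _ hz,
      dirDeriv_sum hW (fun k => ContDiffOn.sum fun l _ => s3 k l) _ hz] at h
    simp only [dirDeriv_sum hW (s3 _) _ hz] at h
    refine Eq.trans ?_ (h.trans ?_)
    · congr 1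
      refine Finset.sum_congr rfl fun a _ => ?_
      rw [dirDeriv_mul hW (contDiffOn_conj (hS a i)) (hH a) _ hz, dirDeriv_conj hW (hS a i) _ hz]
      congr 2
      -- Commuting `∂ⱼ` and `∂ₜ` turns the derivative of the velocity into the time derivative of
      -- the frame.
      exact dirDeriv_comm hW hc (contDiffOn_component hf a) _ _ hz
    · refine Finset.sum_congr rfl fun k _ => Finset.sum_congr rfl fun l _ => ?_
      rw [dirDeriv_mul hW (hSg k l) (s2' k l) _ hz,
        dirDeriv_im hW (ContDiffOn.sum fun a _ => s2 k l a) _ hz, dirDeriv_sum hW (s2 k l) _ hz]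
      congr 3
      refine Finset.sum_congr rfl fun a _ => ?_
      rw [dirDeriv_mul hW (contDiffOn_conj (hS a i)) (hS.matDeriv hW (spaceDir k) a l) _ hz,
        dirDeriv_conj hW (hS a i) _ hz]
      rfl
  · intro k
    rw [matDeriv_inv hW (smoothMatrixOn_metricMatrix hW hf)
      (fun y hy => det_metricMatrix_ne_zero (hlag y hy) (hE y hy)) _ hz,
    matDeriv_metricMatrix hW hf k hz]

end Evolution

/-! ### The tangent spaces of the Lagrangian Grassmannians -/

section Tangent

variable {n : ℕ}

/-- A complex matrix as a vector of the Euclidean space of matrices. -/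
noncomputable def toVec (V : Matrix (Fin n) (Fin n) ℂ) : EuclideanSpace ℂ (Fin n × Fin n) :=
  WithLp.toLp 2 fun ij => V ij.1 ij.2

/-- The vector `½ U Uᵀ`. -/
noncomputable def halfSquare (U : Matrix.unitaryGroup (Fin n) ℂ) :
    EuclideanSpace ℂ (Fin n × Fin n) :=
  toVec ((2⁻¹ : ℂ) • ((U : Matrix (Fin n) (Fin n) ℂ) * (U : Matrix (Fin n) (Fin n) ℂ)ᵀ))

theorem cartanEmbedding_mk (U : Matrix.unitaryGroup (Fin n) ℂ) :
    cartanEmbedding n (QuotientGroup.mk U) = halfSquare U := rfl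

theorem cartanImmersion_mk (U : Matrix.unitaryGroup (Fin n) ℂ) :
    cartanImmersion n (QuotientGroup.mk U) = halfSquare U := rfl

theorem unitary_mul_conjTranspose (U : Matrix.unitaryGroup (Fin n) ℂ) :
    (U : Matrix (Fin n) (Fin n) ℂ) * (U : Matrix (Fin n) (Fin n) ℂ)ᴴ = 1 :=
  Matrix.mem_unitaryGroup_iff.1 U.2

theorem unitary_conjTranspose_mul (U : Matrix.unitaryGroup (Fin n) ℂ) :
    (U : Matrix (Fin n) (Fin n) ℂ)ᴴ * (U : Matrix (Fin n) (Fin n) ℂ) = 1 :=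
  Matrix.mem_unitaryGroup_iff'.1 U.2

theorem unitary_conj_mul_transpose (U : Matrix.unitaryGroup (Fin n) ℂ) :
    conjM (U : Matrix (Fin n) (Fin n) ℂ) * (U : Matrix (Fin n) (Fin n) ℂ)ᵀ = 1 := by
  have h := congrArg conjM (unitary_mul_conjTranspose U)
  rw [conjM_mul, conjM_conjTranspose] at h
  rw [h]; simp [conjM]

theorem unitary_transpose_mul_conj (U : Matrix.unitaryGroup (Fin n) ℂ) :
    (U : Matrix (Fin n) (Fin n) ℂ)ᵀ * conjM (U : Matrix (Fin n) (Fin n) ℂ) = 1 :=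
  mul_eq_one_comm.1 (unitary_conj_mul_transpose U)

theorem conjM_half_smul (A : Matrix (Fin n) (Fin n) ℂ) :
    conjM ((2⁻¹ : ℂ) • A) = (2⁻¹ : ℂ) • conjM A := by
  ext i j
  have : starRingEnd ℂ (2⁻¹ : ℂ) = 2⁻¹ := by rw [map_inv₀, map_ofNat]
  change starRingEnd ℂ (2⁻¹ * A i j) = 2⁻¹ * starRingEnd ℂ (A i j)
  rw [map_mul, this]

/-! ### One-parameter groups of unitary matrices. -/

section Exp

attribute [local instance] Matrix.linftyOpNormedRing Matrix.linftyOpNormedAlgebra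

theorem hasDerivAt_exp_entry (A : Matrix (Fin n) (Fin n) ℂ) (i j : Fin n) :
    HasDerivAt (fun s : ℝ => NormedSpace.exp (s • A) i j) (A i j) 0 := by
  have h := hasDerivAt_exp_smul_const (𝕂 := ℝ) A 0
  have hL := (LinearMap.toContinuousLinearMap
    (Matrix.entryLinearMap ℝ ℂ i j : Matrix (Fin n) (Fin n) ℂ →ₗ[ℝ] ℂ)).hasFDerivAt.comp_hasDerivAt
      (0 : ℝ) h
  refine hL.congr_deriv ?_
  simp only [zero_smul, NormedSpace.exp_zero, one_mul]
  rfl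

theorem continuous_exp_smul (A : Matrix (Fin n) (Fin n) ℂ) :
    Continuous fun s : ℝ => NormedSpace.exp (s • A) := by
  have h : Continuous (NormedSpace.exp : Matrix (Fin n) (Fin n) ℂ → _) :=
    NormedSpace.exp_continuous
  exact h.comp (continuous_id.smul continuous_const)

theorem exp_mul_exp_self (A : Matrix (Fin n) (Fin n) ℂ) :
    NormedSpace.exp A * NormedSpace.exp A = NormedSpace.exp (A + A) :=
  (Matrix.exp_add_of_commute A A (Commute.refl A)).symm

theorem exp_mul_exp_neg (A : Matrix (Fin n) (Fin n) ℂ) :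
    NormedSpace.exp A * NormedSpace.exp (-A) = 1 := by
  rw [← Matrix.exp_add_of_commute A (-A) (Commute.refl A).neg_right, add_neg_cancel,
    NormedSpace.exp_zero]

end Exp

theorem exp_mem_unitaryGroup {Y : Matrix (Fin n) (Fin n) ℂ} (hY : Yᴴ = -Y) (s : ℝ) :
    NormedSpace.exp (s • Y) ∈ Matrix.unitaryGroup (Fin n) ℂ := by
  rw [Matrix.mem_unitaryGroup_iff, Matrix.star_eq_conjTranspose, ← Matrix.exp_conjTranspose,
    Matrix.conjTranspose_smul, hY, star_trivial, smul_neg]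
  exact exp_mul_exp_neg _

variable {N : Type*} [TopologicalSpace N] {ι : N → EuclideanSpace ℂ (Fin n × Fin n)}
  {π : Matrix.unitaryGroup (Fin n) ℂ → N}

theorem hasDerivWithinAt_toVec {P : ℝ → Matrix (Fin n) (Fin n) ℂ} {P' : Matrix (Fin n) (Fin n) ℂ}
    {J : Set ℝ} {t : ℝ} (h : ∀ i j, HasDerivWithinAt (fun s => P s i j) (P' i j) J t) :
    HasDerivWithinAt (fun s => toVec (P s)) (toVec P') J t := by
  rw [hasDerivWithinAt_iff_hasFDerivWithinAt, hasFDerivWithinAt_piLp]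
  rintro ⟨i, j⟩
  refine (h i j).hasFDerivWithinAt.congr_fderiv ?_
  ext; simp [toVec]

theorem hasDerivAt_toVec {P : ℝ → Matrix (Fin n) (Fin n) ℂ} {P' : Matrix (Fin n) (Fin n) ℂ}
    {t : ℝ} (h : ∀ i j, HasDerivAt (fun s => P s i j) (P' i j) t) :
    HasDerivAt (fun s => toVec (P s)) (toVec P') t := by
  rw [← hasDerivWithinAt_univ]
  exact hasDerivWithinAt_toVec fun i j => (h i j).hasDerivWithinAt

theorem hasDerivAt_apply_toVec {c : ℝ → EuclideanSpace ℂ (Fin n × Fin n)}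
    {v : EuclideanSpace ℂ (Fin n × Fin n)} {t : ℝ} (h : HasDerivAt c v t) (ij : Fin n × Fin n) :
    HasDerivAt (fun s => c s ij) (v ij) t :=
  (PiLp.hasFDerivAt_apply (𝕜 := ℝ) 2 (c t) ij).comp_hasDerivAt t h

theorem hasDerivAt_mul_entry {A B : Matrix (Fin n) (Fin n) ℂ} {P : ℝ → Matrix (Fin n) (Fin n) ℂ}
    {P' : Matrix (Fin n) (Fin n) ℂ} (hP : ∀ i j, HasDerivAt (fun s => P s i j) (P' i j) 0)
    (i j : Fin n) : HasDerivAt (fun s => (A * P s * B) i j) ((A * P' * B) i j) 0 := by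
  simp only [Matrix.mul_apply]
  exact HasDerivAt.fun_sum fun b _ =>
    (HasDerivAt.fun_sum fun a _ => (hP a b).const_mul _).mul_const _

/-- Velocity vectors: the symmetric `V` with `Uᴴ V Ū` purely imaginary are tangent at `[U]`. -/
theorem toVec_mem_immersedTangentSpace (hπ : Continuous π) (hι : ∀ U, ι (π U) = halfSquare U)
    (U : Matrix.unitaryGroup (Fin n) ℂ) {V : Matrix (Fin n) (Fin n) ℂ} (hV : Vᵀ = V)
    (hre : ∀ i j, (((U : Matrix (Fin n) (Fin n) ℂ)ᴴ * V *
      conjM (U : Matrix (Fin n) (Fin n) ℂ)) i j).re = 0) :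
    toVec V ∈ immersedTangentSpace ι (π U) := by
  set u : Matrix (Fin n) (Fin n) ℂ := (U : Matrix (Fin n) (Fin n) ℂ) with hu
  set Y := uᴴ * V * conjM u with hYdef
  have hYs : Yᵀ = Y := by
    have e1 : (conjM u)ᵀ = uᴴ := rfl
    have e2 : (uᴴ)ᵀ = conjM u := rfl
    rw [hYdef, Matrix.transpose_mul, Matrix.transpose_mul, hV, e1, e2, Matrix.mul_assoc]
  have hYh : Yᴴ = -Y := by
    ext i j
    have h1 : Y j i = Y i j := congrFun (congrFun hYs i) j
    rw [Matrix.conjTranspose_apply, h1]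
    apply Complex.ext <;> simp [hre]
  have hVY : V = u * Y * uᵀ := by
    rw [hYdef, Matrix.mul_assoc, Matrix.mul_assoc _ (conjM u), unitary_conj_mul_transpose,
      Matrix.mul_one, ← Matrix.mul_assoc, unitary_mul_conjTranspose, Matrix.one_mul]
  -- As `Y` is symmetric, the curve `[U exp(sY)]` has the image `½ U exp(2sY) Uᵀ`, with velocity `U
  -- Y Uᵀ = V` at `s = 0`; the factor ½ of the embedding is absorbed by the 2.
  refine Submodule.subset_span ⟨fun s => π (U * ⟨NormedSpace.exp (s • Y),
    exp_mem_unitaryGroup hYh s⟩), ?_, ?_, ?_⟩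
  · exact hπ.comp (continuous_const.mul ((continuous_exp_smul Y).subtype_mk _))
  · change π (U * ⟨NormedSpace.exp ((0 : ℝ) • Y), exp_mem_unitaryGroup hYh 0⟩) = π U
    rw [show (⟨NormedSpace.exp ((0 : ℝ) • Y), exp_mem_unitaryGroup hYh 0⟩ :
      Matrix.unitaryGroup (Fin n) ℂ) = 1 from Subtype.ext (by simp), mul_one]
  · have hc : (ι ∘ fun s : ℝ => π (U * ⟨NormedSpace.exp (s • Y), exp_mem_unitaryGroup hYh s⟩))
        = fun s => toVec ((2⁻¹ : ℂ) • (u * NormedSpace.exp (s • (Y + Y)) * uᵀ)) := by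
      funext s
      rw [Function.comp_apply, hι, halfSquare, Matrix.UnitaryGroup.mul_val, Matrix.transpose_mul]
      congr 2
      have : (NormedSpace.exp (s • Y))ᵀ = NormedSpace.exp (s • Y) := by
        rw [← Matrix.exp_transpose, Matrix.transpose_smul, hYs]
      simp only [this]
      rw [smul_add, ← exp_mul_exp_self]
      simp only [Matrix.mul_assoc, ← hu]
    rw [hc]
    refine hasDerivAt_toVec fun i j => ?_
    refine ((hasDerivAt_mul_entry (A := u) (B := uᵀ) (hasDerivAt_exp_entry (Y + Y)) i j).const_mul
      (2⁻¹ : ℂ)).congr_deriv ?_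
    rw [Matrix.mul_add, Matrix.add_mul, ← hVY, Matrix.add_apply]
    ring

/-- Every point `P = ½ W Wᵀ` of the image satisfies `P P̄ = ¼`. Differentiating along a curve gives
`V P̄ + P V̄ = 0`, and conjugating with `U` turns this into `Y + Ȳ = 0` for `Y = Uᴴ V Ū`. The
condition is real linear, so it passes to the span. -/
theorem exists_matrix_of_mem_immersedTangentSpace (hπ : Function.Surjective π)
    (hι : ∀ U, ι (π U) = halfSquare U) (U : Matrix.unitaryGroup (Fin n) ℂ)
    {v : EuclideanSpace ℂ (Fin n × Fin n)} (hv : v ∈ immersedTangentSpace ι (π U)) :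
    ∃ V : Matrix (Fin n) (Fin n) ℂ, v = toVec V ∧
      ∀ i j, (((U : Matrix (Fin n) (Fin n) ℂ)ᴴ * V *
        conjM (U : Matrix (Fin n) (Fin n) ℂ)) i j).re = 0 := by
  set u : Matrix (Fin n) (Fin n) ℂ := (U : Matrix (Fin n) (Fin n) ℂ) with hu
  refine Submodule.span_induction ?_ ?_ ?_ ?_ hv
  · rintro v ⟨c, -, hc0, hc⟩
    choose W hW using fun s => hπ (c s)
    set V : Matrix (Fin n) (Fin n) ℂ := Matrix.of fun i j => v (i, j) with hV
    set P : ℝ → Matrix (Fin n) (Fin n) ℂ := fun s => (2⁻¹ : ℂ) •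
      ((W s : Matrix (Fin n) (Fin n) ℂ) * (W s : Matrix (Fin n) (Fin n) ℂ)ᵀ) with hP
    have hcP : ∀ s, ι (c s) = toVec (P s) := fun s => by rw [← hW, hι]; rfl
    have hvV : v = toVec V := rfl
    have hP0 : P 0 = (2⁻¹ : ℂ) • (u * uᵀ) := by
      have h1 : toVec (P 0) = toVec ((2⁻¹ : ℂ) • (u * uᵀ)) := by
        rw [← hcP, hc0, hι]; rfl
      ext i j
      exact congrFun (congrArg WithLp.ofLp h1) (i, j)
    have hPu : ∀ s, P s * conjM (P s) = (4⁻¹ : ℂ) • 1 := by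
      intro s
      have e : conjM (P s) = (2⁻¹ : ℂ) • (conjM (W s : Matrix (Fin n) (Fin n) ℂ)
          * (W s : Matrix (Fin n) (Fin n) ℂ)ᴴ) := by
        have e1 : conjM (W s : Matrix (Fin n) (Fin n) ℂ)ᵀ = (W s : Matrix (Fin n) (Fin n) ℂ)ᴴ := rfl
        rw [← e1, ← conjM_mul, ← conjM_half_smul]
      rw [e, hP, Matrix.smul_mul, Matrix.mul_smul, smul_smul, Matrix.mul_assoc,
        ← Matrix.mul_assoc _ (conjM _), unitary_transpose_mul_conj, Matrix.one_mul,
        unitary_mul_conjTranspose]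
      norm_num
    have hd : ∀ i j, HasDerivAt (fun s => P s i j) (V i j) 0 := by
      intro i j
      have h := hasDerivAt_apply_toVec hc (i, j)
      have e : (fun s => (ι ∘ c) s (i, j)) = fun s => P s i j := by
        funext s; rw [Function.comp_apply, hcP]; rfl
      rwa [e] at h
    have hskew : V * conjM (P 0) + P 0 * conjM V = 0 := by
      ext i j
      have h1 : HasDerivAt (fun s => (P s * conjM (P s)) i j)
          ((V * conjM (P 0) + P 0 * conjM V) i j) 0 := by
        simp only [Matrix.mul_apply, Matrix.add_apply, ← Finset.sum_add_distrib]
        exact HasDerivAt.fun_sum fun a _ => (hd i a).mul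
          ((Complex.conjCLE : ℂ →L[ℝ] ℂ).hasFDerivAt.comp_hasDerivAt (0 : ℝ) (hd a j))
      simp only [hPu] at h1
      exact h1.unique (hasDerivAt_const _ _)
    refine ⟨V, hvV, fun i j => ?_⟩
    have e1 : conjM (P 0) = (2⁻¹ : ℂ) • (conjM u * uᴴ) := by
      have e2 : conjM uᵀ = uᴴ := rfl
      rw [hP0, ← e2, ← conjM_mul, ← conjM_half_smul]
    have hY : uᴴ * V * conjM u + conjM (uᴴ * V * conjM u) = 0 := by
      have h2 := congrArg (fun A => (2 : ℂ) • (uᴴ * A * u)) hskew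
      rw [e1, hP0] at h2
      simp only [Matrix.mul_add, Matrix.add_mul, Matrix.mul_smul, Matrix.smul_mul,
        smul_add, smul_smul, Matrix.mul_zero, Matrix.zero_mul, smul_zero] at h2
      norm_num at h2
      rw [conjM_mul, conjM_mul, conjM_conjTranspose, conjM_conjM, ← h2]
      congr 1
      · simp only [Matrix.mul_assoc]
        rw [unitary_conjTranspose_mul, Matrix.mul_one]
      · simp only [← Matrix.mul_assoc]
        rw [unitary_conjTranspose_mul, Matrix.one_mul]
    have h3 := congrArg Complex.re (congrFun (congrFun hY i) j)
    simp only [Matrix.add_apply, Matrix.map_apply, Complex.add_re, Complex.conj_re,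
      Matrix.zero_apply, Complex.zero_re] at h3
    linarith
  · exact ⟨0, by ext; simp [toVec], by simp⟩
  · rintro _ _ _ _ ⟨V, rfl, hV⟩ ⟨V', rfl, hV'⟩
    refine ⟨V + V', rfl, fun i j => ?_⟩
    rw [Matrix.mul_add, Matrix.add_mul, Matrix.add_apply, Complex.add_re, hV, hV', add_zero]
  · rintro a _ _ ⟨V, rfl, hV⟩
    refine ⟨a • V, rfl, fun i j => ?_⟩
    rw [Matrix.mul_smul, Matrix.smul_mul, Matrix.smul_apply, Complex.smul_re, hV, smul_zero]

theorem inner_toVec (V W : Matrix (Fin n) (Fin n) ℂ) :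
    inner ℝ (toVec V) (toVec W) = (Vᴴ * W).trace.re := by
  simp only [PiLp.inner_apply, toVec, Fintype.sum_prod_type, Matrix.trace, Matrix.diag_apply,
    Matrix.mul_apply, Matrix.conjTranspose_apply, Complex.re_sum]
  rw [Finset.sum_comm]
  refine Finset.sum_congr rfl fun i _ => Finset.sum_congr rfl fun j _ => ?_
  simp [Complex.inner]; ring

/-- The map `V ↦ Uᴴ V Ū` preserves the Frobenius inner product, and a matrix with real entries is
orthogonal to one with imaginary entries. -/
theorem inner_toVec_eq_zero (U : Matrix.unitaryGroup (Fin n) ℂ) {W V : Matrix (Fin n) (Fin n) ℂ}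
    (hW : ∀ i j, (((U : Matrix (Fin n) (Fin n) ℂ)ᴴ * W *
        conjM (U : Matrix (Fin n) (Fin n) ℂ)) i j).im = 0)
    (hV : ∀ i j, (((U : Matrix (Fin n) (Fin n) ℂ)ᴴ * V *
        conjM (U : Matrix (Fin n) (Fin n) ℂ)) i j).re = 0) :
    inner ℝ (toVec W) (toVec V) = 0 := by
  set u : Matrix (Fin n) (Fin n) ℂ := (U : Matrix (Fin n) (Fin n) ℂ) with hu
  have h1 : (Wᴴ * V).trace = ((uᴴ * W * conjM u)ᴴ * (uᴴ * V * conjM u)).trace := by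
    have e2 : (conjM u)ᴴ = uᵀ := by ext i j; simp
    rw [Matrix.conjTranspose_mul, Matrix.conjTranspose_mul, Matrix.conjTranspose_conjTranspose, e2]
    have e3 : uᵀ * (Wᴴ * u) * (uᴴ * V * conjM u) = uᵀ * (Wᴴ * V * conjM u) := by
      calc _ = uᵀ * (Wᴴ * (u * uᴴ) * V * conjM u) := by simp only [Matrix.mul_assoc]
        _ = _ := by rw [unitary_mul_conjTranspose, Matrix.mul_one]
    rw [e3, Matrix.trace_mul_comm uᵀ, Matrix.mul_assoc, unitary_conj_mul_transpose, Matrix.mul_one]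
  rw [inner_toVec, h1]
  simp only [Matrix.trace, Matrix.diag_apply, Matrix.mul_apply (M := (uᴴ * W * conjM u)ᴴ),
    Matrix.conjTranspose_apply, Complex.re_sum]
  refine Finset.sum_eq_zero fun i _ => Finset.sum_eq_zero fun j _ => ?_
  rw [Complex.mul_re, hV, Complex.star_def, Complex.conj_im, hW]
  ring

theorem im_congruence_eq_zero {A : Matrix (Fin n) (Fin n) ℂ} (hA : ∀ i j, (A i j).im = 0)
    (R : Matrix (Fin n) (Fin n) ℝ) (i j : Fin n) :
    (((R.map Complex.ofReal)ᴴ * A * conjM (R.map Complex.ofReal)) i j).im = 0 := by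
  simp [Matrix.mul_apply, Complex.im_sum, Complex.mul_im, hA]

theorem re_congruence_eq_zero {A : Matrix (Fin n) (Fin n) ℂ} (hA : ∀ i j, (A i j).re = 0)
    (R : Matrix (Fin n) (Fin n) ℝ) (i j : Fin n) :
    (((R.map Complex.ofReal)ᴴ * A * conjM (R.map Complex.ofReal)) i j).re = 0 := by
  simp [Matrix.mul_apply, Complex.re_sum, Complex.mul_re, hA]

/-- The tangential part of `W`, if `W - V` is normal and `V` is tangential at `[U]`; both
conditions can be checked in any real frame `E` of the Lagrangian subspace `[U]`. -/
theorem starProjection_immersedTangentSpace (hπ : Continuous π) (hπ' : Function.Surjective π)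
    (hι : ∀ U, ι (π U) = halfSquare U) {y : N} {U : Matrix.unitaryGroup (Fin n) ℂ} (hy : y = π U)
    {E : Matrix (Fin n) (Fin n) ℂ} {R : Matrix (Fin n) (Fin n) ℝ}
    (hE : (U : Matrix (Fin n) (Fin n) ℂ) = E * R.map Complex.ofReal)
    {V W : Matrix (Fin n) (Fin n) ℂ} (hV : Vᵀ = V)
    (hVre : ∀ i j, ((Eᴴ * V * conjM E) i j).re = 0)
    (hWV : ∀ i j, ((Eᴴ * (W - V) * conjM E) i j).im = 0) :
    (immersedTangentSpace ι y).starProjection (toVec W) = toVec V := by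
  subst hy
  have hcong : ∀ A : Matrix (Fin n) (Fin n) ℂ, (U : Matrix (Fin n) (Fin n) ℂ)ᴴ * A *
      conjM (U : Matrix (Fin n) (Fin n) ℂ) = (R.map Complex.ofReal)ᴴ * (Eᴴ * A * conjM E)
        * conjM (R.map Complex.ofReal) := by
    intro A
    rw [hE, conjM_mul, Matrix.conjTranspose_mul]
    simp only [Matrix.mul_assoc]
  refine Submodule.eq_starProjection_of_mem_of_inner_eq_zero ?_ ?_
  · refine toVec_mem_immersedTangentSpace hπ hι U hV fun i j => ?_
    rw [hcong]
    exact re_congruence_eq_zero hVre R i j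
  · intro w hw
    obtain ⟨Z, rfl, hZ⟩ := exists_matrix_of_mem_immersedTangentSpace hπ' hι U hw
    have : toVec W - toVec V = toVec (W - V) := rfl
    rw [this]
    refine inner_toVec_eq_zero U (fun i j => ?_) hZ
    rw [hcong]
    exact im_congruence_eq_zero hWV R i j

end Tangent

/-! ### The mean curvature vector in coordinates -/

section MeanCurvature

variable {n : ℕ}

/-- The Gram matrix of the vectors `hᵢ`. -/
noncomputable def realGram (h : Fin n → Cn n) : Matrix (Fin n) (Fin n) ℝ :=
  Matrix.of fun i j => realInner (h i) (h j)

/-- The part of `v` that is normal to the real span of the vectors `hᵢ`. -/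
noncomputable def normalPart (h : Fin n → Cn n) (v : Cn n) : Cn n :=
  v - ∑ k, ∑ l, ((realGram h)⁻¹ k l * realInner v (h k)) • h l

/-- The mean curvature vector of a parametrized immersion `h`. -/
noncomputable def coordMeanCurvature (h : Rn n → Cn n) (x : Rn n) : Cn n :=
  ∑ i, ∑ j, (realGram fun k => partialDeriv k h x)⁻¹ i j •
    normalPart (fun k => partialDeriv k h x) (partialDeriv i (partialDeriv j h) x)

theorem realInner_add_left (v w z : Cn n) :
    realInner (v + w) z = realInner v z + realInner w z := by
  simp [realInner]

theorem realInner_smul_left (c : ℝ) (v z : Cn n) :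
    realInner (c • v) z = c * realInner v z := by
  have : c • v = (c : ℂ) • v := by ext i; simp
  rw [this]
  simp [realInner]

theorem realInner_comm (v w : Cn n) : realInner v w = realInner w v := by
  unfold realInner
  rw [← inner_conj_symm, Complex.conj_re]

theorem realInner_smul_right (c : ℝ) (v z : Cn n) :
    realInner z (c • v) = c * realInner z v := by
  rw [realInner_comm, realInner_smul_left, realInner_comm]

theorem realInner_sum_left {α : Type*} (s : Finset α) (v : α → Cn n) (z : Cn n) :
    realInner (∑ i ∈ s, v i) z = ∑ i ∈ s, realInner (v i) z := by
  simp [realInner]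

theorem realInner_sum_right {α : Type*} (s : Finset α) (v : α → Cn n) (z : Cn n) :
    realInner z (∑ i ∈ s, v i) = ∑ i ∈ s, realInner z (v i) := by
  simp [realInner]

theorem normalPart_add (h : Fin n → Cn n) (v w : Cn n) :
    normalPart h (v + w) = normalPart h v + normalPart h w := by
  simp only [normalPart, realInner_add_left, mul_add, add_smul, Finset.sum_add_distrib]
  abel

theorem normalPart_smul (h : Fin n → Cn n) (c : ℝ) (v : Cn n) :
    normalPart h (c • v) = c • normalPart h v := by
  simp only [normalPart, realInner_smul_left, smul_sub, Finset.smul_sum, smul_smul]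
  congr 1
  exact Finset.sum_congr rfl fun k _ => Finset.sum_congr rfl fun l _ => by congr 1; ring

theorem normalPart_sum (h : Fin n → Cn n) {α : Type*} (s : Finset α) (v : α → Cn n) :
    normalPart h (∑ i ∈ s, v i) = ∑ i ∈ s, normalPart h (v i) :=
  map_sum (⟨⟨normalPart h, normalPart_add h⟩, normalPart_smul h⟩ : Cn n →ₗ[ℝ] Cn n) v s

theorem normalPart_self {h : Fin n → Cn n} (hG : (realGram h).det ≠ 0) (a : Fin n) :
    normalPart h (h a) = 0 := by
  have h1 : ∀ l, ∑ k, (realGram h)⁻¹ k l * realInner (h a) (h k) = (1 : Matrix _ _ ℝ) a l := by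
    intro l
    rw [← Matrix.mul_nonsing_inv _ (isUnit_iff_ne_zero.2 hG), Matrix.mul_apply]
    exact Finset.sum_congr rfl fun k _ => mul_comm _ _
  unfold normalPart
  rw [Finset.sum_comm]
  simp only [← Finset.sum_smul, h1, Matrix.one_apply, ite_smul, one_smul, zero_smul]
  simp

/-- The transformation law of a contraction under a change of frame `D`. With `inv_congruence` it
shows that contraction with the inverse metric does not depend on the frame. -/
theorem sum_contraction {V : Type*} [AddCommGroup V] [Module ℝ V]
    (M D : Matrix (Fin n) (Fin n) ℝ) (X : Fin n → Fin n → V) :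
    ∑ k, ∑ l, M k l • ∑ a, ∑ b, (D a k * D b l) • X a b
      = ∑ a, ∑ b, (D * M * Dᵀ) a b • X a b := by
  simp only [Finset.smul_sum, smul_smul, Matrix.mul_apply, Matrix.transpose_apply, Finset.sum_smul,
    Finset.sum_mul]
  calc _ = ∑ k, ∑ a, ∑ l, ∑ b, (M k l * (D a k * D b l)) • X a b :=
        Finset.sum_congr rfl fun k _ => Finset.sum_comm
    _ = ∑ a, ∑ k, ∑ l, ∑ b, (M k l * (D a k * D b l)) • X a b := Finset.sum_comm
    _ = ∑ a, ∑ k, ∑ b, ∑ l, (M k l * (D a k * D b l)) • X a b :=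
        Finset.sum_congr rfl fun a _ => Finset.sum_congr rfl fun k _ => Finset.sum_comm
    _ = ∑ a, ∑ b, ∑ k, ∑ l, (M k l * (D a k * D b l)) • X a b :=
        Finset.sum_congr rfl fun a _ => Finset.sum_comm
    _ = ∑ a, ∑ b, ∑ l, ∑ k, (M k l * (D a k * D b l)) • X a b :=
        Finset.sum_congr rfl fun a _ => Finset.sum_congr rfl fun b _ => Finset.sum_comm
    _ = _ := Finset.sum_congr rfl fun a _ => Finset.sum_congr rfl fun b _ =>
        Finset.sum_congr rfl fun l _ => Finset.sum_congr rfl fun k _ => by congr 1; ring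

theorem realGram_comp (h : Fin n → Cn n) (D : Matrix (Fin n) (Fin n) ℝ) :
    realGram (fun l => ∑ b, D b l • h b) = Dᵀ * realGram h * D := by
  ext k l
  simp only [Matrix.mul_apply]
  change realInner _ _ = _
  rw [realInner_sum_right]
  refine Finset.sum_congr rfl fun b _ => ?_
  rw [realInner_smul_right, realInner_sum_left, Finset.sum_mul, Finset.mul_sum]
  refine Finset.sum_congr rfl fun a _ => ?_
  rw [realInner_smul_left]
  simp only [realGram, Matrix.of_apply, Matrix.transpose_apply]
  ring

theorem inv_congruence {G D : Matrix (Fin n) (Fin n) ℝ} (hD : D.det ≠ 0) :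
    D * (Dᵀ * G * D)⁻¹ * Dᵀ = G⁻¹ := by
  have h1 : IsUnit D.det := isUnit_iff_ne_zero.2 hD
  have h2 : IsUnit (Dᵀ).det := by rwa [Matrix.det_transpose]
  rw [Matrix.mul_inv_rev, Matrix.mul_inv_rev, ← Matrix.mul_assoc, Matrix.mul_nonsing_inv _ h1,
    Matrix.one_mul, Matrix.nonsing_inv_mul_cancel_right _ _ h2]

theorem normalPart_comp (h : Fin n → Cn n) {D : Matrix (Fin n) (Fin n) ℝ} (hD : D.det ≠ 0)
    (v : Cn n) : normalPart (fun l => ∑ b, D b l • h b) v = normalPart h v := by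
  unfold normalPart
  congr 1
  rw [realGram_comp, ← inv_congruence (G := realGram h) hD]
  have := sum_contraction ((Dᵀ * realGram h * D)⁻¹) D (fun a b => realInner v (h a) • h b)
  simp only [smul_smul] at this
  rw [← this]
  refine Finset.sum_congr rfl fun k _ => Finset.sum_congr rfl fun l _ => ?_
  rw [realInner_sum_right, mul_smul, Finset.sum_smul]
  congr 1
  refine Finset.sum_congr rfl fun a _ => ?_
  rw [realInner_smul_right, Finset.smul_sum]
  refine Finset.sum_congr rfl fun b _ => ?_
  rw [smul_smul]
  congr 1
  ring

/-- The Jacobian matrix. -/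
noncomputable def jacobian (θ : Rn n → Rn n) (y : Rn n) : Matrix (Fin n) (Fin n) ℝ :=
  Matrix.of fun b l => partialDeriv l θ y b

theorem sum_smul_single (v : Rn n) : ∑ b, v b • EuclideanSpace.single b (1 : ℝ) = v := by
  ext i
  simp [Pi.single_apply]

theorem partialDeriv_comp {V : Type*} [NormedAddCommGroup V] [NormedSpace ℝ V] {h : Rn n → V}
    {θ : Rn n → Rn n} {y : Rn n} (hh : DifferentiableAt ℝ h (θ y)) (hθ : DifferentiableAt ℝ θ y)
    (l : Fin n) : partialDeriv l (h ∘ θ) y = ∑ b, jacobian θ y b l • partialDeriv b h (θ y) := by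
  unfold partialDeriv
  rw [fderiv_comp y hh hθ, ContinuousLinearMap.comp_apply]
  conv_lhs => rw [← sum_smul_single (fderiv ℝ θ y (EuclideanSpace.single l 1))]
  rw [map_sum]
  simp only [map_smul]
  rfl

theorem partialDeriv_contDiffAt {V : Type*} [NormedAddCommGroup V] [NormedSpace ℝ V] {h : Rn n → V}
    {x : Rn n} (hh : ContDiffAt ℝ ∞ h x) (i : Fin n) : ContDiffAt ℝ ∞ (partialDeriv i h) x :=
  (hh.fderiv_right (by simp)).clm_apply contDiffAt_const

theorem partialDeriv_congr {V : Type*} [NormedAddCommGroup V] [NormedSpace ℝ V] {h h' : Rn n → V}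
    {x : Rn n} (hh : h =ᶠ[𝓝 x] h') (i : Fin n) : partialDeriv i h =ᶠ[𝓝 x] partialDeriv i h' := by
  filter_upwards [hh.eventuallyEq_nhds] with y hy
  unfold partialDeriv
  rw [hy.fderiv_eq]

theorem partialDeriv_add_const {V : Type*} [NormedAddCommGroup V] [NormedSpace ℝ V] (h : Rn n → V)
    (v : V) (i : Fin n) : partialDeriv i (fun y => h y + v) = partialDeriv i h := by
  funext y
  unfold partialDeriv
  rw [fderiv_add_const]

theorem contDiffAt_eventually {V : Type*} [NormedAddCommGroup V] [NormedSpace ℝ V] {h : Rn n → V}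
    {x : Rn n} (hh : ContDiffAt ℝ ∞ h x) : ∀ᶠ y in 𝓝 x, DifferentiableAt ℝ h y := by
  have h1 : ContDiffAt ℝ 1 h x := hh.of_le (by simp)
  filter_upwards [h1.eventually (by simp)] with y hy
  exact hy.differentiableAt (by simp)

theorem jacobian_contDiffAt {θ : Rn n → Rn n} {y : Rn n} (hθ : ContDiffAt ℝ ∞ θ y) (b l : Fin n) :
    ContDiffAt ℝ ∞ (fun z => jacobian θ z b l) y :=
  (EuclideanSpace.proj b : Rn n →L[ℝ] ℝ).contDiff.contDiffAt.comp y
    (partialDeriv_contDiffAt hθ l)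

/-- The mean curvature vector does not depend on the parametrization. -/
theorem coordMeanCurvature_comp {h h' : Rn n → Cn n} {θ : Rn n → Rn n} {y : Rn n} {v : Cn n}
    (hh : ContDiffAt ℝ ∞ h (θ y)) (hθ : ContDiffAt ℝ ∞ θ y) (hD : (jacobian θ y).det ≠ 0)
    (hG : (realGram fun k => partialDeriv k h (θ y)).det ≠ 0)
    (hh' : h' =ᶠ[𝓝 y] fun z => h (θ z) + v) :
    coordMeanCurvature h' y = coordMeanCurvature h (θ y) := by
  have h1 : ∀ l, partialDeriv l h' =ᶠ[𝓝 y]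
      fun z => ∑ b, jacobian θ z b l • partialDeriv b h (θ z) := by
    intro l
    refine (partialDeriv_congr hh' l).trans ?_
    have e := partialDeriv_add_const (fun z => h (θ z)) v l
    rw [e]
    filter_upwards [contDiffAt_eventually hθ,
      hθ.continuousAt.eventually (contDiffAt_eventually hh)] with z hz1 hz2
    exact partialDeriv_comp hz2 hz1 l
  -- The second-order chain rule. The terms with second derivatives of `θ` are combinations of the
  -- `∂_b h`, hence tangential, and vanish in the normal part.
  have h2 : ∀ k l, partialDeriv k (partialDeriv l h') y
      = ∑ b, partialDeriv k (fun z => jacobian θ z b l) y • partialDeriv b h (θ y)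
        + ∑ a, ∑ b, (jacobian θ y a k * jacobian θ y b l) •
          partialDeriv a (partialDeriv b h) (θ y) := by
    intro k l
    rw [(partialDeriv_congr (h1 l) k).eq_of_nhds]
    have d1 : ∀ b, DifferentiableAt ℝ (fun z => jacobian θ z b l) y :=
      fun b => (jacobian_contDiffAt hθ b l).differentiableAt (by simp)
    have d2 : ∀ b, DifferentiableAt ℝ (partialDeriv b h) (θ y) :=
      fun b => (partialDeriv_contDiffAt hh b).differentiableAt (by simp)
    have d0 := hθ.differentiableAt (by simp : (∞ : WithTop ℕ∞) ≠ 0)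
    have d3 : ∀ b, DifferentiableAt ℝ (fun z => partialDeriv b h (θ z)) y :=
      fun b => (d2 b).comp y d0
    have e1 : partialDeriv k (fun z => ∑ b, jacobian θ z b l • partialDeriv b h (θ z)) y
        = ∑ b, (partialDeriv k (fun z => jacobian θ z b l) y • partialDeriv b h (θ y)
          + jacobian θ y b l • partialDeriv k (partialDeriv b h ∘ θ) y) := by
      have hs := HasFDerivAt.fun_sum (u := Finset.univ)
        fun b _ => (d1 b).hasFDerivAt.fun_smul (d3 b).hasFDerivAt
      unfold partialDeriv at hs ⊢
      rw [hs.fderiv, _root_.sum_apply]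
      refine Finset.sum_congr rfl fun b _ => ?_
      simp only [_root_.add_apply, _root_.smul_apply,
        ContinuousLinearMap.smulRight_apply]
      rw [add_comm]
      rfl
    rw [e1, Finset.sum_add_distrib]
    congr 1
    rw [Finset.sum_comm]
    refine Finset.sum_congr rfl fun b _ => ?_
    rw [partialDeriv_comp (d2 b) d0, Finset.smul_sum]
    exact Finset.sum_congr rfl fun a _ => by rw [smul_smul, mul_comm]
  unfold coordMeanCurvature
  have h3 : (fun k => partialDeriv k h' y)
      = fun l => ∑ b, jacobian θ y b l • partialDeriv b h (θ y) :=
    funext fun l => (h1 l).eq_of_nhds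
  have h4 : ∀ k l, normalPart (fun k => partialDeriv k h' y)
      (partialDeriv k (partialDeriv l h') y)
      = ∑ a, ∑ b, (jacobian θ y a k * jacobian θ y b l) •
        normalPart (fun k => partialDeriv k h (θ y)) (partialDeriv a (partialDeriv b h) (θ y)) := by
    intro k l
    rw [h3, normalPart_comp _ hD, h2, normalPart_add, normalPart_sum, normalPart_sum,
      Finset.sum_eq_zero, zero_add]
    · refine Finset.sum_congr rfl fun a _ => ?_
      rw [normalPart_sum]
      exact Finset.sum_congr rfl fun b _ => normalPart_smul _ _ _
    · intro b _
      rw [normalPart_smul, normalPart_self hG b, smul_zero]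
  simp only [h4]
  rw [sum_contraction, h3, realGram_comp, inv_congruence hD]

/-- A vector `c` in the kernel of the Gram matrix makes `∑ cᵢ hᵢ` a vector of length zero. -/
theorem realGram_det_ne_zero {h : Fin n → Cn n} (hh : LinearIndependent ℝ h) :
    (realGram h).det ≠ 0 := by
  intro h0
  obtain ⟨c, hc, hc'⟩ := Matrix.exists_mulVec_eq_zero_iff.2 h0
  have h1 : realInner (∑ i, c i • h i) (∑ i, c i • h i) = 0 := by
    rw [realInner_sum_left]
    refine Finset.sum_eq_zero fun i _ => ?_
    rw [realInner_smul_left, realInner_sum_right]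
    have := congrFun hc' i
    simp only [Matrix.mulVec, dotProduct, realGram, Matrix.of_apply, Pi.zero_apply] at this
    simp only [realInner_smul_right]
    rw [show ∑ j, c j * realInner (h i) (h j) = 0 from
      (Finset.sum_congr rfl fun j _ => mul_comm _ _).trans this, mul_zero]
  have h2 : ∑ i, c i • h i = 0 := by
    unfold realInner at h1
    have : ((‖∑ i, c i • h i‖ : ℝ) ^ 2) = 0 := by
      rw [← h1, inner_self_eq_norm_sq_to_K]; norm_cast
    simpa using this
  exact hc (funext (Fintype.linearIndependent_iff.1 hh c h2))

theorem meanCurvature_eq {S : Type*} [TopologicalSpace S] [ChartedSpace (Rn n) S] {M : Type*}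
    [TopologicalSpace M] [ChartedSpace (Cn n) M] (F : S → M) (p : S) :
    meanCurvature (n := n) F p = coordMeanCurvature
      (writtenInExtChartAt (𝓡 n) 𝓘(ℝ, Cn n) p F) (extChartAt (𝓡 n) p p) := rfl

end MeanCurvature

/-! ### Space-time products -/

section Product

variable {n : ℕ} {K : Set ℝ} {Ω : Set (Rn n)} {V : Type*} [NormedAddCommGroup V] [NormedSpace ℝ V]

/-- The geometric definitions differentiate at a fixed time, the evolution equation within the
product `K ×ˢ Ω`. Since `Ω` is open, the derivative on a time slice is an ordinary one, even at an
end point of `K`. -/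
theorem hasFDerivAt_slice {u : ℝ × Rn n → V} {t : ℝ} {x : Rn n} (hΩ : IsOpen Ω) (ht : t ∈ K)
    (hx : x ∈ Ω) (hu : DifferentiableWithinAt ℝ u (K ×ˢ Ω) (t, x)) :
    HasFDerivAt (fun y => u (t, y))
      ((fderivWithin ℝ u (K ×ˢ Ω) (t, x)).comp (ContinuousLinearMap.inr ℝ ℝ (Rn n))) x := by
  have h1 : HasFDerivWithinAt (fun y : Rn n => (t, y)) (ContinuousLinearMap.inr ℝ ℝ (Rn n)) Ω x :=
    (hasFDerivAt_prodMk_right t x).hasFDerivWithinAt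
  exact (hu.hasFDerivWithinAt.comp x h1 fun y hy => ⟨ht, hy⟩).hasFDerivAt (hΩ.mem_nhds hx)

theorem partialDeriv_slice {u : ℝ × Rn n → V} {t : ℝ} {x : Rn n} (hΩ : IsOpen Ω) (ht : t ∈ K)
    (hx : x ∈ Ω) (hu : DifferentiableWithinAt ℝ u (K ×ˢ Ω) (t, x)) (i : Fin n) :
    partialDeriv i (fun y => u (t, y)) x = dirDeriv (K ×ˢ Ω) (spaceDir i) u (t, x) := by
  unfold partialDeriv
  rw [(hasFDerivAt_slice hΩ ht hx hu).fderiv]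
  rfl

theorem hasDerivWithinAt_slice {u : ℝ × Rn n → V} {t : ℝ} {x : Rn n}
    (hx : x ∈ Ω) (hu : DifferentiableWithinAt ℝ u (K ×ˢ Ω) (t, x)) :
    HasDerivWithinAt (fun s => u (s, x)) (dirDeriv (K ×ˢ Ω) (timeDir n) u (t, x)) K t := by
  have h1 : HasFDerivWithinAt (fun s : ℝ => (s, x)) (ContinuousLinearMap.inl ℝ ℝ (Rn n)) K t :=
    (hasFDerivAt_prodMk_left t x).hasFDerivWithinAt
  have h2 : MapsTo (fun s : ℝ => (s, x)) K (K ×ˢ Ω) := fun s hs => ⟨hs, hx⟩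
  exact (hu.hasFDerivWithinAt.comp t h1 h2).hasDerivWithinAt

theorem contDiffAt_slice {u : ℝ × Rn n → V} {t : ℝ} {x : Rn n} (hΩ : IsOpen Ω) (ht : t ∈ K)
    (hx : x ∈ Ω) (hu : ContDiffOn ℝ ∞ u (K ×ˢ Ω)) : ContDiffAt ℝ ∞ (fun y => u (t, y)) x :=
  (hu.comp (s := Ω) (contDiff_prodMk_right t).contDiffOn fun _ hy => ⟨ht, hy⟩).contDiffAt
    (hΩ.mem_nhds hx)

theorem partialDeriv_partialDeriv_slice {u : ℝ × Rn n → V} {t : ℝ} {x : Rn n} (hΩ : IsOpen Ω)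
    (hW : UniqueDiffOn ℝ (K ×ˢ Ω)) (ht : t ∈ K) (hx : x ∈ Ω) (hu : ContDiffOn ℝ ∞ u (K ×ˢ Ω))
    (i j : Fin n) :
    partialDeriv i (partialDeriv j fun y => u (t, y)) x
      = dirDeriv (K ×ˢ Ω) (spaceDir i) (dirDeriv (K ×ˢ Ω) (spaceDir j) u) (t, x) := by
  have h1 : (partialDeriv j fun y => u (t, y))
      =ᶠ[𝓝 x] fun y => dirDeriv (K ×ˢ Ω) (spaceDir j) u (t, y) := by
    filter_upwards [hΩ.mem_nhds hx] with y hy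
    exact partialDeriv_slice hΩ ht hy (hu.differentiableOn (by simp) _ ⟨ht, hy⟩) j
  rw [(partialDeriv_congr h1 i).eq_of_nhds]
  exact partialDeriv_slice hΩ ht hx
    ((dirDeriv_contDiffOn hW hu _).differentiableOn (by simp) _ ⟨ht, hx⟩) i

theorem dirDeriv_component {W : Set (ℝ × Rn n)} (hW : UniqueDiffOn ℝ W) {f : ℝ × Rn n → Cn n}
    (hf : ContDiffOn ℝ ∞ f W) (v : ℝ × Rn n) {z : ℝ × Rn n} (hz : z ∈ W) (a : Fin n) :
    dirDeriv W v (fun y => f y a) z = dirDeriv W v f z a :=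
  dirDeriv_clm hW hf ((EuclideanSpace.proj a : Cn n →L[ℂ] ℂ).restrictScalars ℝ) v hz

theorem realInner_eq (v w : Cn n) : realInner v w = (∑ a, starRingEnd ℂ (v a) * w a).re := by
  simp [realInner, PiLp.inner_apply, mul_comm]

/-- The mean curvature vector in terms of the frame and the Christoffel symbols. -/
theorem coordMeanCurvature_slice {f : ℝ × Rn n → Cn n} {t : ℝ} {x : Rn n} (hΩ : IsOpen Ω)
    (hW : UniqueDiffOn ℝ (K ×ˢ Ω)) (hc : K ×ˢ Ω ⊆ closure (interior (K ×ˢ Ω)))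
    (ht : t ∈ K) (hx : x ∈ Ω) (hf : ContDiffOn ℝ ∞ f (K ×ˢ Ω)) (a : Fin n) :
    coordMeanCurvature (fun y => f (t, y)) x a
      = ∑ k, ∑ l, ((metricMatrix (K ×ˢ Ω) f (t, x))⁻¹ k l : ℂ) *
        (matDeriv (K ×ˢ Ω) (spaceDir k) (frame (K ×ˢ Ω) f) (t, x) a l
        - ∑ r, (((metricMatrix (K ×ˢ Ω) f (t, x))⁻¹ * lowerChristoffel (K ×ˢ Ω) f (t, x) l) r k : ℂ)
          * frame (K ×ˢ Ω) f (t, x) a r) := by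
  set W := K ×ˢ Ω with hWdef
  have hz : (t, x) ∈ W := ⟨ht, hx⟩
  have e1 : ∀ i a, partialDeriv i (fun y => f (t, y)) x a = frame W f (t, x) a i := by
    intro i a
    rw [partialDeriv_slice hΩ ht hx (hf.differentiableOn (by simp) _ hz),
      ← dirDeriv_component hW hf _ hz]
    rfl
  have e2 : ∀ i j a, partialDeriv i (partialDeriv j fun y => f (t, y)) x a
      = matDeriv W (spaceDir i) (frame W f) (t, x) a j := by
    intro i j a
    rw [partialDeriv_partialDeriv_slice hΩ hW ht hx hf,
      ← dirDeriv_component hW (dirDeriv_contDiffOn hW hf _) _ hz]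
    exact dirDeriv_congr (fun y hy => (dirDeriv_component hW hf _ hy a).symm) _ hz
  have e3 : (realGram fun k => partialDeriv k (fun y => f (t, y)) x) = metricMatrix W f (t, x) := by
    ext i j
    simp only [realGram, Matrix.of_apply, realInner_eq, e1]
    rfl
  have e4 : ∀ i j k, realInner (partialDeriv i (partialDeriv j fun y => f (t, y)) x)
      (partialDeriv k (fun y => f (t, y)) x) = lowerChristoffel W f (t, x) j k i := by
    intro i j k
    rw [realInner_comm, realInner_eq]
    simp only [e1, e2]
    simp only [frame_symm hW hc hf i _ j hz]
    rfl
  have hsymm : ∀ k l, (metricMatrix W f (t, x))⁻¹ k l = (metricMatrix W f (t, x))⁻¹ l k := by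
    intro k l
    have h : ((metricMatrix W f (t, x))⁻¹)ᵀ = (metricMatrix W f (t, x))⁻¹ := by
      rw [Matrix.transpose_nonsing_inv, metricMatrix_transpose]
    exact congrFun (congrFun h l) k
  unfold coordMeanCurvature
  rw [e3]
  have e5 : ∀ (s : Finset (Fin n)) (v : Fin n → Cn n), (∑ i ∈ s, v i) a = ∑ i ∈ s, v i a :=
    fun s v => by simp
  have e6 : ∀ (c : ℝ) (v : Cn n), (c • v) a = (c : ℂ) * v a := fun c v => by simp
  have e7 : ∀ v w : Cn n, (v - w) a = v a - w a := fun v w => rfl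
  simp only [e5, e6, normalPart, e7, e1, e2, e3, e4]
  refine Finset.sum_congr rfl fun k _ => Finset.sum_congr rfl fun l _ => ?_
  congr 2
  rw [Finset.sum_comm]
  refine Finset.sum_congr rfl fun r _ => ?_
  rw [← Finset.sum_mul, Matrix.mul_apply]
  congr 1
  push_cast
  exact Finset.sum_congr rfl fun s _ => by rw [hsymm s r]

end Product

/-! ### Local lifts to `ℂⁿ` of a family of maps to a flat manifold -/

section Lift

variable {n : ℕ} {S : Type*} [TopologicalSpace S] [ChartedSpace (Rn n) S]
  {M : Type*} [TopologicalSpace M] [ChartedSpace (Cn n) M]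

/-- The transition functions of the atlas of `M` are locally translations of `ℂⁿ`. -/
def HasTranslationAtlas (n : ℕ) (M : Type*) [TopologicalSpace M] [ChartedSpace (Cn n) M] : Prop :=
  ∀ e ∈ atlas (Cn n) M, ∀ e' ∈ atlas (Cn n) M, ∀ x ∈ (e.symm.trans e').source,
    ∃ v : Cn n, ∀ᶠ y in 𝓝 x, (e.symm.trans e') y = y + v

theorem hasTranslationAtlas_self : HasTranslationAtlas n (Cn n) := by
  intro e he e' he' x _
  rw [chartedSpaceSelf_atlas] at he he'
  subst he; subst he'
  exact ⟨0, by simp⟩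

theorem hasTranslationAtlas_quotient (Λ : AddSubgroup (Cn n)) [DiscreteTopology Λ] :
    HasTranslationAtlas n (Cn n ⧸ Λ) :=
  fun _ he _ he' _ hx => quotient_transition Λ he he' hx

/-- The tangent space at `y` is identified with `ℂⁿ` by the preferred chart at `y`. Any other chart
of the atlas differs from it by a translation near `y`, so its differential is the identity. -/
theorem hasMFDerivAt_chart (hM : HasTranslationAtlas n M) {ψ : OpenPartialHomeomorph M (Cn n)}
    (hψ : ψ ∈ atlas (Cn n) M) {y : M} (hy : y ∈ ψ.source) :
    HasMFDerivAt 𝓘(ℝ, Cn n) 𝓘(ℝ, Cn n) ψ y (ContinuousLinearMap.id ℝ (Cn n)) := by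
  refine ⟨ψ.continuousAt hy, ?_⟩
  obtain ⟨v, hv⟩ := hM (chartAt (Cn n) y) (chart_mem_atlas _ y) ψ hψ (chartAt (Cn n) y y) (by
    simp [hy])
  refine HasFDerivAt.hasFDerivWithinAt ?_
  have h1 : HasFDerivAt (fun z : Cn n => z + v) (ContinuousLinearMap.id ℝ (Cn n))
      (chartAt (Cn n) y y) := (hasFDerivAt_id _).add_const v
  refine h1.congr_of_eventuallyEq ?_
  filter_upwards [hv] with z hz
  simpa [writtenInExtChartAt, chartAt_self_eq] using hz

/-- `K` is the trace of a ball on `J`. It is relatively open, so derivatives within `K` and within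
`J` agree, and it has interior points even if `t₀` is an end point, because `t₀` lies in the closure
of the interior of `J`. -/
theorem exists_box {J : Set ℝ} (hJ : Convex ℝ J) (hJ' : (interior J).Nonempty) {t₀ : ℝ}
    (ht₀ : t₀ ∈ J) {O : Set (Rn n)} (hO : IsOpen O) {x₀ : Rn n} (hx₀ : x₀ ∈ O)
    {A : Set (ℝ × Rn n)} (hA : A ∈ 𝓝[J ×ˢ O] (t₀, x₀)) :
    ∃ (K : Set ℝ) (Ω : Set (Rn n)), K ⊆ J ∧ t₀ ∈ K ∧ (∀ t ∈ K, K ∈ 𝓝[J] t) ∧ Convex ℝ K ∧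
      (interior K).Nonempty ∧ IsOpen Ω ∧ x₀ ∈ Ω ∧ Ω ⊆ O ∧ K ×ˢ Ω ⊆ A := by
  rw [nhdsWithin_prod_eq, Filter.mem_prod_iff] at hA
  obtain ⟨K', hK', Ω', hΩ', hA⟩ := hA
  rw [hO.nhdsWithin_eq hx₀] at hΩ'
  obtain ⟨ε, hε, hball⟩ := Metric.mem_nhdsWithin_iff.1 hK'
  obtain ⟨Ω, hΩs, hΩo, hxΩ⟩ := mem_nhds_iff.1 (Filter.inter_mem hΩ' (hO.mem_nhds hx₀))
  refine ⟨Metric.ball t₀ ε ∩ J, Ω, inter_subset_right, ⟨Metric.mem_ball_self hε, ht₀⟩,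
    fun t ht => ?_, (convex_ball t₀ ε).inter hJ, ?_, hΩo, hxΩ, fun y hy => (hΩs hy).2, ?_⟩
  · exact Filter.inter_mem (mem_nhdsWithin_of_mem_nhds (Metric.isOpen_ball.mem_nhds ht.1))
      self_mem_nhdsWithin
  · have h1 : t₀ ∈ closure (interior J) := by
      rw [hJ.closure_interior_eq_closure_of_nonempty_interior hJ']
      exact subset_closure ht₀
    obtain ⟨s, hs1, hs2⟩ := mem_closure_iff.1 h1 _ Metric.isOpen_ball (Metric.mem_ball_self hε)
    refine ⟨s, ?_⟩
    rw [interior_inter, Metric.isOpen_ball.interior_eq]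
    exact ⟨hs1, hs2⟩
  · rintro ⟨t, x⟩ ⟨ht, hx⟩
    exact hA ⟨hball ht, (hΩs hx).1⟩

theorem uniqueDiffOn_box {K : Set ℝ} {Ω : Set (Rn n)} (hK : Convex ℝ K)
    (hK' : (interior K).Nonempty) (hΩ : IsOpen Ω) : UniqueDiffOn ℝ (K ×ˢ Ω) :=
  (uniqueDiffOn_convex hK hK').prod hΩ.uniqueDiffOn

theorem box_subset_closure_interior {K : Set ℝ} {Ω : Set (Rn n)} (hK : Convex ℝ K)
    (hK' : (interior K).Nonempty) (hΩ : IsOpen Ω) :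
    K ×ˢ Ω ⊆ closure (interior (K ×ˢ Ω)) := by
  rw [interior_prod_eq, closure_prod_eq, hK.closure_interior_eq_closure_of_nonempty_interior hK',
    hΩ.interior_eq]
  exact prod_mono subset_closure subset_closure

theorem contMDiffOn_param {J : Set ℝ} {F : ℝ → S → M}
    (hF : ContMDiffOn (𝓘(ℝ, ℝ).prod (𝓡 n)) 𝓘(ℝ, Cn n) ∞ (fun z : ℝ × S => F z.1 z.2) (J ×ˢ univ))
    {e : OpenPartialHomeomorph S (Rn n)} (he : e ∈ IsManifold.maximalAtlas (𝓡 n) ∞ S) :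
    ContMDiffOn 𝓘(ℝ, ℝ × Rn n) 𝓘(ℝ, Cn n) ∞ (fun z : ℝ × Rn n => F z.1 (e.symm z.2))
      (J ×ˢ e.target) := by
  rw [modelWithCornersSelf_prod, ← chartedSpaceSelf_prod]
  have h1 : ContMDiffOn (𝓘(ℝ, ℝ).prod (𝓡 n)) (𝓘(ℝ, ℝ).prod (𝓡 n)) ∞
      (fun z : ℝ × Rn n => (z.1, e.symm z.2)) (J ×ˢ e.target) :=
    contMDiffOn_fst.prodMk ((contMDiffOn_symm_of_mem_maximalAtlas he).comp contMDiffOn_snd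
      fun z hz => hz.2)
  exact hF.comp h1 fun z hz => ⟨hz.1, mem_univ _⟩

theorem contMDiff_time_slice {J : Set ℝ} {F : ℝ → S → M}
    (hF : ContMDiffOn (𝓘(ℝ, ℝ).prod (𝓡 n)) 𝓘(ℝ, Cn n) ∞ (fun z : ℝ × S => F z.1 z.2) (J ×ˢ univ))
    {t : ℝ} (ht : t ∈ J) : ContMDiff (𝓡 n) 𝓘(ℝ, Cn n) ∞ (F t) := by
  rw [← contMDiffOn_univ]
  exact hF.comp (contMDiffOn_const.prodMk contMDiffOn_id) fun q _ => ⟨ht, mem_univ _⟩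

theorem contMDiffOn_space_slice {J : Set ℝ} {F : ℝ → S → M}
    (hF : ContMDiffOn (𝓘(ℝ, ℝ).prod (𝓡 n)) 𝓘(ℝ, Cn n) ∞ (fun z : ℝ × S => F z.1 z.2) (J ×ˢ univ))
    (q : S) : ContMDiffOn 𝓘(ℝ, ℝ) 𝓘(ℝ, Cn n) ∞ (fun s => F s q) J :=
  hF.comp (contMDiffOn_id.prodMk contMDiffOn_const) fun _ hs => ⟨hs, mem_univ _⟩

theorem transition_contDiffAt {e φ : OpenPartialHomeomorph S (Rn n)}
    (he : e ∈ IsManifold.maximalAtlas (𝓡 n) ∞ S) (hφ : φ ∈ IsManifold.maximalAtlas (𝓡 n) ∞ S)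
    {y : Rn n} (hy : y ∈ φ.target) (hy' : φ.symm y ∈ e.source) :
    ContDiffAt ℝ ∞ (fun z => e (φ.symm z)) y := by
  rw [← contMDiffAt_iff_contDiffAt]
  exact (contMDiffAt_of_mem_maximalAtlas he hy').comp y (contMDiffAt_symm_of_mem_maximalAtlas hφ hy)

theorem jacobian_comp {θ θ' : Rn n → Rn n} {y : Rn n} (h : DifferentiableAt ℝ θ' (θ y))
    (h' : DifferentiableAt ℝ θ y) :
    jacobian (θ' ∘ θ) y = jacobian θ' (θ y) * jacobian θ y := by
  ext i j
  simp only [jacobian, Matrix.of_apply, Matrix.mul_apply]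
  rw [partialDeriv_comp h h']
  simp [jacobian, mul_comm]

theorem jacobian_id (y : Rn n) : jacobian (fun z : Rn n => z) y = 1 := by
  ext i j
  simp only [jacobian, Matrix.of_apply, partialDeriv, fderiv_fun_id]
  simp [Matrix.one_apply]

/-- The chain rule for the transition function and its inverse, whose composition is the identity
near `y`. -/
theorem transition_jacobian_det_ne_zero {e φ : OpenPartialHomeomorph S (Rn n)}
    (he : e ∈ IsManifold.maximalAtlas (𝓡 n) ∞ S) (hφ : φ ∈ IsManifold.maximalAtlas (𝓡 n) ∞ S)
    {y : Rn n} (hy : y ∈ φ.target) (hy' : φ.symm y ∈ e.source) :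
    (jacobian (fun z => e (φ.symm z)) y).det ≠ 0 := by
  have h1 := (transition_contDiffAt he hφ hy hy').differentiableAt (by simp)
  have h2 := (transition_contDiffAt hφ he (e.map_source hy') (by
    rw [e.left_inv hy']; exact φ.map_target hy)).differentiableAt (by simp)
  have h3 : jacobian ((fun z => φ (e.symm z)) ∘ fun z => e (φ.symm z)) y = 1 := by
    rw [← jacobian_id y]
    have : ((fun z => φ (e.symm z)) ∘ fun z => e (φ.symm z)) =ᶠ[𝓝 y] fun z => z := by
      filter_upwards [φ.open_target.mem_nhds hy, (φ.continuousAt_symm hy).preimage_mem_nhds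
        (e.open_source.mem_nhds hy')] with z hz hz'
      rw [Function.comp_apply, e.left_inv hz', φ.right_inv hz]
    ext i j
    simp only [jacobian, Matrix.of_apply]
    rw [(partialDeriv_congr this j).eq_of_nhds]
  rw [jacobian_comp h2 h1] at h3
  intro h0
  have := congrArg Matrix.det h3
  rw [Matrix.det_mul, h0] at this
  simp at this

theorem linearIndependent_single :
    LinearIndependent ℝ fun k : Fin n => (EuclideanSpace.single k (1 : ℝ) : Rn n) := by
  have h := (EuclideanSpace.basisFun (Fin n) ℝ).toBasis.linearIndependent
  have e : ⇑(EuclideanSpace.basisFun (Fin n) ℝ).toBasis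
      = fun k : Fin n => (EuclideanSpace.single k (1 : ℝ) : Rn n) := by
    funext k
    simp
  rwa [e] at h

theorem mfderiv_symm_bijective {e : OpenPartialHomeomorph S (Rn n)}
    (he : e ∈ IsManifold.maximalAtlas (𝓡 n) ∞ S) {x : Rn n} (hx : x ∈ e.target) :
    Function.Bijective (mfderiv 𝓘(ℝ, Rn n) (𝓡 n) e.symm x) := by
  have h : e.MDifferentiable (𝓡 n) 𝓘(ℝ, Rn n) :=
    ⟨(contMDiffOn_of_mem_maximalAtlas he).mdifferentiableOn (by simp),
      (contMDiffOn_symm_of_mem_maximalAtlas he).mdifferentiableOn (by simp)⟩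
  exact h.symm.mfderiv_bijective hx

/-- Local data of a family of immersions: a smooth map `f` to `ℂⁿ` on a product `K × Ω` of a time
interval and an open set of coordinates. -/
structure IsLocalLift (J : Set ℝ) (F : ℝ → S → M) (e : OpenPartialHomeomorph S (Rn n))
    (K : Set ℝ) (Ω : Set (Rn n)) (f : ℝ × Rn n → Cn n) : Prop where
  subset : K ⊆ J
  mem_nhdsWithin : ∀ t ∈ K, K ∈ 𝓝[J] t
  convex : Convex ℝ K
  interior_nonempty : (interior K).Nonempty
  isOpen : IsOpen Ω
  subset_target : Ω ⊆ e.target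
  contDiffOn : ContDiffOn ℝ ∞ f (K ×ˢ Ω)
  differential_eq : ∀ t ∈ K, ∀ x ∈ Ω, ∀ w : Rn n,
    differential (n := n) (F t) (e.symm x) (mfderiv 𝓘(ℝ, Rn n) (𝓡 n) e.symm x w)
      = fderiv ℝ (fun y => f (t, y)) x w
  meanCurvature_eq : ∀ t ∈ K, ∀ x ∈ Ω,
    meanCurvature (n := n) (F t) (e.symm x) = coordMeanCurvature (fun y => f (t, y)) x
  velocity_eq : ∀ t ∈ K, ∀ x ∈ Ω,
    (mfderivWithin 𝓘(ℝ, ℝ) 𝓘(ℝ, Cn n) (fun s => F s (e.symm x)) J t (1 : ℝ) : Cn n)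
      = derivWithin (fun s => f (s, x)) K t

variable [IsManifold (𝓡 n) ∞ S] [IsManifold 𝓘(ℝ, Cn n) ∞ M]

/-- The lift is `F` read in the chart `ψ` at `F t₀ p₀`, on a box that `F` maps into the domain of
`ψ`. The chart `e` of `S` is left arbitrary, because orientations are described by charts of the
maximal atlas. -/
theorem exists_isLocalLift (hM : HasTranslationAtlas n M) {J : Set ℝ} (hJ : Convex ℝ J)
    (hJ' : (interior J).Nonempty) {F : ℝ → S → M}
    (hF : ContMDiffOn (𝓘(ℝ, ℝ).prod (𝓡 n)) 𝓘(ℝ, Cn n) ∞ (fun z : ℝ × S => F z.1 z.2) (J ×ˢ univ))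
    (himm : ∀ t ∈ J, ∀ p : S, Function.Injective (differential (n := n) (F t) p))
    {e : OpenPartialHomeomorph S (Rn n)} (he : e ∈ IsManifold.maximalAtlas (𝓡 n) ∞ S)
    {p₀ : S} (hp₀ : p₀ ∈ e.source) {t₀ : ℝ} (ht₀ : t₀ ∈ J) :
    ∃ K Ω f, IsLocalLift J F e K Ω f ∧ t₀ ∈ K ∧ e p₀ ∈ Ω := by
  set ψ : OpenPartialHomeomorph M (Cn n) := chartAt (Cn n) (F t₀ p₀) with hψdef
  have hψ : ψ ∈ atlas (Cn n) M := chart_mem_atlas _ _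
  have hψ' : ψ ∈ IsManifold.maximalAtlas 𝓘(ℝ, Cn n) ∞ M :=
    IsManifold.subset_maximalAtlas hψ
  have hc := contMDiffOn_param hF he
  have hA : (fun z : ℝ × Rn n => F z.1 (e.symm z.2)) ⁻¹' ψ.source
      ∈ 𝓝[J ×ˢ e.target] (t₀, e p₀) := by
    refine (hc.continuousOn (t₀, e p₀) ⟨ht₀, e.map_source hp₀⟩).preimage_mem_nhdsWithin ?_
    refine ψ.open_source.mem_nhds ?_
    simp only [e.left_inv hp₀]
    exact mem_chart_source _ _
  obtain ⟨K, Ω, hKJ, htK, hKn, hKc, hKi, hΩo, hxΩ, hΩt, hKΩ⟩ :=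
    exists_box hJ hJ' ht₀ e.open_target (e.map_source hp₀) hA
  have hmem : ∀ t ∈ K, ∀ x ∈ Ω, F t (e.symm x) ∈ ψ.source := fun t ht x hx =>
    hKΩ (Set.mk_mem_prod ht hx : (t, x) ∈ K ×ˢ Ω)
  set f : ℝ × Rn n → Cn n := fun z => ψ (F z.1 (e.symm z.2)) with hf
  have hfs : ContDiffOn ℝ ∞ f (K ×ˢ Ω) := by
    rw [← contMDiffOn_iff_contDiffOn]
    exact (contMDiffOn_of_mem_maximalAtlas hψ').comp (hc.mono (prod_mono hKJ hΩt))
      fun z hz => hmem _ hz.1 _ hz.2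
  have hdiff : ∀ t ∈ K, ∀ x ∈ Ω, ∀ w : Rn n,
      differential (n := n) (F t) (e.symm x) (mfderiv 𝓘(ℝ, Rn n) (𝓡 n) e.symm x w)
        = fderiv ℝ (fun y => f (t, y)) x w := by
    intro t ht x hx w
    have h1 := (contMDiffAt_symm_of_mem_maximalAtlas he (hΩt hx)).mdifferentiableAt (n := ∞)
      (by simp)
    have h2 := ((contMDiff_time_slice hF (hKJ ht)) (e.symm x)).mdifferentiableAt (by simp)
    have h3 := (hasMFDerivAt_chart hM hψ (hmem t ht x hx)).comp x
      (h2.hasMFDerivAt.comp x h1.hasMFDerivAt)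
    have h4 := h3.mfderiv
    rw [mfderiv_eq_fderiv] at h4
    exact (congrArg (fun L : Rn n →L[ℝ] Cn n => L w) h4).symm
  refine ⟨K, Ω, f, ⟨hKJ, hKn, hKc, hKi, hΩo, hΩt, hfs, hdiff, ?_, ?_⟩, htK, hxΩ⟩
  -- At each point `q`, `meanCurvature` uses the preferred charts at `q` and at `F t q`, whereas `f`
  -- uses the fixed charts `e` and `ψ`. The two expressions differ by the reparametrization `e ∘
  -- φ.symm` and a translation `v`, so `coordMeanCurvature_comp` applies.
  · intro t ht x hx
    set q := e.symm x with hq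
    set φ := chartAt (Rn n) q with hφdef
    have hφ : φ ∈ IsManifold.maximalAtlas (𝓡 n) ∞ S := IsManifold.chart_mem_maximalAtlas q
    have hqφ : q ∈ φ.source := mem_chart_source _ _
    have hqe : q ∈ e.source := e.map_target (hΩt hx)
    have hy : φ q ∈ φ.target := φ.map_source hqφ
    have hθx : e (φ.symm (φ q)) = x := by rw [φ.left_inv hqφ, e.right_inv (hΩt hx)]
    have hye : φ.symm (φ q) ∈ e.source := by rwa [φ.left_inv hqφ]
    obtain ⟨v, hv⟩ := hM ψ hψ (chartAt (Cn n) (F t q)) (chart_mem_atlas _ _) (ψ (F t q)) (by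
      simp [hmem t ht x hx, hq])
    rw [meanCurvature_eq]
    have hli : LinearIndependent ℝ fun k => partialDeriv k (fun y => f (t, y)) x := by
      have h2 : Function.Injective (fderiv ℝ (fun y => f (t, y)) x) := by
        have : (fun w => fderiv ℝ (fun y => f (t, y)) x w) = differential (n := n) (F t) (e.symm x)
            ∘ (mfderiv 𝓘(ℝ, Rn n) (𝓡 n) e.symm x) := by
          funext w; exact (hdiff t ht x hx w).symm
        change Function.Injective fun w => fderiv ℝ (fun y => f (t, y)) x w
        rw [this]
        exact (himm t (hKJ ht) _).comp (mfderiv_symm_bijective he (hΩt hx)).1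
      exact linearIndependent_single.map' (fderiv ℝ (fun y => f (t, y)) x).toLinearMap
        (LinearMap.ker_eq_bot.2 h2)
    have hsl := contDiffAt_slice hΩo ht hx hfs
    have key := coordMeanCurvature_comp (h := fun y => f (t, y))
      (h' := writtenInExtChartAt (𝓡 n) 𝓘(ℝ, Cn n) q (F t))
      (θ := fun z => e (φ.symm z)) (y := φ q) (v := v) (by rwa [hθx])
      (transition_contDiffAt he hφ hy hye) (transition_jacobian_det_ne_zero he hφ hy hye)
      (by rw [hθx]; exact realGram_det_ne_zero hli) ?_
    · rw [hθx] at key; exact key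
    · have hcont : ContinuousAt (fun z => ψ (F t (φ.symm z))) (φ q) := by
        refine ContinuousAt.comp (g := ψ) ?_ ?_
        · rw [φ.left_inv hqφ]; exact ψ.continuousAt (hmem t ht x hx)
        · exact (contMDiff_time_slice hF (hKJ ht)).continuous.continuousAt.comp
            (φ.continuousAt_symm hy)
      have hFs : ContinuousAt (fun z => F t (φ.symm z)) (φ q) :=
        (contMDiff_time_slice hF (hKJ ht)).continuous.continuousAt.comp (φ.continuousAt_symm hy)
      have hv' : ∀ᶠ z in 𝓝 (φ q), (ψ.symm.trans (chartAt (Cn n) (F t q))) (ψ (F t (φ.symm z)))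
          = ψ (F t (φ.symm z)) + v := by
        rw [show 𝓝 (ψ (F t q)) = 𝓝 (ψ (F t (φ.symm (φ q)))) by rw [φ.left_inv hqφ]] at hv
        exact hcont.tendsto.eventually hv
      filter_upwards [hv', (φ.continuousAt_symm hy).preimage_mem_nhds
        (e.open_source.mem_nhds hye), hFs.preimage_mem_nhds (ψ.open_source.mem_nhds (by
          rw [φ.left_inv hqφ]; exact hmem t ht x hx))] with z hz hz1 hz2
      simp only [hf, e.left_inv hz1]
      rw [← hz, OpenPartialHomeomorph.coe_trans, Function.comp_apply, ψ.left_inv hz2]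
      rfl
  · intro t ht x hx
    have hu : UniqueMDiffWithinAt 𝓘(ℝ, ℝ) K t :=
      (uniqueDiffOn_convex hKc hKi t ht).uniqueMDiffWithinAt
    have h1 : MDifferentiableWithinAt 𝓘(ℝ, ℝ) 𝓘(ℝ, Cn n) (fun s => F s (e.symm x)) J t :=
      (contMDiffOn_space_slice hF (e.symm x)).mdifferentiableOn (by simp) t (hKJ ht)
    have h2 := (hasMFDerivAt_chart hM hψ (hmem t ht x hx)).comp_hasMFDerivWithinAt t
      (h1.hasMFDerivWithinAt.mono hKJ)
    have h3 := h2.mfderivWithin hu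
    rw [mfderivWithin_eq_fderivWithin] at h3
    exact (congrArg (fun L : ℝ →L[ℝ] Cn n => L 1) h3).symm

end Lift

/-! ### Unitary frames of Lagrangian subspaces -/

section UnitaryFrame

variable {n : ℕ}

theorem symplecticForm_eq (v w : Cn n) : symplecticForm v w = (inner ℂ v w).im := by
  simp [symplecticForm, realInner]

theorem inner_eq_realInner (v w : Cn n) : inner ℝ v w = realInner v w := by
  rw [realInner_eq, PiLp.inner_apply, Complex.re_sum]
  exact Finset.sum_congr rfl fun a _ => by
    simp [Complex.inner]; ring

variable {V : Type*} [AddCommGroup V] [Module ℝ V]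

/-- A basis whose image under `A` is unitary. -/
def IsUnitaryFrame (A : V →ₗ[ℝ] Cn n) (b : Module.Basis (Fin n) ℝ V) : Prop :=
  ∀ i j, inner ℂ (A (b i)) (A (b j)) = if i = j then 1 else 0

/-- A real orthonormal basis of a Lagrangian subspace is unitary: the real part of the Hermitian
product is the Euclidean product and its imaginary part is the symplectic form, which vanishes. -/
theorem exists_isUnitaryFrame {A : V →ₗ[ℝ] Cn n} (hA : Function.Injective A)
    (hV : Module.finrank ℝ V = n) (hlag : ∀ v w, symplecticForm (A v) (A w) = 0) :
    ∃ b : Module.Basis (Fin n) ℝ V, IsUnitaryFrame A b := by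
  have hr : Module.finrank ℝ (LinearMap.range A) = n := by
    rw [LinearMap.finrank_range_of_inj hA, hV]
  set c := (stdOrthonormalBasis ℝ (LinearMap.range A)).reindex (finCongr hr) with hc
  set L := LinearEquiv.ofInjective A hA with hL
  refine ⟨c.toBasis.map L.symm, fun i j => ?_⟩
  have e : ∀ i, A ((c.toBasis.map L.symm) i) = (c i : Cn n) := by
    intro i
    simp [hL]
  have him : (inner ℂ (A ((c.toBasis.map L.symm) i)) (A ((c.toBasis.map L.symm) j))).im = 0 := by
    rw [← symplecticForm_eq]; exact hlag _ _
  have hre : (inner ℂ (A ((c.toBasis.map L.symm) i)) (A ((c.toBasis.map L.symm) j))).re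
      = if i = j then 1 else 0 := by
    have h1 := orthonormal_iff_ite.1 c.orthonormal i j
    rw [Submodule.coe_inner, inner_eq_realInner] at h1
    rw [e, e]
    exact h1
  apply Complex.ext
  · rw [hre]; split_ifs <;> simp
  · rw [him]; split_ifs <;> simp

/-- Adjusting the orientation changes basis vectors only by signs, so the frame stays unitary. There
must be a vector to reverse, hence `1 ≤ n`. -/
theorem exists_isUnitaryFrame_oriented (hn : 1 ≤ n) {A : V →ₗ[ℝ] Cn n}
    (hA : Function.Injective A) (hV : Module.finrank ℝ V = n)
    (hlag : ∀ v w, symplecticForm (A v) (A w) = 0) (o : Orientation ℝ V (Fin n)) :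
    ∃ b : Module.Basis (Fin n) ℝ V, IsUnitaryFrame A b ∧ b.orientation = o := by
  obtain ⟨b, hb⟩ := exists_isUnitaryFrame hA hV hlag
  have : Nonempty (Fin n) := ⟨⟨0, hn⟩⟩
  refine ⟨b.adjustToOrientation o, fun i j => ?_, b.orientation_adjustToOrientation o⟩
  by_cases hij : i = j
  · subst hij
    rcases b.adjustToOrientation_apply_eq_or_eq_neg o i with h | h <;> rw [h]
    · exact hb i i
    · rw [map_neg, inner_neg_neg]; exact hb i i
  · have h0 := hb i j
    rw [if_neg hij] at h0 ⊢
    rcases b.adjustToOrientation_apply_eq_or_eq_neg o i with h | h <;>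
    rcases b.adjustToOrientation_apply_eq_or_eq_neg o j with h' | h' <;>
    simp [h, h', h0]

theorem IsUnitaryFrame.exists_unitary {A : V →ₗ[ℝ] Cn n} {b : Module.Basis (Fin n) ℝ V}
    (hb : IsUnitaryFrame A b) :
    ∃ U : Matrix.unitaryGroup (Fin n) ℂ, ∀ j, A (b j) = column U j := by
  refine ⟨⟨Matrix.of fun i j => A (b j) i, ?_⟩, fun j => rfl⟩
  rw [Matrix.mem_unitaryGroup_iff']
  ext i j
  have h := hb i j
  rw [PiLp.inner_apply] at h
  rw [Matrix.mul_apply, Matrix.one_apply, ← h]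
  refine Finset.sum_congr rfl fun a _ => ?_
  simp [Matrix.star_apply, mul_comm]

/-- Two frames of the same real subspace differ by a real matrix. -/
theorem frame_eq_mul {A : V →ₗ[ℝ] Cn n} (b c : Module.Basis (Fin n) ℝ V)
    {B C : Matrix (Fin n) (Fin n) ℂ} (hB : ∀ a j, B a j = A (b j) a)
    (hC : ∀ a j, C a j = A (c j) a) : C = B * (b.toMatrix c).map Complex.ofReal := by
  ext a j
  rw [hC, ← b.sum_toMatrix_smul_self c j, map_sum, Matrix.mul_apply]
  simp [hB, mul_comm]

end UnitaryFrame

/-! ### The Gauss map in a local lift -/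

section Gauss

variable {n : ℕ} {S : Type*} [TopologicalSpace S] [ChartedSpace (Rn n) S]
  {M : Type*} [TopologicalSpace M] [ChartedSpace (Cn n) M]

theorem convex_timeInterval (T : EReal) : Convex ℝ (timeInterval T) := by
  rw [convex_iff_ordConnected]
  refine ⟨fun a ha b hb c hc => ⟨ha.1.trans hc.1, lt_of_le_of_lt ?_ hb.2⟩⟩
  exact_mod_cast hc.2

theorem interior_timeInterval_nonempty {T : EReal} {t : ℝ} (ht : t ∈ timeInterval T) :
    (interior (timeInterval T)).Nonempty := by
  obtain ⟨s, hs1, hs2⟩ := EReal.lt_iff_exists_real_btwn.1 ht.2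
  have hts : t < s := by exact_mod_cast hs1
  have hsub : Ioo t s ⊆ timeInterval T := fun r hr =>
    ⟨ht.1.trans hr.1.le, lt_trans (by exact_mod_cast hr.2) hs2⟩
  obtain ⟨r, hr⟩ := nonempty_Ioo.2 hts
  exact ⟨r, interior_maximal hsub isOpen_Ioo hr⟩

/-- The differential as a linear map. -/
noncomputable def differentialLinear (F : S → M) (p : S) : TangentSpace (𝓡 n) p →ₗ[ℝ] Cn n :=
  (mfderiv (𝓡 n) 𝓘(ℝ, Cn n) F p).toLinearMap

theorem finrank_tangentSpace (p : S) : Module.finrank ℝ (TangentSpace (𝓡 n) p) = n :=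
  finrank_euclideanSpace_fin

theorem IsLagrangianMeanCurvatureFlow.exists_gaussMap {T : EReal} {F : ℝ → S → M}
    (hL : IsLagrangianMeanCurvatureFlow (n := n) T F) {t : ℝ} (ht : t ∈ timeInterval T) (p : S) :
    ∃ U : Matrix.unitaryGroup (Fin n) ℂ, ∃ b : Module.Basis (Fin n) ℝ (TangentSpace (𝓡 n) p),
      ∀ j, differential (F t) p (b j) = column U j := by
  obtain ⟨b, hb⟩ := exists_isUnitaryFrame (A := differentialLinear (F t) p)
    (hL.immersion t ht p) (finrank_tangentSpace p) (hL.lagrangian t ht p)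
  obtain ⟨U, hU⟩ := hb.exists_unitary
  exact ⟨U, b, hU⟩

theorem IsLagrangianMeanCurvatureFlow.exists_orientedGaussMap (hn : 1 ≤ n) {T : EReal}
    {F : ℝ → S → M} (hL : IsLagrangianMeanCurvatureFlow (n := n) T F) {t : ℝ}
    (ht : t ∈ timeInterval T) (p : S) (o : Orientation ℝ (TangentSpace (𝓡 n) p) (Fin n)) :
    ∃ U : Matrix.unitaryGroup (Fin n) ℂ, ∃ b : Module.Basis (Fin n) ℝ (TangentSpace (𝓡 n) p),
      (∀ j, differential (F t) p (b j) = column U j) ∧ b.orientation = o := by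
  obtain ⟨b, hb, hbo⟩ := exists_isUnitaryFrame_oriented hn (A := differentialLinear (F t) p)
    (hL.immersion t ht p) (finrank_tangentSpace p) (hL.lagrangian t ht p) o
  obtain ⟨U, hU⟩ := hb.exists_unitary
  exact ⟨U, b, hU, hbo⟩

theorem unitary_det_ne_zero (U : Matrix.unitaryGroup (Fin n) ℂ) :
    (U : Matrix (Fin n) (Fin n) ℂ).det ≠ 0 := by
  intro h
  have := congrArg Matrix.det (unitary_mul_conjTranspose U)
  rw [Matrix.det_mul, h] at this
  simp at this

/-- The coordinate basis of a tangent space. -/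
theorem exists_coordBasis {e : OpenPartialHomeomorph S (Rn n)}
    (he : e ∈ IsManifold.maximalAtlas (𝓡 n) ∞ S) {x : Rn n} (hx : x ∈ e.target) :
    ∃ c : Module.Basis (Fin n) ℝ (TangentSpace (𝓡 n) (e.symm x)),
      ∀ i, c i = mfderiv 𝓘(ℝ, Rn n) (𝓡 n) e.symm x (EuclideanSpace.single i 1) := by
  let L : Rn n ≃ₗ[ℝ] TangentSpace (𝓡 n) (e.symm x) := LinearEquiv.ofBijective
    (mfderiv 𝓘(ℝ, Rn n) (𝓡 n) e.symm x).toLinearMap (mfderiv_symm_bijective he hx)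
  refine ⟨(EuclideanSpace.basisFun (Fin n) ℝ).toBasis.map L, fun i => ?_⟩
  rw [Module.Basis.map_apply]
  simp only [OrthonormalBasis.coe_toBasis, EuclideanSpace.basisFun_apply]
  rfl

namespace IsLocalLift

variable {J : Set ℝ} {F : ℝ → S → M} {e : OpenPartialHomeomorph S (Rn n)} {K : Set ℝ}
  {Ω : Set (Rn n)} {f : ℝ × Rn n → Cn n}

theorem uniqueDiffOn (h : IsLocalLift J F e K Ω f) : UniqueDiffOn ℝ (K ×ˢ Ω) :=
  uniqueDiffOn_box h.convex h.interior_nonempty h.isOpen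

theorem subset_closure (h : IsLocalLift J F e K Ω f) :
    K ×ˢ Ω ⊆ closure (interior (K ×ˢ Ω)) :=
  box_subset_closure_interior h.convex h.interior_nonempty h.isOpen

theorem frame_apply (h : IsLocalLift J F e K Ω f) {t : ℝ} (ht : t ∈ K) {x : Rn n} (hx : x ∈ Ω)
    (a j : Fin n) : frame (K ×ˢ Ω) f (t, x) a j = differentialLinear (F t) (e.symm x)
      (mfderiv 𝓘(ℝ, Rn n) (𝓡 n) e.symm x (EuclideanSpace.single j 1)) a := by
  have h1 := h.differential_eq t ht x hx (EuclideanSpace.single j 1)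
  change dirDeriv _ _ _ _ = differential (n := n) (F t) (e.symm x) _ a
  rw [h1, dirDeriv_component h.uniqueDiffOn h.contDiffOn _ ⟨ht, hx⟩]
  exact congrArg (fun v : Cn n => v a) (partialDeriv_slice h.isOpen ht hx
    (h.contDiffOn.differentiableOn (by simp) _ ⟨ht, hx⟩) j).symm

/-- The coordinate frame and a unitary frame of the tangent space differ by a real matrix. -/
theorem frame_eq_unitary_mul (h : IsLocalLift J F e K Ω f) {t : ℝ} (ht : t ∈ K) {x : Rn n}
    (hx : x ∈ Ω) {b c : Module.Basis (Fin n) ℝ (TangentSpace (𝓡 n) (e.symm x))}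
    (hc : ∀ i, c i = mfderiv 𝓘(ℝ, Rn n) (𝓡 n) e.symm x (EuclideanSpace.single i 1))
    {U : Matrix.unitaryGroup (Fin n) ℂ}
    (hU : ∀ j, differential (F t) (e.symm x) (b j) = column U j) :
    frame (K ×ˢ Ω) f (t, x)
        = (U : Matrix (Fin n) (Fin n) ℂ) * (b.toMatrix c).map Complex.ofReal ∧
      (U : Matrix (Fin n) (Fin n) ℂ)
        = frame (K ×ˢ Ω) f (t, x) * (c.toMatrix b).map Complex.ofReal := by
  have h1 : ∀ a j, frame (K ×ˢ Ω) f (t, x) a j = differentialLinear (F t) (e.symm x) (c j) a := by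
    intro a j; rw [h.frame_apply ht hx, hc]
  have h2 : ∀ a j, (U : Matrix (Fin n) (Fin n) ℂ) a j
      = differentialLinear (F t) (e.symm x) (b j) a :=
    fun a j => (congrArg (fun v : Cn n => v a) (hU j)).symm
  exact ⟨frame_eq_mul b c h2 h1, frame_eq_mul c b h1 h2⟩

variable {T : EReal}

theorem det_frame_ne_zero (h : IsLocalLift (timeInterval T) F e K Ω f)
    (hL : IsLagrangianMeanCurvatureFlow (n := n) T F)
    (he : e ∈ IsManifold.maximalAtlas (𝓡 n) ∞ S) {z : ℝ × Rn n} (hz : z ∈ K ×ˢ Ω) :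
    (frame (K ×ˢ Ω) f z).det ≠ 0 := by
  obtain ⟨t, x⟩ := z
  obtain ⟨ht, hx⟩ : t ∈ K ∧ x ∈ Ω := hz
  obtain ⟨U, b, hU⟩ := hL.exists_gaussMap (h.subset ht) (e.symm x)
  obtain ⟨c, hc⟩ := exists_coordBasis he (h.subset_target hx)
  intro h0
  have := congrArg Matrix.det (h.frame_eq_unitary_mul ht hx hc hU).2
  rw [Matrix.det_mul, h0, zero_mul] at this
  exact unitary_det_ne_zero U this

theorem lagrangian (h : IsLocalLift (timeInterval T) F e K Ω f)
    (hL : IsLagrangianMeanCurvatureFlow (n := n) T F) {z : ℝ × Rn n} (hz : z ∈ K ×ˢ Ω)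
    (i j : Fin n) : (((frame (K ×ˢ Ω) f z)ᴴ * frame (K ×ˢ Ω) f z) i j).im = 0 := by
  obtain ⟨t, x⟩ := z
  obtain ⟨ht, hx⟩ : t ∈ K ∧ x ∈ Ω := hz
  have h1 := hL.lagrangian t (h.subset ht) (e.symm x)
    (mfderiv 𝓘(ℝ, Rn n) (𝓡 n) e.symm x (EuclideanSpace.single i 1))
    (mfderiv 𝓘(ℝ, Rn n) (𝓡 n) e.symm x (EuclideanSpace.single j 1))
  rw [symplecticForm_eq, PiLp.inner_apply] at h1
  rw [← h1, Matrix.mul_apply]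
  congr 1
  refine Finset.sum_congr rfl fun a _ => ?_
  rw [Matrix.conjTranspose_apply, h.frame_apply ht hx, h.frame_apply ht hx]
  exact mul_comm _ _

theorem flow (h : IsLocalLift (timeInterval T) F e K Ω f)
    (hL : IsLagrangianMeanCurvatureFlow (n := n) T F) {z : ℝ × Rn n} (hz : z ∈ K ×ˢ Ω)
    (a : Fin n) : dirDeriv (K ×ˢ Ω) (timeDir n) (fun y => f y a) z
      = ∑ k, ∑ l, ((metricMatrix (K ×ˢ Ω) f z)⁻¹ k l : ℂ) *
        (matDeriv (K ×ˢ Ω) (spaceDir k) (frame (K ×ˢ Ω) f) z a l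
        - ∑ r, (((metricMatrix (K ×ˢ Ω) f z)⁻¹ * lowerChristoffel (K ×ˢ Ω) f z l) r k : ℂ)
          * frame (K ×ˢ Ω) f z a r) := by
  obtain ⟨t, x⟩ := z
  obtain ⟨ht, hx⟩ : t ∈ K ∧ x ∈ Ω := hz
  have h1 := hL.flow t (h.subset ht) (e.symm x)
  rw [h.velocity_eq t ht x hx, h.meanCurvature_eq t ht x hx] at h1
  rw [← coordMeanCurvature_slice h.isOpen h.uniqueDiffOn h.subset_closure ht hx h.contDiffOn, ← h1,
    dirDeriv_component h.uniqueDiffOn h.contDiffOn _ ⟨ht, hx⟩]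
  refine congrArg (fun v : Cn n => v a) ?_
  exact ((hasDerivWithinAt_slice hx
    (h.contDiffOn.differentiableOn (by simp) _ ⟨ht, hx⟩)).derivWithin
    (uniqueDiffOn_convex h.convex h.interior_nonempty t ht)).symm

/-- Writing the frame as `E = U R` with `R` real, `U Uᵀ Ē = U Uᵀ Ū R = E`; now cancel the invertible
`Ē`. So the smooth matrix `E Ē⁻¹` computes `U Uᵀ` for every unitary frame `U`. -/
theorem gaussMatrix_eq (h : IsLocalLift (timeInterval T) F e K Ω f)
    (hL : IsLagrangianMeanCurvatureFlow (n := n) T F)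
    (he : e ∈ IsManifold.maximalAtlas (𝓡 n) ∞ S) {t : ℝ} (ht : t ∈ K) {x : Rn n} (hx : x ∈ Ω)
    {b : Module.Basis (Fin n) ℝ (TangentSpace (𝓡 n) (e.symm x))}
    {U : Matrix.unitaryGroup (Fin n) ℂ}
    (hU : ∀ j, differential (F t) (e.symm x) (b j) = column U j) :
    gaussMatrix (K ×ˢ Ω) f (t, x)
      = (U : Matrix (Fin n) (Fin n) ℂ) * (U : Matrix (Fin n) (Fin n) ℂ)ᵀ := by
  obtain ⟨c, hc⟩ := exists_coordBasis he (h.subset_target hx)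
  have hdet := h.det_frame_ne_zero hL he (z := (t, x)) ⟨ht, hx⟩
  have h1 := (h.frame_eq_unitary_mul ht hx hc hU).1
  have h2 : (U : Matrix (Fin n) (Fin n) ℂ) * (U : Matrix (Fin n) (Fin n) ℂ)ᵀ
      * conjM (frame (K ×ˢ Ω) f (t, x)) = frame (K ×ˢ Ω) f (t, x) := by
    have h3 : conjM ((b.toMatrix c).map Complex.ofReal) = (b.toMatrix c).map Complex.ofReal := by
      ext i j; simp
    rw [h1, conjM_mul, h3, Matrix.mul_assoc, ← Matrix.mul_assoc _ (conjM _),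
      unitary_transpose_mul_conj, Matrix.one_mul]
  have hu : IsUnit (conjM (frame (K ×ˢ Ω) f (t, x))).det :=
    isUnit_iff_ne_zero.2 (det_conjM_ne_zero hdet)
  unfold gaussMatrix
  nth_rewrite 1 [← h2]
  exact Matrix.mul_nonsing_inv_cancel_right _ _ hu

end IsLocalLift

end Gauss

/-! ### The heat equation -/

section HeatEquation

variable {n : ℕ}

theorem toVec_smul (c : ℝ) (V : Matrix (Fin n) (Fin n) ℂ) :
    c • toVec V = toVec ((c : ℂ) • V) := by
  ext ij; simp [toVec]

theorem toVec_sum {α : Type*} (s : Finset α) (V : α → Matrix (Fin n) (Fin n) ℂ) :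
    ∑ i ∈ s, toVec (V i) = toVec (∑ i ∈ s, V i) := by
  ext ij; simp [toVec, Matrix.sum_apply]

theorem toVec_sub (V V' : Matrix (Fin n) (Fin n) ℂ) : toVec V - toVec V' = toVec (V - V') := rfl

theorem contDiffOn_toVec {X : Type*} [NormedAddCommGroup X] [NormedSpace ℝ X] {W : Set X}
    {P : X → Matrix (Fin n) (Fin n) ℂ} (hP : SmoothMatrixOn W P) :
    ContDiffOn ℝ ∞ (fun z => toVec (P z)) W :=
  (contDiffOn_piLp 2).2 fun ij => hP ij.1 ij.2

theorem dirDeriv_toVec {X : Type*} [NormedAddCommGroup X] [NormedSpace ℝ X] {W : Set X}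
    (hW : UniqueDiffOn ℝ W) {P : X → Matrix (Fin n) (Fin n) ℂ} (hP : SmoothMatrixOn W P) (v : X)
    {z : X} (hz : z ∈ W) :
    dirDeriv W v (fun y => toVec (P y)) z = toVec (matDeriv W v P z) := by
  ext ij
  exact (dirDeriv_clm hW (contDiffOn_toVec hP)
    (PiLp.proj (𝕜 := ℝ) 2 (fun _ : Fin n × Fin n => ℂ) ij) v hz).symm

/-- Each derivative of the induced metric is a sum of two products `⟨∂f, ∂∂f⟩`. In the Christoffel
combination four of the six cancel, and the other two both equal `⟨∂ₗf, ∂ᵢ∂ⱼf⟩`. -/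
theorem christoffel_slice {K : Set ℝ} {Ω : Set (Rn n)} {f : ℝ × Rn n → Cn n} {t : ℝ} {x : Rn n}
    (hΩ : IsOpen Ω) (hW : UniqueDiffOn ℝ (K ×ˢ Ω))
    (hc : K ×ˢ Ω ⊆ closure (interior (K ×ˢ Ω))) (ht : t ∈ K) (hx : x ∈ Ω)
    (hf : ContDiffOn ℝ ∞ f (K ×ˢ Ω)) {G : Rn n → Matrix (Fin n) (Fin n) ℝ}
    (hG : ∀ y ∈ Ω, G y = metricMatrix (K ×ˢ Ω) f (t, y)) (k i j : Fin n) :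
    christoffel G x k i j
      = ((metricMatrix (K ×ˢ Ω) f (t, x))⁻¹ * lowerChristoffel (K ×ˢ Ω) f (t, x) j) k i := by
  set W := K ×ˢ Ω with hWdef
  have hz : (t, x) ∈ W := ⟨ht, hx⟩
  have hd : ∀ i j l, partialDeriv i (fun y => G y j l) x
      = lowerChristoffel W f (t, x) i j l + lowerChristoffel W f (t, x) i l j := by
    intro i j l
    have h1 : (fun y => G y j l) =ᶠ[𝓝 x] fun y => metricMatrix W f (t, y) j l := by
      filter_upwards [hΩ.mem_nhds hx] with y hy
      rw [hG y hy]
    rw [(partialDeriv_congr h1 i).eq_of_nhds]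
    refine (partialDeriv_slice (u := fun z => metricMatrix W f z j l) hΩ ht hx
      ((smoothMatrixOn_metricMatrix hW hf j l).differentiableOn (by simp) _ hz) i).trans ?_
    exact congrFun (congrFun (matDeriv_metricMatrix hW hf i hz) j) l
  have hs : ∀ i j l, lowerChristoffel W f (t, x) i j l = lowerChristoffel W f (t, x) l j i := by
    intro i j l
    simp only [lowerChristoffel, Matrix.map_apply, Matrix.mul_apply]
    congr 1
    exact Finset.sum_congr rfl fun a _ => by rw [frame_symm hW hc hf i a l hz]
  unfold christoffel
  rw [Matrix.mul_apply, Finset.mul_sum, hG x hx]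
  refine Finset.sum_congr rfl fun l _ => ?_
  rw [hd, hd, hd, hs i j l, hs j i l, hs i l j]
  ring

/-- The Laplacian of a matrix-valued function in a chart. -/
theorem laplaceBeltrami_slice {S : Type*} [TopologicalSpace S] [ChartedSpace (Rn n) S]
    {K : Set ℝ} {Ω : Set (Rn n)} {f : ℝ × Rn n → Cn n} {t : ℝ} {p : S}
    {g : ∀ q : S, TangentSpace (𝓡 n) q → TangentSpace (𝓡 n) q → ℝ}
    {u : S → EuclideanSpace ℂ (Fin n × Fin n)} {P : ℝ × Rn n → Matrix (Fin n) (Fin n) ℂ}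
    (hΩ : IsOpen Ω) (hW : UniqueDiffOn ℝ (K ×ˢ Ω))
    (hc : K ×ˢ Ω ⊆ closure (interior (K ×ˢ Ω))) (ht : t ∈ K) (hx : chartAt (Rn n) p p ∈ Ω)
    (hf : ContDiffOn ℝ ∞ f (K ×ˢ Ω)) (hP : SmoothMatrixOn (K ×ˢ Ω) P)
    (hg : ∀ y ∈ Ω, metricCoeff g p y = metricMatrix (K ×ˢ Ω) f (t, y))
    (hu : ∀ y ∈ Ω, u ((chartAt (Rn n) p).symm y) = toVec (P (t, y))) :
    laplaceBeltrami g u p = toVec (∑ k, ∑ l,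
      ((metricMatrix (K ×ˢ Ω) f (t, chartAt (Rn n) p p))⁻¹ k l : ℂ) •
        (matDeriv (K ×ˢ Ω) (spaceDir k) (matDeriv (K ×ˢ Ω) (spaceDir l) P) (t, chartAt (Rn n) p p)
          - ∑ r, (((metricMatrix (K ×ˢ Ω) f (t, chartAt (Rn n) p p))⁻¹
            * lowerChristoffel (K ×ˢ Ω) f (t, chartAt (Rn n) p p) l) r k : ℂ) •
            matDeriv (K ×ˢ Ω) (spaceDir r) P (t, chartAt (Rn n) p p))) := by
  set W := K ×ˢ Ω with hWdef
  set x := chartAt (Rn n) p p with hxdef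
  have hz : (t, x) ∈ W := ⟨ht, hx⟩
  have hex : extChartAt (𝓡 n) p p = x := rfl
  have h0 : (u ∘ (extChartAt (𝓡 n) p).symm) =ᶠ[𝓝 x] fun y => toVec (P (t, y)) := by
    filter_upwards [hΩ.mem_nhds hx] with y hy
    exact hu y hy
  have h1 : ∀ i, partialDeriv i (u ∘ (extChartAt (𝓡 n) p).symm) x
      = toVec (matDeriv W (spaceDir i) P (t, x)) := by
    intro i
    rw [(partialDeriv_congr h0 i).eq_of_nhds]
    refine (partialDeriv_slice (u := fun z => toVec (P z)) hΩ ht hx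
      ((contDiffOn_toVec hP).differentiableOn (by simp) _ hz) i).trans ?_
    exact dirDeriv_toVec hW hP _ hz
  have h2 : ∀ i j, partialDeriv i (partialDeriv j (u ∘ (extChartAt (𝓡 n) p).symm)) x
      = toVec (matDeriv W (spaceDir i) (matDeriv W (spaceDir j) P) (t, x)) := by
    intro i j
    rw [(partialDeriv_congr (partialDeriv_congr h0 j) i).eq_of_nhds]
    refine (partialDeriv_partialDeriv_slice (u := fun z => toVec (P z)) hΩ hW ht hx
      (contDiffOn_toVec hP) i j).trans ?_
    rw [dirDeriv_congr (fun y hy => dirDeriv_toVec hW hP (spaceDir j) hy) (spaceDir i) hz,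
      dirDeriv_toVec hW (hP.matDeriv hW _) _ hz]
  unfold laplaceBeltrami
  simp only [hex, h1, h2, hg x hx, christoffel_slice hΩ hW hc ht hx hf hg, toVec_smul, toVec_sum,
    toVec_sub]
  rfl

variable {S : Type*} [TopologicalSpace S] [ChartedSpace (Rn n) S]
  {M : Type*} [TopologicalSpace M] [ChartedSpace (Cn n) M]
  {N : Type*} {ι : N → EuclideanSpace ℂ (Fin n × Fin n)}
  {π : Matrix.unitaryGroup (Fin n) ℂ → N}

theorem IsLocalLift.metricCoeff_eq {J : Set ℝ} {F : ℝ → S → M} {p : S} {K : Set ℝ}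
    {Ω : Set (Rn n)} {f : ℝ × Rn n → Cn n} (h : IsLocalLift J F (chartAt (Rn n) p) K Ω f) {t : ℝ}
    (ht : t ∈ K) {y : Rn n} (hy : y ∈ Ω) :
    metricCoeff (inducedMetric (n := n) (F t)) p y = metricMatrix (K ×ˢ Ω) f (t, y) := by
  ext i j
  have e1 : ∀ (i a : Fin n), differential (n := n) (F t) ((chartAt (Rn n) p).symm y)
      (mfderiv 𝓘(ℝ, Rn n) (𝓡 n) (chartAt (Rn n) p).symm y (EuclideanSpace.single i 1)) a
      = frame (K ×ˢ Ω) f (t, y) a i := fun i a => (h.frame_apply ht hy a i).symm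
  change realInner (differential (n := n) (F t) ((chartAt (Rn n) p).symm y)
      (mfderiv 𝓘(ℝ, Rn n) (𝓡 n) (chartAt (Rn n) p).symm y (EuclideanSpace.single i 1)))
    (differential (n := n) (F t) ((chartAt (Rn n) p).symm y)
      (mfderiv 𝓘(ℝ, Rn n) (𝓡 n) (chartAt (Rn n) p).symm y (EuclideanSpace.single j 1))) = _
  rw [realInner_eq]
  simp only [e1]
  rfl

/-- `γ t p` is the class under `π` of a unitary frame of the tangent space. -/
def IsGaussLift (π : Matrix.unitaryGroup (Fin n) ℂ → N) (J : Set ℝ) (F : ℝ → S → M)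
    (γ : ℝ → S → N) : Prop :=
  ∀ t ∈ J, ∀ p : S, ∃ U : Matrix.unitaryGroup (Fin n) ℂ, γ t p = π U ∧
    ∃ b : Module.Basis (Fin n) ℝ (TangentSpace (𝓡 n) p),
      ∀ j, differential (F t) p (b j) = column U j

variable {T : EReal} {F : ℝ → S → M} {γ : ℝ → S → N}

theorem IsGaussLift.eq_toVec (hγ : IsGaussLift π (timeInterval T) F γ)
    (hι : ∀ U, ι (π U) = halfSquare U) (hL : IsLagrangianMeanCurvatureFlow (n := n) T F)
    {e : OpenPartialHomeomorph S (Rn n)} (he : e ∈ IsManifold.maximalAtlas (𝓡 n) ∞ S)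
    {K : Set ℝ} {Ω : Set (Rn n)} {f : ℝ × Rn n → Cn n}
    (h : IsLocalLift (timeInterval T) F e K Ω f) {t : ℝ} (ht : t ∈ K) {x : Rn n} (hx : x ∈ Ω) :
    ι (γ t (e.symm x)) = toVec ((2⁻¹ : ℂ) • gaussMatrix (K ×ˢ Ω) f (t, x)) := by
  obtain ⟨U, hU, b, hb⟩ := hγ t (h.subset ht) (e.symm x)
  rw [hU, hι, h.gaussMatrix_eq hL he ht hx hb]
  rfl

theorem SmoothMatrixOn.half_smul {X : Type*} [NormedAddCommGroup X] [NormedSpace ℝ X] {W : Set X}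
    {P : X → Matrix (Fin n) (Fin n) ℂ} (hP : SmoothMatrixOn W P) :
    SmoothMatrixOn W (fun z => (2⁻¹ : ℂ) • P z) :=
  fun i j => contDiffOn_const.mul (hP i j)

theorem matDeriv_half_smul {X : Type*} [NormedAddCommGroup X] [NormedSpace ℝ X] {W : Set X}
    (hW : UniqueDiffOn ℝ W) {P : X → Matrix (Fin n) (Fin n) ℂ} (hP : SmoothMatrixOn W P) (v : X)
    {z : X} (hz : z ∈ W) :
    matDeriv W v (fun y => (2⁻¹ : ℂ) • P y) z = (2⁻¹ : ℂ) • matDeriv W v P z := by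
  ext i j
  refine (dirDeriv_mul hW (contDiffOn_const (c := (2⁻¹ : ℂ))) (hP i j) v hz).trans ?_
  simp [dirDeriv, matDeriv]

/-- Stated for a general quotient map `π` so that it serves both Grassmannians. With `ι ∘ γ = ½ Q`
locally, the velocity `½ Q_t` is tangent and `½ (ΔQ - Q_t)` is normal, so the tangential part of the
Laplacian is the velocity. -/
theorem IsGaussLift.heat_eq [IsManifold (𝓡 n) ∞ S] [IsManifold 𝓘(ℝ, Cn n) ∞ M] [TopologicalSpace N]
    (hγ : IsGaussLift π (timeInterval T) F γ) (hπ : Continuous π)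
    (hπ' : Function.Surjective π)
    (hι : ∀ U, ι (π U) = halfSquare U) (hM : HasTranslationAtlas n M)
    (hL : IsLagrangianMeanCurvatureFlow (n := n) T F) {t : ℝ} (ht : t ∈ timeInterval T) (p : S) :
    derivWithin (fun s => ι (γ s p)) (timeInterval T) t
      = tensionField ι (inducedMetric (n := n) (F t)) (γ t) p := by
  have he : chartAt (Rn n) p ∈ IsManifold.maximalAtlas (𝓡 n) ∞ S :=
    IsManifold.chart_mem_maximalAtlas p
  obtain ⟨K, Ω, f, h, htK, hxΩ⟩ := exists_isLocalLift hM (convex_timeInterval T)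
    (interior_timeInterval_nonempty ht) hL.smoothOn hL.immersion he (mem_chart_source _ p) ht
  have hz : (t, chartAt (Rn n) p p) ∈ K ×ˢ Ω := ⟨htK, hxΩ⟩
  have hpx : (chartAt (Rn n) p).symm (chartAt (Rn n) p p) = p :=
    (chartAt (Rn n) p).left_inv (mem_chart_source _ p)
  have hW := h.uniqueDiffOn
  have hdet : ∀ z ∈ K ×ˢ Ω, (frame (K ×ˢ Ω) f z).det ≠ 0 := fun z hz => h.det_frame_ne_zero hL he hz
  have hlag : ∀ z ∈ K ×ˢ Ω, ∀ i j, (((frame (K ×ˢ Ω) f z)ᴴ * frame (K ×ˢ Ω) f z) i j).im = 0 :=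
    fun z hz => h.lagrangian hL hz
  have hSQ := smoothMatrixOn_gaussMatrix hW h.contDiffOn hdet
  have hSP := hSQ.half_smul
  have hval : ∀ s ∈ K, ∀ y ∈ Ω, ι (γ s ((chartAt (Rn n) p).symm y))
      = toVec ((2⁻¹ : ℂ) • gaussMatrix (K ×ˢ Ω) f (s, y)) :=
    fun s hs y hy => hγ.eq_toVec hι hL he h hs hy
  -- the time derivative
  have hvel : derivWithin (fun s => ι (γ s p)) (timeInterval T) t
      = toVec ((2⁻¹ : ℂ) • matDeriv (K ×ˢ Ω) (timeDir n) (gaussMatrix (K ×ˢ Ω) f)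
          (t, chartAt (Rn n) p p)) := by
    have h1 := hasDerivWithinAt_slice hxΩ ((contDiffOn_toVec hSP).differentiableOn (by simp) _ hz)
    rw [dirDeriv_toVec hW hSP _ hz, matDeriv_half_smul hW hSQ _ hz] at h1
    have h2 : HasDerivWithinAt (fun s => ι (γ s p))
        (toVec ((2⁻¹ : ℂ) • matDeriv (K ×ˢ Ω) (timeDir n) (gaussMatrix (K ×ˢ Ω) f)
          (t, chartAt (Rn n) p p))) K t := by
      refine h1.congr (fun s hs => ?_) ?_
      · rw [← hval s hs (chartAt (Rn n) p p) hxΩ, hpx]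
      · rw [← hval t htK (chartAt (Rn n) p p) hxΩ, hpx]
    exact (h2.mono_of_mem_nhdsWithin (h.mem_nhdsWithin t htK)).derivWithin
      (uniqueDiffOn_convex (convex_timeInterval T) (interior_timeInterval_nonempty ht) t ht)
  rw [hvel]
  obtain ⟨U, hU, b, hb⟩ := hγ t ht p
  obtain ⟨c, hc⟩ := exists_coordBasis he (h.subset_target hxΩ)
  obtain ⟨R, hR⟩ : ∃ R : Matrix (Fin n) (Fin n) ℝ, (U : Matrix (Fin n) (Fin n) ℂ)
      = frame (K ×ˢ Ω) f (t, chartAt (Rn n) p p) * R.map Complex.ofReal := by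
    -- The basis `b` lives at `p`, the coordinate frame at `φ.symm (φ p)` for the chart `φ` at `p`.
    -- These points are only propositionally equal, so the point is generalized before substituting.
    have : ∀ q, q = (chartAt (Rn n) p).symm (chartAt (Rn n) p p) →
        (∃ b : Module.Basis (Fin n) ℝ (TangentSpace (𝓡 n) q),
          ∀ j, differential (F t) q (b j) = column U j) →
        ∃ R : Matrix (Fin n) (Fin n) ℝ, (U : Matrix (Fin n) (Fin n) ℂ)
          = frame (K ×ˢ Ω) f (t, chartAt (Rn n) p p) * R.map Complex.ofReal := by
      rintro q rfl ⟨b, hb⟩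
      exact ⟨_, (h.frame_eq_unitary_mul htK hxΩ hc hb).2⟩
    exact this p hpx.symm ⟨b, hb⟩
  unfold tensionField
  rw [laplaceBeltrami_slice h.isOpen hW h.subset_closure htK hxΩ h.contDiffOn hSP
    (fun y hy => h.metricCoeff_eq htK hy) (fun y hy => hval t htK y hy)]
  symm
  have hS := smoothMatrixOn_frame hW h.contDiffOn
  have hform := first_derivative_form (gaussMatrix_transpose (hlag _ hz) (hdet _ hz))
    (gaussMatrix_mul_conj (hdet _ hz)) (Q₁ := matDeriv (K ×ˢ Ω) (timeDir n) (gaussMatrix (K ×ˢ Ω) f)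
          (t, chartAt (Rn n) p p))
    (E₁ := matDeriv (K ×ˢ Ω) (timeDir n) (frame (K ×ˢ Ω) f) (t, chartAt (Rn n) p p)) (by
      have h1 := matDeriv_congr (fun y hy => gaussMatrix_mul_conj (hdet y hy)) (timeDir n) hz
      rwa [matDeriv_mul hW hSQ hS.conj _ hz, matDeriv_conj hW hS _ hz] at h1)
  -- Three facts are needed: `Q_t` is symmetric because `Q` is, `Eᴴ Q_t Ē` is imaginary by `hform`,
  -- and `Eᴴ (ΔQ - Q_t) Ē` is real by the evolution equation.
  refine starProjection_immersedTangentSpace hπ hπ' hι hU hR ?_ (fun i j => ?_) (fun i j => ?_)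
  · rw [Matrix.transpose_smul]
    congr 1
    ext i j
    exact dirDeriv_congr (fun y hy =>
      congrFun (congrFun (gaussMatrix_transpose (hlag y hy) (hdet y hy)) i) j) _ hz
  · rw [Matrix.mul_smul, Matrix.smul_mul, hform, Matrix.smul_apply, smul_eq_mul, Complex.mul_re,
      re_sub_conj]
    simp
  · have key := evolution_gaussMatrix hW h.subset_closure h.contDiffOn hdet hlag
      (fun z hz a => h.flow hL hz a) hz i j
    have e1 : ∀ k l, matDeriv (K ×ˢ Ω) (spaceDir k) (matDeriv (K ×ˢ Ω) (spaceDir l)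
        fun y => (2⁻¹ : ℂ) • gaussMatrix (K ×ˢ Ω) f y) (t, chartAt (Rn n) p p)
        = (2⁻¹ : ℂ) • matDeriv (K ×ˢ Ω) (spaceDir k)
          (matDeriv (K ×ˢ Ω) (spaceDir l) (gaussMatrix (K ×ˢ Ω) f)) (t, chartAt (Rn n) p p) := by
      intro k l
      rw [matDeriv_congr (fun y hy => matDeriv_half_smul hW hSQ (spaceDir l) hy) _ hz,
        matDeriv_half_smul hW (hSQ.matDeriv hW _) _ hz]
    simp only [e1, matDeriv_half_smul hW hSQ _ hz, smul_comm _ (2⁻¹ : ℂ), ← Finset.smul_sum,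
      ← smul_sub, Matrix.mul_smul, Matrix.smul_mul]
    rw [Matrix.smul_apply, smul_eq_mul, Complex.mul_im, key]
    simp

theorem IsGaussLift.smoothOn [IsManifold (𝓡 n) ∞ S] [IsManifold 𝓘(ℝ, Cn n) ∞ M]
    (hγ : IsGaussLift π (timeInterval T) F γ)
    (hι : ∀ U, ι (π U) = halfSquare U) (hM : HasTranslationAtlas n M)
    (hL : IsLagrangianMeanCurvatureFlow (n := n) T F) :
    ContMDiffOn (𝓘(ℝ, ℝ).prod (𝓡 n)) 𝓘(ℝ, EuclideanSpace ℂ (Fin n × Fin n)) ∞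
      (fun z : ℝ × S => ι (γ z.1 z.2)) (timeInterval T ×ˢ univ) := by
  rintro ⟨t, p⟩ ⟨ht, -⟩
  have he : chartAt (Rn n) p ∈ IsManifold.maximalAtlas (𝓡 n) ∞ S :=
    IsManifold.chart_mem_maximalAtlas p
  obtain ⟨K, Ω, f, h, htK, hxΩ⟩ := exists_isLocalLift hM (convex_timeInterval T)
    (interior_timeInterval_nonempty ht) hL.smoothOn hL.immersion he (mem_chart_source _ p) ht
  set φ := chartAt (Rn n) p with hφ
  have hs := contDiffOn_toVec (smoothMatrixOn_gaussMatrix h.uniqueDiffOn h.contDiffOn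
    fun z hz => h.det_frame_ne_zero hL he hz).half_smul
  have hs' : ContMDiffOn (𝓘(ℝ, ℝ).prod (𝓡 n)) 𝓘(ℝ, EuclideanSpace ℂ (Fin n × Fin n)) ∞
      (fun z : ℝ × Rn n => toVec ((2⁻¹ : ℂ) • gaussMatrix (K ×ˢ Ω) f z)) (K ×ˢ Ω) := by
    rw [← modelWithCornersSelf_prod, chartedSpaceSelf_prod]
    exact hs.contMDiffOn
  have hO : IsOpen (φ.source ∩ φ ⁻¹' Ω) := φ.isOpen_inter_preimage h.isOpen
  have hpO : p ∈ φ.source ∩ φ ⁻¹' Ω := ⟨mem_chart_source _ p, hxΩ⟩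
  have hcomp : ContMDiffOn (𝓘(ℝ, ℝ).prod (𝓡 n)) 𝓘(ℝ, EuclideanSpace ℂ (Fin n × Fin n)) ∞
      (fun z : ℝ × S => toVec ((2⁻¹ : ℂ) • gaussMatrix (K ×ˢ Ω) f (z.1, φ z.2)))
      (K ×ˢ (φ.source ∩ φ ⁻¹' Ω)) := by
    have h1 : ContMDiffOn (𝓘(ℝ, ℝ).prod (𝓡 n)) (𝓘(ℝ, ℝ).prod (𝓡 n)) ∞
        (fun z : ℝ × S => (z.1, φ z.2)) (K ×ˢ (φ.source ∩ φ ⁻¹' Ω)) :=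
      contMDiffOn_fst.prodMk ((contMDiffOn_of_mem_maximalAtlas he).comp contMDiffOn_snd
        fun z hz => hz.2.1)
    exact hs'.comp h1 fun z hz => ⟨hz.1, hz.2.2⟩
  have hcongr : ContMDiffOn (𝓘(ℝ, ℝ).prod (𝓡 n)) 𝓘(ℝ, EuclideanSpace ℂ (Fin n × Fin n)) ∞
      (fun z : ℝ × S => ι (γ z.1 z.2)) (K ×ˢ (φ.source ∩ φ ⁻¹' Ω)) := by
    refine hcomp.congr fun z hz => ?_
    rw [← hγ.eq_toVec hι hL he h hz.1 hz.2.2, φ.left_inv hz.2.1]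
  refine (hcongr (t, p) ⟨htK, hpO⟩).mono_of_mem_nhdsWithin ?_
  rw [nhdsWithin_prod_eq, nhdsWithin_univ]
  exact Filter.prod_mem_prod (h.mem_nhdsWithin t htK) (hO.mem_nhds hpO)

end HeatEquation

/-! ### Continuity of the Gauss maps -/

section Continuity

variable {n : ℕ}

/-- The unitary matrices form a closed set with entries bounded by 1. Compactness makes continuous
injections of the quotients into Hausdorff spaces closed embeddings. -/
instance compactSpace_unitaryGroup (n : ℕ) : CompactSpace (Matrix.unitaryGroup (Fin n) ℂ) := by
  refine isCompact_iff_compactSpace.1 ?_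
  have h1 : IsCompact (Set.pi univ fun _ : Fin n => Set.pi univ fun _ : Fin n =>
      Metric.closedBall (0 : ℂ) 1) :=
    isCompact_univ_pi fun _ => isCompact_univ_pi fun _ => isCompact_closedBall _ _
  refine IsCompact.of_isClosed_subset h1 isClosed_unitary fun U hU i _ j _ => ?_
  simpa using entry_norm_bound_of_unitary hU i j

theorem continuous_halfSquare :
    Continuous (halfSquare : Matrix.unitaryGroup (Fin n) ℂ → EuclideanSpace ℂ (Fin n × Fin n)) := by
  refine (PiLp.continuous_toLp 2 _).comp (continuous_pi fun ij => ?_)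
  have h : Continuous fun U : Matrix.unitaryGroup (Fin n) ℂ =>
      (2⁻¹ : ℂ) • ((U : Matrix (Fin n) (Fin n) ℂ) * (U : Matrix (Fin n) (Fin n) ℂ)ᵀ) := by
    fun_prop
  exact h.matrix_elem ij.1 ij.2

theorem continuous_cartanEmbedding : Continuous (cartanEmbedding n) :=
  (QuotientGroup.isQuotientMap_mk _).continuous_iff.2 continuous_halfSquare

/-- Unitary matrices with the same `U Uᵀ` differ by a real orthogonal matrix. -/
theorem exists_orthogonal_of_halfSquare_eq {U V : Matrix.unitaryGroup (Fin n) ℂ}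
    (h : halfSquare U = halfSquare V) :
    ∃ A ∈ Matrix.orthogonalGroup (Fin n) ℝ,
      ((U⁻¹ * V : Matrix.unitaryGroup (Fin n) ℂ) : Matrix (Fin n) (Fin n) ℂ)
        = A.map Complex.ofReal := by
  set u : Matrix (Fin n) (Fin n) ℂ := (U : Matrix (Fin n) (Fin n) ℂ) with hu
  set v : Matrix (Fin n) (Fin n) ℂ := (V : Matrix (Fin n) (Fin n) ℂ) with hv
  have h1 : u * uᵀ = v * vᵀ := by
    ext i j
    have h2 := congrFun (congrArg WithLp.ofLp h) (i, j)
    change (2⁻¹ : ℂ) * (u * uᵀ) i j = 2⁻¹ * (v * vᵀ) i j at h2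
    exact mul_left_cancel₀ (by norm_num) h2
  set w : Matrix (Fin n) (Fin n) ℂ := uᴴ * v with hw
  have hwe : ((U⁻¹ * V : Matrix.unitaryGroup (Fin n) ℂ) : Matrix (Fin n) (Fin n) ℂ) = w := rfl
  -- `W Wᵀ = 1` and `W` is unitary, so `W` is real
  have h3 : w = conjM w := by
    have h4 : w * vᵀ = uᵀ := by
      rw [hw, Matrix.mul_assoc, ← h1, ← Matrix.mul_assoc, unitary_conjTranspose_mul,
        Matrix.one_mul]
    rw [hw, conjM_mul, conjM_conjTranspose, ← h4, Matrix.mul_assoc, unitary_transpose_mul_conj,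
      Matrix.mul_one]
  have h5 : w = (w.map Complex.re).map Complex.ofReal := by
    ext i j
    have h6 : w i j = starRingEnd ℂ (w i j) := congrFun (congrFun h3 i) j
    exact (Complex.conj_eq_iff_re.1 h6.symm).symm
  refine ⟨w.map Complex.re, ?_, hwe.trans h5⟩
  rw [Matrix.mem_orthogonalGroup_iff]
  have h7 : w * wᴴ = 1 := hwe ▸ unitary_mul_conjTranspose (U⁻¹ * V)
  ext i j
  have h8 := congrArg Complex.re (congrFun (congrFun h7 i) j)
  have him : ∀ i j, (w i j).im = 0 := fun i j =>
    Complex.conj_eq_iff_im.1 (congrFun (congrFun h3 i) j).symm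
  rw [Matrix.mul_apply, Complex.re_sum] at h8
  rw [Matrix.mul_apply]
  refine Eq.trans (Finset.sum_congr rfl fun a _ => ?_) (h8.trans ?_)
  · simp [Complex.mul_re, him]
  · rw [Matrix.one_apply, Matrix.one_apply]
    split_ifs <;> simp

theorem cartanEmbedding_injective : Function.Injective (cartanEmbedding n) := by
  intro a b hab
  induction a using QuotientGroup.induction_on with | H U => ?_
  induction b using QuotientGroup.induction_on with | H V => ?_
  exact QuotientGroup.eq.2 (exists_orthogonal_of_halfSquare_eq hab)

theorem isInducing_cartanEmbedding : IsInducing (cartanEmbedding n) :=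
  (continuous_cartanEmbedding.isClosedEmbedding cartanEmbedding_injective).isInducing

/-- The determinant on `U(n)/SO(n)`. -/
noncomputable def grassmannDet (n : ℕ) : OrientedLagrangianGrassmannian n → ℂ :=
  Quotient.lift (fun U : Matrix.unitaryGroup (Fin n) ℂ => (U : Matrix (Fin n) (Fin n) ℂ).det) (by
    intro U V h
    obtain ⟨A, hA, hUV⟩ := QuotientGroup.leftRel_apply.1 h
    have hV : (V : Matrix (Fin n) (Fin n) ℂ) = U * A.map Complex.ofReal := by
      rw [← hUV, ← Matrix.UnitaryGroup.mul_val, mul_inv_cancel_left]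
    have hA' : (A.map Complex.ofReal).det = 1 := by
      have h2 : (A.map Complex.ofReal).det = (A.det : ℂ) :=
        (RingHom.map_det Complex.ofRealHom A).symm
      rw [h2, (Matrix.mem_specialOrthogonalGroup_iff.1 hA).2, Complex.ofReal_one]
    change (U : Matrix (Fin n) (Fin n) ℂ).det = (V : Matrix (Fin n) (Fin n) ℂ).det
    rw [hV, Matrix.det_mul, hA', mul_one])

/-- The embedding `[U] ↦ (½ U Uᵀ, det U)` of `U(n)/SO(n)`. -/
noncomputable def orientedEmbedding (n : ℕ) (y : OrientedLagrangianGrassmannian n) :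
    EuclideanSpace ℂ (Fin n × Fin n) × ℂ :=
  (cartanImmersion n y, grassmannDet n y)

theorem continuous_orientedEmbedding : Continuous (orientedEmbedding n) := by
  refine (QuotientGroup.isQuotientMap_mk _).continuous_iff.2 ?_
  have h : Continuous fun U : Matrix.unitaryGroup (Fin n) ℂ =>
      (U : Matrix (Fin n) (Fin n) ℂ).det := continuous_subtype_val.matrix_det
  exact continuous_halfSquare.prodMk h

/-- Equality of `½ U Uᵀ` gives `V = U A` with `A` real orthogonal, and equality of the determinants
forces `det A = 1`. The determinant thus separates the two orientations, which `cartanImmersion`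
identifies. -/
theorem orientedEmbedding_injective : Function.Injective (orientedEmbedding n) := by
  intro a b hab
  induction a using QuotientGroup.induction_on with | H U => ?_
  induction b using QuotientGroup.induction_on with | H V => ?_
  obtain ⟨A, hA, hUV⟩ :=
    exists_orthogonal_of_halfSquare_eq (U := U) (V := V) (congrArg Prod.fst hab)
  have hdet : (U : Matrix (Fin n) (Fin n) ℂ).det = (V : Matrix (Fin n) (Fin n) ℂ).det :=
    congrArg Prod.snd hab
  refine QuotientGroup.eq.2 ⟨A, Matrix.mem_specialOrthogonalGroup_iff.2 ⟨hA, ?_⟩, hUV⟩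
  have hV : (V : Matrix (Fin n) (Fin n) ℂ) = U * A.map Complex.ofReal := by
    rw [← hUV, ← Matrix.UnitaryGroup.mul_val, mul_inv_cancel_left]
  have h2 : (A.map Complex.ofReal).det = (A.det : ℂ) :=
    (RingHom.map_det Complex.ofRealHom A).symm
  rw [hV, Matrix.det_mul, h2] at hdet
  have h3 := mul_left_cancel₀ (unitary_det_ne_zero U) ((mul_one _).trans hdet)
  exact_mod_cast h3.symm

theorem isInducing_orientedEmbedding : IsInducing (orientedEmbedding n) :=
  (continuous_orientedEmbedding.isClosedEmbedding orientedEmbedding_injective).isInducing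

theorem norm_det_unitary (U : Matrix.unitaryGroup (Fin n) ℂ) :
    ‖(U : Matrix (Fin n) (Fin n) ℂ).det‖ = 1 := by
  have h := congrArg (fun A : Matrix (Fin n) (Fin n) ℂ => ‖A.det‖) (unitary_mul_conjTranspose U)
  simp only [Matrix.det_mul, Matrix.det_conjTranspose, norm_mul, norm_star, Matrix.det_one,
    norm_one] at h
  nlinarith [norm_nonneg (U : Matrix (Fin n) (Fin n) ℂ).det]

/-- The determinant of a unitary frame, from that of an equally oriented frame. -/
theorem det_eq_div_norm {E : Matrix (Fin n) (Fin n) ℂ} {U : Matrix.unitaryGroup (Fin n) ℂ}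
    {R : Matrix (Fin n) (Fin n) ℝ} (hE : E = (U : Matrix (Fin n) (Fin n) ℂ) * R.map Complex.ofReal)
    (hR : 0 < R.det) : (U : Matrix (Fin n) (Fin n) ℂ).det = E.det / (‖E.det‖ : ℂ) := by
  have h2 : (R.map Complex.ofReal).det = (R.det : ℂ) :=
    (RingHom.map_det Complex.ofRealHom R).symm
  have h3 : (R.det : ℂ) ≠ 0 := by exact_mod_cast hR.ne'
  rw [hE, Matrix.det_mul, h2, norm_mul, norm_det_unitary, one_mul, Complex.norm_real,
    Real.norm_of_nonneg hR.le, mul_div_assoc, div_self h3, mul_one]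

variable {S : Type*} [TopologicalSpace S] [ChartedSpace (Rn n) S] [IsManifold (𝓡 n) ∞ S]
  {M : Type*} [TopologicalSpace M] [ChartedSpace (Cn n) M] [IsManifold 𝓘(ℝ, Cn n) ∞ M]
  {T : EReal} {F : ℝ → S → M}

/-- In a positively oriented chart the coordinate frame is `E = U R` with `det R > 0`, so `det U =
det E / |det E|`, which is continuous in space and time. -/
theorem continuousOn_grassmannDet (hM : HasTranslationAtlas n M)
    (hL : IsLagrangianMeanCurvatureFlow (n := n) T F)
    {o : ∀ p : S, Orientation ℝ (TangentSpace (𝓡 n) p) (Fin n)} (ho : IsManifoldOrientation o)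
    {γ : ℝ → S → OrientedLagrangianGrassmannian n}
    (hγ : IsOrientedGaussMap (n := n) (timeInterval T) o F γ) :
    ContinuousOn (fun z : ℝ × S => grassmannDet n (γ z.1 z.2)) (timeInterval T ×ˢ univ) := by
  rintro ⟨t, p⟩ ⟨ht, -⟩
  obtain ⟨e, he, hpe, heo⟩ := ho p
  obtain ⟨K, Ω, f, h, htK, hxΩ⟩ := exists_isLocalLift hM (convex_timeInterval T)
    (interior_timeInterval_nonempty ht) hL.smoothOn hL.immersion he hpe ht
  have hO : IsOpen (e.source ∩ e ⁻¹' Ω) := e.isOpen_inter_preimage h.isOpen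
  have hval : ∀ s ∈ K, ∀ q ∈ e.source ∩ e ⁻¹' Ω, grassmannDet n (γ s q)
      = (frame (K ×ˢ Ω) f (s, e q)).det / (‖(frame (K ×ˢ Ω) f (s, e q)).det‖ : ℂ) := by
    rintro s hs q ⟨hq, hqΩ⟩
    obtain ⟨x, hx, rfl⟩ : ∃ x ∈ Ω, q = e.symm x := ⟨e q, hqΩ, (e.left_inv hq).symm⟩
    obtain ⟨U, hU, b, hb, hbo⟩ := hγ s (h.subset hs) (e.symm x)
    obtain ⟨c, hc, hco⟩ := heo _ hq
    rw [e.right_inv (h.subset_target hx)] at hc ⊢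
    rw [hU]
    refine det_eq_div_norm (h.frame_eq_unitary_mul hs hx hc hb).1 ?_
    have := (b.orientation_eq_iff_det_pos c).1 (hbo.trans hco.symm)
    rwa [Module.Basis.det_apply] at this
  have hcont : ContinuousOn (fun z : ℝ × S => (frame (K ×ˢ Ω) f (z.1, e z.2)).det
      / (‖(frame (K ×ˢ Ω) f (z.1, e z.2)).det‖ : ℂ)) (K ×ˢ (e.source ∩ e ⁻¹' Ω)) := by
    have hmaps : MapsTo (fun z : ℝ × S => (z.1, e z.2)) (K ×ˢ (e.source ∩ e ⁻¹' Ω)) (K ×ˢ Ω) :=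
      fun z hz => ⟨hz.1, hz.2.2⟩
    have hce : ContinuousOn (fun z : ℝ × S => (z.1, e z.2)) (K ×ˢ (e.source ∩ e ⁻¹' Ω)) :=
      continuousOn_fst.prodMk (e.continuousOn.comp continuousOn_snd fun z hz => hz.2.1)
    have h1 : ContinuousOn (fun z : ℝ × S => (frame (K ×ˢ Ω) f (z.1, e z.2)).det)
        (K ×ˢ (e.source ∩ e ⁻¹' Ω)) :=
      (smoothMatrixOn_frame h.uniqueDiffOn h.contDiffOn).det.continuousOn.comp hce hmaps
    refine h1.div (Complex.continuous_ofReal.comp_continuousOn h1.norm) fun z hz => ?_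
    have := h.det_frame_ne_zero hL he (hmaps hz)
    simpa using this
  have hcongr : ContinuousOn (fun z : ℝ × S => grassmannDet n (γ z.1 z.2))
      (K ×ˢ (e.source ∩ e ⁻¹' Ω)) := hcont.congr fun z hz => hval _ hz.1 _ hz.2
  refine (hcongr (t, p) ⟨htK, hpe, hxΩ⟩).mono_of_mem_nhdsWithin ?_
  rw [nhdsWithin_prod_eq, nhdsWithin_univ]
  exact Filter.prod_mem_prod (h.mem_nhdsWithin t htK) (hO.mem_nhds ⟨hpe, hxΩ⟩)

/-! ### The Gauss map of a Lagrangian mean curvature flow -/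

theorem isHarmonicMapHeatFlow_gaussMap (hM : HasTranslationAtlas n M)
    (hL : IsLagrangianMeanCurvatureFlow (n := n) T F) {γ : ℝ → S → LagrangianGrassmannian n}
    (hγ : IsGaussMap (n := n) (timeInterval T) F γ) :
    IsHarmonicMapHeatFlow (cartanEmbedding n) (timeInterval T)
      (fun t => inducedMetric (n := n) (F t)) γ := by
  have hγ' : IsGaussLift (QuotientGroup.mk (s := orthogonalSubgroup n)) (timeInterval T) F γ := hγ
  have hs := hγ'.smoothOn cartanEmbedding_mk hM hL
  exact ⟨isInducing_cartanEmbedding.continuousOn_iff.2 hs.continuousOn, hs, fun t ht p =>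
    hγ'.heat_eq QuotientGroup.continuous_mk QuotientGroup.mk_surjective cartanEmbedding_mk hM hL
      ht p⟩

theorem isHarmonicMapHeatFlow_orientedGaussMap (hM : HasTranslationAtlas n M)
    (hL : IsLagrangianMeanCurvatureFlow (n := n) T F)
    {o : ∀ p : S, Orientation ℝ (TangentSpace (𝓡 n) p) (Fin n)} (ho : IsManifoldOrientation o)
    {γ : ℝ → S → OrientedLagrangianGrassmannian n}
    (hγ : IsOrientedGaussMap (n := n) (timeInterval T) o F γ) :
    IsHarmonicMapHeatFlow (cartanImmersion n) (timeInterval T)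
      (fun t => inducedMetric (n := n) (F t)) γ := by
  have hγ' : IsGaussLift (QuotientGroup.mk (s := specialOrthogonalSubgroup n)) (timeInterval T)
      F γ := by
    intro t ht p
    obtain ⟨U, hU, b, hb, -⟩ := hγ t ht p
    exact ⟨U, hU, b, hb⟩
  have hs := hγ'.smoothOn cartanImmersion_mk hM hL
  refine ⟨isInducing_orientedEmbedding.continuousOn_iff.2
    (hs.continuousOn.prodMk (continuousOn_grassmannDet hM hL ho hγ)), hs, fun t ht p =>
    hγ'.heat_eq QuotientGroup.continuous_mk QuotientGroup.mk_surjective cartanImmersion_mk hM hL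
      ht p⟩

/-- The statement for an ambient manifold `M` that is locally `ℂⁿ` up to translations. -/
theorem gaussMap_flow (hn : 1 ≤ n) (hM : HasTranslationAtlas n M)
    (hL : IsLagrangianMeanCurvatureFlow (n := n) T F) :
    ((∃ γ, IsGaussMap (n := n) (timeInterval T) F γ) ∧
      ∀ γ, IsGaussMap (n := n) (timeInterval T) F γ →
        IsHarmonicMapHeatFlow (cartanEmbedding n) (timeInterval T)
          (fun t => inducedMetric (n := n) (F t)) γ) ∧
    ∀ o : ∀ p : S, Orientation ℝ (TangentSpace (𝓡 n) p) (Fin n), IsManifoldOrientation o →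
      (∃ γ, IsOrientedGaussMap (n := n) (timeInterval T) o F γ) ∧
      ∀ γ, IsOrientedGaussMap (n := n) (timeInterval T) o F γ →
        IsHarmonicMapHeatFlow (cartanImmersion n) (timeInterval T)
          (fun t => inducedMetric (n := n) (F t)) γ := by
  classical
  refine ⟨⟨?_, fun γ hγ => isHarmonicMapHeatFlow_gaussMap hM hL hγ⟩, fun o ho =>
    ⟨?_, fun γ hγ => isHarmonicMapHeatFlow_orientedGaussMap hM hL ho hγ⟩⟩
  -- A unitary frame is chosen at each point separately; regularity is proved afterwards for every
  -- Gauss map. The value for times outside the interval is arbitrary.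
  · refine ⟨fun t p => if ht : t ∈ timeInterval T then
      QuotientGroup.mk (hL.exists_gaussMap ht p).choose else QuotientGroup.mk 1, fun t ht p => ?_⟩
    exact ⟨_, dif_pos ht, (hL.exists_gaussMap ht p).choose_spec⟩
  · refine ⟨fun t p => if ht : t ∈ timeInterval T then
      QuotientGroup.mk (hL.exists_orientedGaussMap hn ht p (o p)).choose
      else QuotientGroup.mk 1, fun t ht p => ?_⟩
    exact ⟨_, dif_pos ht, (hL.exists_orientedGaussMap hn ht p (o p)).choose_spec⟩

end Continuity

theorem mainTheorem3 (n : ℕ) (hn : 1 ≤ n) {S : Type*} [TopologicalSpace S]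
    [ChartedSpace (Rn n) S] [IsManifold (𝓡 n) ∞ S] (T : EReal) :
    -- the ambient space is `ℂⁿ`
    (∀ F : ℝ → S → Cn n, IsLagrangianMeanCurvatureFlow (n := n) T F →
      ((∃ γ, IsGaussMap (n := n) (timeInterval T) F γ) ∧
        ∀ γ, IsGaussMap (n := n) (timeInterval T) F γ →
          IsHarmonicMapHeatFlow (cartanEmbedding n) (timeInterval T)
            (fun t => inducedMetric (n := n) (F t)) γ) ∧
      ∀ o : ∀ p : S, Orientation ℝ (TangentSpace (𝓡 n) p) (Fin n), IsManifoldOrientation o →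
        (∃ γ, IsOrientedGaussMap (n := n) (timeInterval T) o F γ) ∧
        ∀ γ, IsOrientedGaussMap (n := n) (timeInterval T) o F γ →
          IsHarmonicMapHeatFlow (cartanImmersion n) (timeInterval T)
            (fun t => inducedMetric (n := n) (F t)) γ) ∧
    -- the ambient space is `ℂⁿ ⧸ Λ`, for a lattice `Λ` a flat torus
    (∀ (Λ : AddSubgroup (Cn n)) [DiscreteTopology Λ] (F : ℝ → S → Cn n ⧸ Λ),
      IsLagrangianMeanCurvatureFlow (n := n) T F →
      ((∃ γ, IsGaussMap (n := n) (timeInterval T) F γ) ∧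
        ∀ γ, IsGaussMap (n := n) (timeInterval T) F γ →
          IsHarmonicMapHeatFlow (cartanEmbedding n) (timeInterval T)
            (fun t => inducedMetric (n := n) (F t)) γ) ∧
      ∀ o : ∀ p : S, Orientation ℝ (TangentSpace (𝓡 n) p) (Fin n), IsManifoldOrientation o →
        (∃ γ, IsOrientedGaussMap (n := n) (timeInterval T) o F γ) ∧
        ∀ γ, IsOrientedGaussMap (n := n) (timeInterval T) o F γ →
          IsHarmonicMapHeatFlow (cartanImmersion n) (timeInterval T)
            (fun t => inducedMetric (n := n) (F t)) γ) := by
  exact ⟨fun F hL => gaussMap_flow hn hasTranslationAtlas_self hL,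
    fun Λ _ F hL => gaussMap_flow hn (hasTranslationAtlas_quotient Λ) hL⟩
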